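/- A temporal graph $G=(V,\mathcal E,T)$ consists of a finite node set $V$, a maximal time $T\ge 1$ and a set of temporal arcs $\mathcal E\subseteq V\times V\times\{1,\dots,T\}$; put $n=|V|\ge 1$ and $m=|\mathcal E|$. A (non-strict) temporal walk is a nonempty sequence of arcs $W=(e_1,\dots,e_\ell)$, $e_i=(u_i,v_i,t_i)\in\mathcal E$, with $u_{i+1}=v_i$ and $t_i\le t_{i+1}$ for $1\le i<\ell$; it is strict if moreover $t_i<t_{i+1}$, and $k$-restless ($k\in\mathbb N$) if $t_{i+1}-t_i\le k$. Its length is $\ell$, its arrival time is $\mathrm{arr}(W)=t_\ell$, and it goes from $u_1$ to $v_\ell$. As a passive walk, $W$ visits the temporal nodes $(u_1,t_1)$ and $(v_i,t_i)$ for $1\le i\le\ell$. As an active walk it visits $(u_1,t_1)$, all $(v_i,t)$ with $1\le i<\ell$ and $t_i\le t\le t_{i+1}$, and, waiting on its last node until time $T$, all $(v_\ell,t)$ with $t_\ell\le t\le T$. For nodes $s\ne z$, the optimal $s$-$z$ walks are, for the shortest criterion, the walks of minimal length among all walks from $s$ to $z$; for the shortest $k$-restless criterion, those of minimal length among all $k$-restless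 walks from $s$ to $z$; for the shortest foremost criterion, those minimising $\mathrm{arr}(W)\cdot n+\mathrm{len}(W)$ among all walks from $s$ to $z$. In the strict version only strict walks are admitted. Let $\sigma_{sz}$ be the number of optimal $s$-$z$ walks ($0$ if $s=z$), $\sigma_{sz}(v,t)$ the number of those that visit $(v,t)$, and $$B(v,t)=\sum_{s,z\in V,\ s\ne v\ne z}\delta_{sz}(v,t),\qquad \delta_{sz}(v,t)=\begin{cases}\sigma_{sz}(v,t)/\sigma_{sz}&\text{if }\sigma_{sz}\neq 0,\\ 0&\text{otherwise.}\end{cases}$$ The model of computation is a random access machine with exact rational arithmetic in which every operation takes unit time. The input consists of $n$, $T$, $m$, $k$ and the list of the temporal arcs in an arbitrary order, with nodes numbered $0,\dots,n-1$. **Theorem.** For passive walks, the values $B(v,t)$ of all temporal nodes $(v,t)\in V\times\{1,\dots,T\}$ can be computed in time $O(n^2T+nmT)$ under each of the shortest, shortest $k$-restless and shortest foremost criteria. For active walks, they can be computed in time $O(n^2T^2+nmT)$ under each of the shortest and shortest $k$-restless criteria. Both results hold for the strict and for the non-strict version. In each case one program, with one constant in the $O$, serves all temporal graphs and all $k$.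 -/

import Mathlib

namespace TemporalBetweenness

/-! ## Temporal graphs, temporal walks and betweenness -/

/-- A temporal arc `(src, dst, time)`. -/
structure TArc (V : Type*) where
  src : V
  dst : V
  time : ℕ

/-- A directed temporal graph on the node set `V`: the maximal time step `T` and a finite set of
temporal arcs, a subset of `V × V × {1, …, T}`. -/
structure TemporalGraph (V : Type*) where
  T : ℕ
  arcs : Finset (TArc V)
  time_mem : ∀ e ∈ arcs, 1 ≤ e.time ∧ e.time ≤ T

inductive WalkType
  | passive
  | active

inductive Strictness
  | nonStrict
  | strict

/-- The optimality criteria: shortest, shortest `k`-restless, shortest foremost. -/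
inductive Criterion
  | shortest
  | shortestRestless (k : ℕ)
  | shortestForemost

/-- Compatibility of the times of two consecutive transitions. -/
def Strictness.Compatible : Strictness → ℕ → ℕ → Prop
  | .nonStrict, t, t' => t ≤ t'
  | .strict, t, t' => t < t'

/-- Restriction of a criterion on the times of two consecutive transitions. -/
def Criterion.Allows : Criterion → ℕ → ℕ → Prop
  | .shortest, _, _ => True
  | .shortestRestless k, t, t' => t' - t ≤ k
  | .shortestForemost, _, _ => True

/-- `arr(W)`: the time of the last transition (`0` for the empty list, which is never used). -/
def arrival {V : Type*} (W : List (TArc V)) : ℕ :=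
  match W.getLast? with
  | some e => e.time
  | none => 0

/-- The quantity that a criterion minimises; `n` is the number of nodes of the graph. -/
def Criterion.cost {V : Type*} (cr : Criterion) (n : ℕ) (W : List (TArc V)) : ℕ :=
  match cr with
  | .shortest => W.length
  | .shortestRestless _ => W.length
  | .shortestForemost => arrival W * n + W.length

/-- `[(v, a), (v, a + 1), …, (v, b)]`, empty when `b < a`. -/
def stay {V : Type*} (v : V) (a b : ℕ) : List (V × ℕ) :=
  (List.range' a (b + 1 - a)).map fun t => (v, t)

/-- The first visited temporal node `[(u₁, t₁)]`. -/
def visitedStart {V : Type*} : List (TArc V) → List (V × ℕ)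
  | [] => []
  | e :: _ => [(e.src, e.time)]

/-- The visits of an active walk after its first transition:
`[(vᵢ, t) | tᵢ ≤ t ≤ tᵢ₊₁]` for each `i < k`, and then `[(v_k, t_k)]`. -/
def visitedActive {V : Type*} : List (TArc V) → List (V × ℕ)
  | [] => []
  | [e] => [(e.dst, e.time)]
  | e :: f :: W => stay e.dst e.time f.time ++ visitedActive (f :: W)

/-- The extension of an active walk on its last node up to time `T`. -/
def visitedExtension {V : Type*} (T : ℕ) (W : List (TArc V)) : List (V × ℕ) :=
  match W.getLast? with
  | some e => stay e.dst (e.time + 1) T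
  | none => []

/-- The list of visited temporal nodes. Active walks are extended on their last node up to the
maximal time `T`. -/
def visited {V : Type*} (ty : WalkType) (T : ℕ) (W : List (TArc V)) : List (V × ℕ) :=
  match ty with
  | .passive => visitedStart W ++ W.map fun e => (e.dst, e.time)
  | .active => visitedStart W ++ visitedActive W ++ visitedExtension T W

namespace TemporalGraph

variable {V : Type*} (G : TemporalGraph V)

/-- The (nonempty) temporal walks from `s` to `z` that a criterion and a strictness admit. -/
def walks (st : Strictness) (cr : Criterion) (s z : V) : Set (List (TArc V)) :=
  {W | (∀ e ∈ W, e ∈ G.arcs) ∧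
    W.IsChain (fun e f => f.src = e.dst ∧ st.Compatible e.time f.time ∧ cr.Allows e.time f.time) ∧
    (∃ e, W.head? = some e ∧ e.src = s) ∧ (∃ e, W.getLast? = some e ∧ e.dst = z)}

/-- The optimal walks from `s` to `z`, for two distinct nodes: those of least cost. -/
def optimalWalks [Fintype V] (st : Strictness) (cr : Criterion) (s z : V) :
    Set (List (TArc V)) :=
  {W | s ≠ z ∧ W ∈ G.walks st cr s z ∧
    ∀ W' ∈ G.walks st cr s z, cr.cost (Fintype.card V) W ≤ cr.cost (Fintype.card V) W'}

/-- There are finitely many optimal walks, so `Set.ncard` below counts them. -/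
theorem optimalWalks_finite [Fintype V] (st : Strictness) (cr : Criterion) (s z : V) :
    (G.optimalWalks st cr s z).Finite := by
  rcases (G.optimalWalks st cr s z).eq_empty_or_nonempty with h | ⟨W₀, h₀⟩
  · rw [h]; exact Set.finite_empty
  · refine ((List.finite_length_le {e // e ∈ G.arcs}
      (cr.cost (Fintype.card V) W₀)).image (List.map Subtype.val)).subset ?_
    rintro W ⟨-, hW, hmin⟩
    refine ⟨W.attach.map fun e => ⟨e.1, hW.1 e.1 e.2⟩, ?_, ?_⟩
    · have h1 : W.length ≤ cr.cost (Fintype.card V) W := by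
        cases cr <;> simp [Criterion.cost]
      simpa using h1.trans (hmin W₀ h₀.2.1)
    · simp [List.map_map, Function.comp_def]

/-- `σ_{sz}`: the number of optimal walks from `s` to `z`. -/
noncomputable def sigma [Fintype V] (st : Strictness) (cr : Criterion) (s z : V) : ℕ :=
  (G.optimalWalks st cr s z).ncard

/-- `σ_{sz}(v, t)`: the number of optimal walks from `s` to `z` that visit `(v, t)`. -/
noncomputable def sigmaThrough [Fintype V] (ty : WalkType) (st : Strictness) (cr : Criterion)
    (s z v : V) (t : ℕ) : ℕ :=
  {W ∈ G.optimalWalks st cr s z | (v, t) ∈ visited ty G.T W}.ncard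

/-- `δ_{sz}(v, t)`. -/
noncomputable def delta [Fintype V] (ty : WalkType) (st : Strictness) (cr : Criterion)
    (s z v : V) (t : ℕ) : ℚ :=
  if G.sigma st cr s z = 0 then 0
  else (G.sigmaThrough ty st cr s z v t : ℚ) / (G.sigma st cr s z : ℚ)

open scoped Classical in
/-- The betweenness centrality `B(v, t)` of a temporal node. -/
noncomputable def betweenness [Fintype V] (ty : WalkType) (st : Strictness) (cr : Criterion)
    (v : V) (t : ℕ) : ℚ :=
  ∑ s : V, ∑ z : V, if s ≠ v ∧ v ≠ z then G.delta ty st cr s z v t else 0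

end TemporalGraph

/-! ## The machine model

Programs of a random access machine, in structured form. The memory has word variables, arrays of
words addressed by two words, and arrays of exact rational numbers addressed by two words. On words
there are only constants, successor, truncated subtraction and comparisons; hence a word never
exceeds the largest constant or input word by more than the running time. On rationals there are
constants and the four field operations, and no way to inspect a rational: it can neither be
compared nor turned into a word. Every operation costs one unit of time. -/

/-- Word expressions. -/
inductive WExpr
  | lit (c : ℕ)
  | var (x : ℕ)
  | get (a : ℕ) (i j : WExpr)
  | succ (e : WExpr)
  | sub (e f : WExpr)

/-- Boolean expressions. -/
inductive BExpr
  | lt (e f : WExpr)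
  | eq (e f : WExpr)
  | not (b : BExpr)
  | and (b c : BExpr)
  | or (b c : BExpr)

/-- Rational expressions. -/
inductive QExpr
  | lit (q : ℚ)
  | get (a : ℕ) (i j : WExpr)
  | add (p q : QExpr)
  | sub (p q : QExpr)
  | mul (p q : QExpr)
  | div (p q : QExpr)

/-- Programs. -/
inductive Prog
  | skip
  | assign (x : ℕ) (e : WExpr)
  | store (a : ℕ) (i j e : WExpr)
  | storeQ (a : ℕ) (i j : WExpr) (q : QExpr)
  | seq (p q : Prog)
  | ite (b : BExpr) (p q : Prog)
  | loop (b : BExpr) (p : Prog)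

/-- A memory state: word variables, word arrays and rational arrays, each named by a number. -/
structure Mem where
  var : ℕ → ℕ
  arr : ℕ → ℕ → ℕ → ℕ
  num : ℕ → ℕ → ℕ → ℚ

namespace WExpr

def eval (σ : Mem) : WExpr → ℕ
  | lit c => c
  | var x => σ.var x
  | get a i j => σ.arr a (i.eval σ) (j.eval σ)
  | succ e => e.eval σ + 1
  | sub e f => e.eval σ - f.eval σ

/-- The time to evaluate an expression: one unit for each node of its tree. -/
def time : WExpr → ℕ
  | lit _ => 1
  | var _ => 1
  | get _ i j => i.time + j.time + 1
  | succ e => e.time + 1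
  | sub e f => e.time + f.time + 1

end WExpr

namespace BExpr

def Holds (σ : Mem) : BExpr → Prop
  | lt e f => e.eval σ < f.eval σ
  | eq e f => e.eval σ = f.eval σ
  | not b => ¬ b.Holds σ
  | and b c => b.Holds σ ∧ c.Holds σ
  | or b c => b.Holds σ ∨ c.Holds σ

def time : BExpr → ℕ
  | lt e f => e.time + f.time + 1
  | eq e f => e.time + f.time + 1
  | not b => b.time + 1
  | and b c => b.time + c.time + 1
  | or b c => b.time + c.time + 1

end BExpr

namespace QExpr

/-- Evaluation; a quotient by zero is zero. -/
def eval (σ : Mem) : QExpr → ℚ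
  | lit q => q
  | get a i j => σ.num a (i.eval σ) (j.eval σ)
  | add p q => p.eval σ + q.eval σ
  | sub p q => p.eval σ - q.eval σ
  | mul p q => p.eval σ * q.eval σ
  | div p q => p.eval σ / q.eval σ

def time : QExpr → ℕ
  | lit _ => 1
  | get _ i j => i.time + j.time + 1
  | add p q => p.time + q.time + 1
  | sub p q => p.time + q.time + 1
  | mul p q => p.time + q.time + 1
  | div p q => p.time + q.time + 1

end QExpr

namespace Mem

def setVar (σ : Mem) (x c : ℕ) : Mem :=
  { σ with var := fun y => if y = x then c else σ.var y }

def setArr (σ : Mem) (a i j c : ℕ) : Mem :=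
  { σ with arr := fun a' i' j' => if a' = a ∧ i' = i ∧ j' = j then c else σ.arr a' i' j' }

def setNum (σ : Mem) (a i j : ℕ) (q : ℚ) : Mem :=
  { σ with num := fun a' i' j' => if a' = a ∧ i' = i ∧ j' = j then q else σ.num a' i' j' }

end Mem

/-- `Exec p σ τ σ'`: started in the state `σ`, the program `p` halts in the state `σ'` after exactly
`τ` units of time. -/
inductive Exec : Prog → Mem → ℕ → Mem → Prop
  | skip (σ : Mem) : Exec .skip σ 1 σ
  | assign (σ : Mem) (x : ℕ) (e : WExpr) :
      Exec (.assign x e) σ (e.time + 1) (σ.setVar x (e.eval σ))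
  | store (σ : Mem) (a : ℕ) (i j e : WExpr) :
      Exec (.store a i j e) σ (i.time + j.time + e.time + 1)
        (σ.setArr a (i.eval σ) (j.eval σ) (e.eval σ))
  | storeQ (σ : Mem) (a : ℕ) (i j : WExpr) (q : QExpr) :
      Exec (.storeQ a i j q) σ (i.time + j.time + q.time + 1)
        (σ.setNum a (i.eval σ) (j.eval σ) (q.eval σ))
  | seq {p q : Prog} {σ σ' σ'' : Mem} {τ τ' : ℕ} (hp : Exec p σ τ σ') (hq : Exec q σ' τ' σ'') :
      Exec (.seq p q) σ (τ + τ') σ''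
  | iteTrue {b : BExpr} {p : Prog} (q : Prog) {σ σ' : Mem} {τ : ℕ} (hb : b.Holds σ)
      (hp : Exec p σ τ σ') : Exec (.ite b p q) σ (b.time + 1 + τ) σ'
  | iteFalse {b : BExpr} (p : Prog) {q : Prog} {σ σ' : Mem} {τ : ℕ} (hb : ¬ b.Holds σ)
      (hq : Exec q σ τ σ') : Exec (.ite b p q) σ (b.time + 1 + τ) σ'
  | loopDone {b : BExpr} (p : Prog) {σ : Mem} (hb : ¬ b.Holds σ) :
      Exec (.loop b p) σ (b.time + 1) σ
  | loopStep {b : BExpr} {p : Prog} {σ σ' σ'' : Mem} {τ τ' : ℕ} (hb : b.Holds σ)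
      (hp : Exec p σ τ σ') (hl : Exec (.loop b p) σ' τ' σ'') :
      Exec (.loop b p) σ (b.time + 1 + τ + τ') σ''

/-! ## The computational problem -/

/-- The initial memory for a temporal graph on the nodes `0, …, n - 1`, whose temporal arcs are
listed in `L`, and the parameter `k`. The variables `0, 1, 2, 3` hold `n`, `T`, `m`, `k`; the word
arrays `0, 1, 2` hold at `(i, 0)` the source, the target and the time of the `i`-th arc of `L`.
Everything else is zero. -/
def inputMem {n : ℕ} (G : TemporalGraph (Fin n)) (L : List (TArc (Fin n))) (k : ℕ) : Mem where
  var x :=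
    match x with
    | 0 => n
    | 1 => G.T
    | 2 => L.length
    | 3 => k
    | _ => 0
  arr a i j :=
    match L[i]?, j with
    | some e, 0 =>
      match a with
      | 0 => e.src
      | 1 => e.dst
      | 2 => e.time
      | _ => 0
    | _, _ => 0
  num _ _ _ := 0

/-- The betweenness of all temporal nodes can be computed in time `O(bound n m T)`: a single program
and a single constant serve all temporal graphs with at least one node and one time step, all
parameters `k` of the family `cr` of criteria, and every order in which the arcs may be listed. The
program leaves `B(v, t)` in the rational array `0` at `(v, t)`. -/
def BetweennessComputableIn (ty : WalkType) (st : Strictness) (cr : ℕ → Criterion)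
    (bound : ℕ → ℕ → ℕ → ℕ) : Prop :=
  ∃ (P : Prog) (C : ℕ), ∀ (n : ℕ) (G : TemporalGraph (Fin n)) (L : List (TArc (Fin n))) (k : ℕ),
    0 < n → 0 < G.T → L.Nodup → (∀ e, e ∈ L ↔ e ∈ G.arcs) →
    ∃ (τ : ℕ) (σ : Mem), Exec P (inputMem G L k) τ σ ∧
      τ ≤ C * bound n G.arcs.card G.T ∧
      ∀ (v : Fin n) (t : ℕ), 1 ≤ t → t ≤ G.T →
        σ.num 0 v t = G.betweenness ty st (cr k) v t

end TemporalBetweenness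

open TemporalBetweenness

/-! Fix a source `s`. The temporal nodes, together with an artificial start `(s, 0)`, are the states
of a transition system `tsys` in which an arc `(u, v, t)` leads to `(v, t)`. Whether an arc may
prolong a walk depends on the last temporal node alone; the waiting bound `κ` is `k` in the restless
case and `T`, no restriction at all, otherwise. All criteria minimise `arr · w + len` with `w = 0`
or `w = n`. Since the last temporal node fixes the arrival time, an optimal walk is a shortest path
(geodesic) to the temporal node where it ends, and the optimal `s`-`z` walks are precisely the
geodesics to those `(z, t)` that have the least cost (`mem_optimalWalks`).

Prefixes of geodesics are geodesics (`geo_snoc`), so Brandes' method applies. A breadth-first search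
finds the levels, a forward recurrence counts the geodesics (`sig_succ`), and a backward recurrence
computes for every state `x` a number `A x`. It is the sum of the shares `1 / σ_sz` of the optimal
walks that properly extend a given geodesic to `x`; it depends on `x` only (`sum_prefix`).

A geodesic meets a state at most once, and an optimal walk meets its last node only at its end,
because stopping earlier would be cheaper. Hence for passive walks the source contributes `sig (v,
t) * A (v, t)` to `B(v, t)` (`contribution_passive`).

An active walk visits `(v, t)` if it arrives there or if it waits at `v` across time `t` after an
earlier arrival. Walks that wait are counted by the transition that ends the waiting, which is
unique (`Waits.unique`, `sum_edge`). Walks that do both are counted twice and have to be subtracted: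
such a walk comes to `v` at some `t₁ < t`, leaves at time `t` and returns to `v` within the time
step `t`. Up to `(v, t)` it is a geodesic to `(v, t₁)` followed by a shortest closed walk at `v` of
time `t`. The closed walks do not depend on `s`; they are found beforehand by the same search with
`κ = 0` (`card_returns`, `contribution_active`).

Time: a pass over the levels handles each temporal node once, with the arcs out of its node, which
is `O((n + m) T)` for one source. For active walks every `(v, t₁)` distributes its shares over all
`t` by bucketing arcs by time and taking suffix sums, in `O(T + deg v)`, hence `O(n T² + m T)` for
one source. The programs are verified with timed triples `Runs`. -/

namespace TemporalBetweenness

section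

/-! ## A program logic with time bounds -/

namespace Prog

/-- The program contains an assignment to the variable. -/
def wV : Prog → ℕ → Bool
  | assign x _, y => x == y
  | seq p q, y => p.wV y || q.wV y
  | ite _ p q, y => p.wV y || q.wV y
  | loop _ p, y => p.wV y
  | _, _ => false

/-- The program contains a store to the word array. -/
def wA : Prog → ℕ → Bool
  | store a _ _ _, b => a == b
  | seq p q, y => p.wA y || q.wA y
  | ite _ p q, y => p.wA y || q.wA y
  | loop _ p, y => p.wA y
  | _, _ => false

/-- The program contains a store to the rational array. -/
def wN : Prog → ℕ → Bool
  | storeQ a _ _ _, b => a == b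
  | seq p q, y => p.wN y || q.wN y
  | ite _ p q, y => p.wN y || q.wN y
  | loop _ p, y => p.wN y
  | _, _ => false

/-- What the program does not write to is the same in both states. -/
structure Keeps (p : Prog) (σ σ' : Mem) : Prop where
  var : ∀ x, p.wV x = false → σ'.var x = σ.var x
  arr : ∀ a, p.wA a = false → σ'.arr a = σ.arr a
  num : ∀ a, p.wN a = false → σ'.num a = σ.num a

theorem Keeps.refl (p : Prog) (σ : Mem) : p.Keeps σ σ :=
  ⟨fun _ _ => rfl, fun _ _ => rfl, fun _ _ => rfl⟩

end Prog

/-- The frame rule. As the written names are computed from the program text, a frame condition for a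
concrete program is an equation of Booleans that holds by `rfl`; invariants need only mention what
actually changes. -/
theorem Exec.keeps {p : Prog} {σ σ' : Mem} {τ : ℕ} (h : Exec p σ τ σ') : p.Keeps σ σ' := by
  induction h with
  | skip σ => exact .refl _ _
  | assign σ x e =>
    refine ⟨fun y hy => ?_, fun _ _ => rfl, fun _ _ => rfl⟩
    have : y ≠ x := fun h => by simp [Prog.wV, h] at hy
    simp [Mem.setVar, this]
  | store σ a i j e =>
    refine ⟨fun _ _ => rfl, fun b hb => ?_, fun _ _ => rfl⟩
    have : b ≠ a := fun h => by simp [Prog.wA, h] at hb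
    simp [Mem.setArr, this]
  | storeQ σ a i j e =>
    refine ⟨fun _ _ => rfl, fun _ _ => rfl, fun b hb => ?_⟩
    have : b ≠ a := fun h => by simp [Prog.wN, h] at hb
    simp [Mem.setNum, this]
  | seq _ _ h1 h2 =>
    refine ⟨fun x hx => ?_, fun x hx => ?_, fun x hx => ?_⟩ <;>
      simp only [Prog.wV, Prog.wA, Prog.wN, Bool.or_eq_false_iff] at hx
    · rw [h2.var x hx.2, h1.var x hx.1]
    · rw [h2.arr x hx.2, h1.arr x hx.1]
    · rw [h2.num x hx.2, h1.num x hx.1]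
  | iteTrue _ _ _ h1 =>
    refine ⟨fun x hx => ?_, fun x hx => ?_, fun x hx => ?_⟩ <;>
      simp only [Prog.wV, Prog.wA, Prog.wN, Bool.or_eq_false_iff] at hx
    exacts [h1.var x hx.1, h1.arr x hx.1, h1.num x hx.1]
  | iteFalse _ _ _ h1 =>
    refine ⟨fun x hx => ?_, fun x hx => ?_, fun x hx => ?_⟩ <;>
      simp only [Prog.wV, Prog.wA, Prog.wN, Bool.or_eq_false_iff] at hx
    exacts [h1.var x hx.2, h1.arr x hx.2, h1.num x hx.2]
  | loopDone => exact .refl _ _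
  | loopStep _ _ _ h1 h2 =>
    refine ⟨fun x hx => ?_, fun x hx => ?_, fun x hx => ?_⟩
    · rw [h2.var x hx, h1.var x hx]
    · rw [h2.arr x hx, h1.arr x hx]
    · rw [h2.num x hx, h1.num x hx]

/-- Started in `σ`, the program halts within time `B` in a state that satisfies `Q`. -/
def Runs (p : Prog) (σ : Mem) (B : ℕ) (Q : Mem → Prop) : Prop :=
  ∃ τ σ', Exec p σ τ σ' ∧ τ ≤ B ∧ Q σ'

namespace Runs

variable {p q : Prog} {σ : Mem} {B B' : ℕ} {Q Q' : Mem → Prop}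

theorem mono (h : Runs p σ B Q) (hB : B ≤ B') (hQ : ∀ σ', p.Keeps σ σ' → Q σ' → Q' σ') :
    Runs p σ B' Q' := by
  obtain ⟨τ, σ', hE, hτ, hq⟩ := h
  exact ⟨τ, σ', hE, hτ.trans hB, hQ _ hE.keeps hq⟩

theorem le (h : Runs p σ B Q) (hB : B ≤ B') : Runs p σ B' Q := h.mono hB fun _ _ h => h

theorem skip (h : Q σ) : Runs .skip σ 1 Q := ⟨1, σ, .skip σ, le_rfl, h⟩

theorem seq (h : Runs p σ B fun σ' => Runs q σ' B' Q) : Runs (.seq p q) σ (B + B') Q := by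
  obtain ⟨τ, σ', hE, hτ, τ', σ'', hE', hτ', hq⟩ := h
  exact ⟨_, _, .seq hE hE', Nat.add_le_add hτ hτ', hq⟩

/-- Sequential composition where the second program starts from a state that agrees with the
initial one wherever the first program does not write. -/
theorem seq_keeps (h : Runs p σ B Q') (h' : ∀ σ', p.Keeps σ σ' → Q' σ' → Runs q σ' B' Q) :
    Runs (.seq p q) σ (B + B') Q :=
  seq (h.mono le_rfl h')

theorem ite {b : BExpr} (h : b.Holds σ → Runs p σ B Q) (h' : ¬ b.Holds σ → Runs q σ B Q) :
    Runs (.ite b p q) σ (b.time + 1 + B) Q := by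
  by_cases hb : b.Holds σ
  · obtain ⟨τ, σ', hE, hτ, hq⟩ := h hb
    exact ⟨_, _, .iteTrue q hb hE, by omega, hq⟩
  · obtain ⟨τ, σ', hE, hτ, hq⟩ := h' hb
    exact ⟨_, _, .iteFalse p hb hE, by omega, hq⟩

theorem assign {x : ℕ} {e : WExpr} (h : Q (σ.setVar x (e.eval σ))) :
    Runs (.assign x e) σ (e.time + 1) Q := ⟨_, _, .assign σ x e, le_rfl, h⟩

theorem store {a : ℕ} {i j e : WExpr} (h : Q (σ.setArr a (i.eval σ) (j.eval σ) (e.eval σ))) :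
    Runs (.store a i j e) σ (i.time + j.time + e.time + 1) Q := ⟨_, _, .store σ a i j e, le_rfl, h⟩

theorem storeQ {a : ℕ} {i j : WExpr} {e : QExpr}
    (h : Q (σ.setNum a (i.eval σ) (j.eval σ) (e.eval σ))) :
    Runs (.storeQ a i j e) σ (i.time + j.time + e.time + 1) Q :=
  ⟨_, _, .storeQ σ a i j e, le_rfl, h⟩

end Runs

/-- `for i = 0, …, hi - 1 do body`; the bound `hi` is evaluated once and kept in the variable
`b`. -/
def forLoop (i b : ℕ) (hi : WExpr) (body : Prog) : Prog :=
  .seq (.assign b hi) (.seq (.assign i (.lit 0))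
    (.loop (.lt (.var i) (.var b)) (.seq body (.assign i (.succ (.var i))))))

/-- The invariant sees the arrays only, so it survives the updates of the loop variable; facts about
other variables come from `Keeps`. Each round pays 4 for the test and 3 for the increment, whence `c
j + 7`; the two initial assignments and the last test cost `hi.time + 7`. -/
theorem Runs.forUp {i b : ℕ} {hi : WExpr} {body : Prog} {σ : Mem}
    (I : ℕ → (ℕ → ℕ → ℕ → ℕ) → (ℕ → ℕ → ℕ → ℚ) → Prop) (c : ℕ → ℕ) {N : ℕ}
    (hN : hi.eval σ = N) (hib : (b == i) = false)
    (hi' : body.wV i = false) (hb' : body.wV b = false)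
    (h0 : I 0 σ.arr σ.num)
    (hstep : ∀ j < N, ∀ σ' : Mem, (forLoop i b hi body).Keeps σ σ' →
      σ'.var i = j → I j σ'.arr σ'.num →
      Runs body σ' (c j) fun σ'' => I (j + 1) σ''.arr σ''.num) :
    Runs (forLoop i b hi body) σ (∑ j ∈ Finset.range N, (c j + 7) + hi.time + 7)
      fun σ' => I N σ'.arr σ'.num := by
  have hbi : b ≠ i := by simpa using hib
  set P := forLoop i b hi body with hP
  -- Induction on the number `r` of rounds still to come.
  have key : ∀ r j, j + r = N → ∀ σ' : Mem, P.Keeps σ σ' → σ'.var i = j → σ'.var b = N →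
      I j σ'.arr σ'.num →
      Runs (.loop (.lt (.var i) (.var b)) (.seq body (.assign i (.succ (.var i))))) σ'
        (∑ j ∈ Finset.Ico j N, (c j + 7) + 4) fun σ' => I N σ'.arr σ'.num := by
    intro r
    induction r with
    | zero =>
      intro j hj σ' _ hi hb hI
      refine ⟨_, _, .loopDone _ ?_, ?_, ?_⟩
      · simp [BExpr.Holds, WExpr.eval, hi, hb]; omega
      · simp [BExpr.time, WExpr.time]
      · have : j = N := by omega
        exact this ▸ hI
    | succ r ih =>
      intro j hj σ' hk hi hb hI
      have hjN : j < N := by omega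
      obtain ⟨τ, σ₁, hE, hτ, hI₁⟩ := hstep j hjN σ' hk hi hI
      have k₁ := hE.keeps
      have hE₂ := Exec.seq hE (Exec.assign σ₁ i (.succ (.var i)))
      have hi₁ : σ₁.var i = j := by rw [k₁.var i hi', hi]
      have hb₁ : σ₁.var b = N := by rw [k₁.var b hb', hb]
      obtain ⟨τ', σ₂, hE₃, hτ', hI₂⟩ := ih (j + 1) (by omega)
        (σ₁.setVar i ((WExpr.succ (.var i)).eval σ₁)) ⟨fun x hx => by
          have hx' := hx
          simp only [hP, forLoop, Prog.wV, Bool.or_eq_false_iff] at hx'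
          have := hE₂.keeps.var x (by simp only [Prog.wV, Bool.or_eq_false_iff]; exact hx'.2.2)
          rw [this, hk.var x hx], fun x hx => by
          have hx' := hx
          simp only [hP, forLoop, Prog.wA, Bool.or_eq_false_iff] at hx'
          have := hE₂.keeps.arr x (by simp only [Prog.wA, Bool.or_eq_false_iff]; exact hx'.2.2)
          rw [this, hk.arr x hx], fun x hx => by
          have hx' := hx
          simp only [hP, forLoop, Prog.wN, Bool.or_eq_false_iff] at hx'
          have := hE₂.keeps.num x (by simp only [Prog.wN, Bool.or_eq_false_iff]; exact hx'.2.2)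
          rw [this, hk.num x hx]⟩
        (by simp [Mem.setVar, WExpr.eval, hi₁]) (by simp [Mem.setVar, hbi, hb₁]) hI₁
      refine ⟨_, _, .loopStep ?_ hE₂ hE₃, ?_, hI₂⟩
      · simp [BExpr.Holds, WExpr.eval, hi, hb, hjN]
      · rw [← Finset.add_sum_Ioo_eq_sum_Ico hjN]
        have : Finset.Ioo j N = Finset.Ico (j + 1) N := by ext; simp
        rw [this]
        simp only [BExpr.time, WExpr.time]
        omega
  have hE := Exec.assign σ b hi
  have hE' := Exec.assign (σ.setVar b (hi.eval σ)) i (.lit 0)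
  obtain ⟨τ, σ₂, hE₂, hτ, hI⟩ := key N 0 (by omega)
    ((σ.setVar b (hi.eval σ)).setVar i ((WExpr.lit 0).eval (σ.setVar b (hi.eval σ))))
    ⟨fun x hx => by
      simp only [hP, forLoop, Prog.wV, Bool.or_eq_false_iff] at hx
      rw [hE'.keeps.var x (by simp only [Prog.wV]; exact hx.2.1),
        hE.keeps.var x (by simp only [Prog.wV]; exact hx.1)], fun _ _ => rfl, fun _ _ => rfl⟩
    (by simp [Mem.setVar, WExpr.eval]) (by simp [Mem.setVar, hbi, hN]) h0
  refine ⟨_, _, .seq hE (.seq hE' hE₂), ?_, hI⟩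
  rw [Finset.range_eq_Ico]
  simp only [WExpr.time]
  omega

/-- The variant of `Runs.forUp` for a constant bound on the time of an iteration. -/
theorem Runs.forUp_const {i b : ℕ} {hi : WExpr} {body : Prog} {σ : Mem}
    (I : ℕ → (ℕ → ℕ → ℕ → ℕ) → (ℕ → ℕ → ℕ → ℚ) → Prop) (c : ℕ) {N B : ℕ}
    (hN : hi.eval σ = N) (hib : (b == i) = false)
    (hi' : body.wV i = false) (hb' : body.wV b = false)
    (hB : N * (c + 7) + hi.time + 7 ≤ B)
    (h0 : I 0 σ.arr σ.num)
    (hstep : ∀ j < N, ∀ σ' : Mem, (forLoop i b hi body).Keeps σ σ' →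
      σ'.var i = j → I j σ'.arr σ'.num →
      Runs body σ' c fun σ'' => I (j + 1) σ''.arr σ''.num) :
    Runs (forLoop i b hi body) σ B fun σ' => I N σ'.arr σ'.num :=
  (Runs.forUp I (fun _ => c) hN hib hi' hb' h0 hstep).le (by simpa using hB)

end

section

/-! ## Shortest paths in a labelled transition system -/

/-- A transition system: the label `e` leads from each state `x` with `ok x e` to `tgt e`. -/
structure TS (E X : Type*) where
  arcs : Finset E
  ok : X → E → Prop
  tgt : E → X
  start : X

namespace TS

variable {E X : Type*} (S : TS E X)

/-- The state reached by a list of labels. -/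
def tip (W : List E) : X := W.foldl (fun _ e => S.tgt e) S.start

@[simp] theorem tip_nil : S.tip [] = S.start := rfl

@[simp] theorem tip_append_singleton (W : List E) (e : E) : S.tip (W ++ [e]) = S.tgt e := by
  simp [tip]

inductive Path : List E → Prop
  | nil : Path []
  | snoc {W : List E} {e : E} (h : Path W) (he : e ∈ S.arcs) (hok : S.ok (S.tip W) e) :
      Path (W ++ [e])

theorem path_snoc {W : List E} {e : E} :
    S.Path (W ++ [e]) ↔ S.Path W ∧ e ∈ S.arcs ∧ S.ok (S.tip W) e := by
  refine ⟨fun h => ?_, fun h => .snoc h.1 h.2.1 h.2.2⟩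
  generalize hW' : W ++ [e] = W' at h
  cases h with
  | nil => simp at hW'
  | snoc h he hok =>
    obtain ⟨rfl, h2⟩ := List.append_inj' hW' rfl
    cases h2
    exact ⟨h, he, hok⟩

theorem Path.mem {W : List E} (h : S.Path W) : ∀ e ∈ W, e ∈ S.arcs := by
  induction h with
  | nil => simp
  | snoc _ he _ ih =>
    intro e' he'
    rcases List.mem_append.1 he' with h | h
    · exact ih _ h
    · rw [List.mem_singleton.1 h]; exact he

/-- One more than the least length of a path to `x`, and `0` if there is none. -/
noncomputable def lvl (x : X) : ℕ := sInf {d | ∃ W, S.Path W ∧ S.tip W = x ∧ W.length + 1 = d}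

/-- Geodesics: the shortest paths to their last state. -/
def Geo (W : List E) : Prop := S.Path W ∧ W.length + 1 = S.lvl (S.tip W)

variable {S}

theorem Path.lvl_le {W : List E} (h : S.Path W) : S.lvl (S.tip W) ≤ W.length + 1 :=
  Nat.sInf_le ⟨W, h, rfl, rfl⟩

theorem exists_geo {x : X} (h : S.lvl x ≠ 0) : ∃ W, S.Geo W ∧ S.tip W = x := by
  have hne : {d | ∃ W, S.Path W ∧ S.tip W = x ∧ W.length + 1 = d}.Nonempty :=
    Nat.nonempty_of_pos_sInf (Nat.pos_of_ne_zero h)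
  obtain ⟨W, h1, h2, h3⟩ := Nat.sInf_mem hne
  exact ⟨W, ⟨h1, h2 ▸ h3⟩, h2⟩

theorem Path.lvl_pos {W : List E} (h : S.Path W) : S.lvl (S.tip W) ≠ 0 := by
  have hne : {d | ∃ W', S.Path W' ∧ S.tip W' = S.tip W ∧ W'.length + 1 = d}.Nonempty :=
    ⟨_, W, h, rfl, rfl⟩
  obtain ⟨W', -, -, h3⟩ := Nat.sInf_mem hne
  unfold lvl
  omega

theorem lvl_start : S.lvl S.start = 1 := by
  have h1 : S.lvl S.start ≤ 1 := (Path.nil (S := S)).lvl_le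
  have h2 : S.lvl S.start ≠ 0 := (Path.nil (S := S)).lvl_pos
  omega

theorem Geo.length {W : List E} (h : S.Geo W) : W.length = S.lvl (S.tip W) - 1 := by
  have := h.2; omega

theorem geo_nil : S.Geo [] := ⟨.nil, by simp [lvl_start]⟩

theorem lvl_eq_one {x : X} : S.lvl x = 1 ↔ x = S.start := by
  refine ⟨fun h => ?_, fun h => h ▸ lvl_start⟩
  obtain ⟨W, hW, rfl⟩ := exists_geo (S := S) (x := x) (by omega)
  have : W = [] := List.eq_nil_of_length_eq_zero (by rw [hW.length]; omega)
  simp [this]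

theorem lvl_tgt_le {x : X} {e : E} (hx : S.lvl x ≠ 0) (he : e ∈ S.arcs) (hok : S.ok x e) :
    S.lvl (S.tgt e) ≤ S.lvl x + 1 := by
  obtain ⟨W, hW, rfl⟩ := exists_geo hx
  have := (Path.snoc hW.1 he hok).lvl_le
  simp only [tip_append_singleton, List.length_append, List.length_singleton] at this
  rw [← hW.2]
  exact this

theorem lvl_tgt_pos {x : X} {e : E} (hx : S.lvl x ≠ 0) (he : e ∈ S.arcs) (hok : S.ok x e) :
    S.lvl (S.tgt e) ≠ 0 := by
  obtain ⟨W, hW, rfl⟩ := exists_geo hx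
  have := (Path.snoc hW.1 he hok).lvl_pos
  simpa using this

/-- Optimal substructure: if a shortest path to `tgt e` ends with `e`, then what precedes `e` is
shortest to its own last state, since `ok` depends on that state only and a shorter path could be
substituted. -/
theorem geo_snoc {W : List E} {e : E} :
    S.Geo (W ++ [e]) ↔
      S.Geo W ∧ e ∈ S.arcs ∧ S.ok (S.tip W) e ∧ S.lvl (S.tgt e) = S.lvl (S.tip W) + 1 := by
  constructor
  · rintro ⟨h1, h2⟩
    rw [path_snoc] at h1
    obtain ⟨hW, he, hok⟩ := h1
    have h3 := hW.lvl_le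
    have h4 := lvl_tgt_le hW.lvl_pos he hok
    simp only [tip_append_singleton, List.length_append, List.length_singleton] at h2
    exact ⟨⟨hW, by omega⟩, he, hok, by omega⟩
  · rintro ⟨⟨hW, hl⟩, he, hok, h⟩
    exact ⟨.snoc hW he hok, by simp [h, hl]⟩

theorem Geo.of_append {W W' : List E} (h : S.Geo (W ++ W')) : S.Geo W := by
  induction W' using List.reverseRecOn with
  | nil => simpa using h
  | append_singleton l e ih =>
    rw [← List.append_assoc, geo_snoc] at h
    exact ih h.1

theorem Geo.of_prefix {W W' : List E} (h : S.Geo W') (hp : W <+: W') : S.Geo W := by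
  obtain ⟨t, rfl⟩ := hp
  exact h.of_append

/-- The states of one level are the new targets of the labels from the level before. -/
theorem lvl_eq_succ {y : X} {d : ℕ} (hd : d ≠ 0) :
    S.lvl y = d + 1 ↔
      (S.lvl y = 0 ∨ d < S.lvl y) ∧ ∃ x e, S.lvl x = d ∧ e ∈ S.arcs ∧ S.ok x e ∧ S.tgt e = y := by
  constructor
  · intro h
    refine ⟨by omega, ?_⟩
    obtain ⟨W, hW, rfl⟩ := exists_geo (S := S) (x := y) (by omega)
    induction W using List.reverseRecOn with
    | nil => simp [lvl_start] at h; omega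
    | append_singleton W e _ =>
      rw [geo_snoc] at hW
      rw [tip_append_singleton] at h
      exact ⟨S.tip W, e, by omega, hW.2.1, hW.2.2.1, by simp⟩
  · rintro ⟨h, x, e, rfl, he, hok, rfl⟩
    have := lvl_tgt_le hd he hok
    have := lvl_tgt_pos hd he hok
    omega

/-! ### Counting geodesics and accumulating weights along them -/

section finite

variable (St : Finset X)

/-- A finite set that contains all reachable states. -/
def Within (S : TS E X) (St : Finset X) : Prop := S.start ∈ St ∧ ∀ e ∈ S.arcs, S.tgt e ∈ St

variable {St}

theorem Within.tip_mem (hS : S.Within St) {W : List E} (h : S.Path W) : S.tip W ∈ St := by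
  cases h with
  | nil => exact hS.1
  | snoc _ he _ => simpa using hS.2 _ he

theorem Within.mem (hS : S.Within St) {x : X} (h : S.lvl x ≠ 0) : x ∈ St := by
  obtain ⟨W, hW, rfl⟩ := exists_geo h
  exact hS.tip_mem hW.1

/-- No level below an occupied one is empty, so a state of level `d` entails at least `d` states of
levels `1, …, d`. This bounds the number of levels that the program has to run through. -/
theorem Within.lvl_le (hS : S.Within St) (x : X) : S.lvl x ≤ St.card := by
  classical
  have key : ∀ d, ∀ x, S.lvl x = d → d ≤ (St.filter fun y => S.lvl y ≠ 0 ∧ S.lvl y ≤ d).card := by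
    intro d
    induction d with
    | zero => simp
    | succ d ih =>
      intro x hx
      have h1 : d ≤ (St.filter fun y => S.lvl y ≠ 0 ∧ S.lvl y ≤ d).card := by
        rcases Nat.eq_zero_or_pos d with rfl | hd
        · simp
        · obtain ⟨-, y, e, hy, -⟩ := (lvl_eq_succ (by omega)).1 hx
          exact ih y hy
      have h2 : x ∉ St.filter fun y => S.lvl y ≠ 0 ∧ S.lvl y ≤ d := by simp [hx]
      calc d + 1 ≤ (insert x (St.filter fun y => S.lvl y ≠ 0 ∧ S.lvl y ≤ d)).card := by
            rw [Finset.card_insert_of_notMem h2]; omega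
        _ ≤ _ := by
            refine Finset.card_le_card fun y hy => ?_
            rcases Finset.mem_insert.1 hy with rfl | hy
            · simp [hx, hS.mem (S := S) (x := y) (by omega)]
            · simp only [Finset.mem_filter] at hy ⊢
              exact ⟨hy.1, hy.2.1, by omega⟩
  exact (key _ x rfl).trans (Finset.card_le_card (Finset.filter_subset _ _))

theorem Within.geo_finite (hS : S.Within St) : {W | S.Geo W}.Finite := by
  refine ((List.finite_length_le {e // e ∈ S.arcs} St.card).image
    (List.map Subtype.val)).subset ?_
  intro W hW
  refine ⟨W.attach.map fun e => ⟨e.1, hW.1.mem S e.1 e.2⟩, ?_, ?_⟩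
  · have h1 := hW.2
    have h2 := hS.lvl_le (S.tip W)
    simp only [Set.mem_ofPred_eq, List.length_map, List.length_attach]
    omega
  · simp [List.map_map, Function.comp_def]

open scoped Classical in
/-- The set of all geodesics. -/
noncomputable def geos (S : TS E X) : Finset (List E) :=
  if h : {W | S.Geo W}.Finite then h.toFinset else ∅

theorem Within.mem_geos (hS : S.Within St) {W : List E} : W ∈ S.geos ↔ S.Geo W := by
  simp [geos, hS.geo_finite]

open scoped Classical in
/-- The set of the geodesics to `x`. -/
noncomputable def geosTo (S : TS E X) (x : X) : Finset (List E) := S.geos.filter (S.tip · = x)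

theorem Within.mem_geosTo (hS : S.Within St) {W : List E} {x : X} :
    W ∈ S.geosTo x ↔ S.Geo W ∧ S.tip W = x := by
  simp [geosTo, hS.mem_geos]

/-- The number of geodesics to `x`. -/
noncomputable def sig (S : TS E X) (x : X) : ℚ := ((S.geosTo x).card : ℚ)

theorem Within.sig_start (hS : S.Within St) : S.sig S.start = 1 := by
  have : S.geosTo S.start = {[]} := by
    ext W
    rw [hS.mem_geosTo, Finset.mem_singleton]
    constructor
    · rintro ⟨h1, h2⟩
      have := h1.2
      rw [h2, lvl_start] at this
      exact List.eq_nil_of_length_eq_zero (by omega)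
    · rintro rfl
      exact ⟨geo_nil, rfl⟩
  simp [sig, this]

theorem Within.sig_eq_zero (hS : S.Within St) {x : X} (hx : S.lvl x = 0) : S.sig x = 0 := by
  have : S.geosTo x = ∅ := by
    ext W
    simp only [hS.mem_geosTo, Finset.notMem_empty, iff_false]
    rintro ⟨h1, rfl⟩
    exact h1.1.lvl_pos hx
  simp [sig, this]

/-- Summation over the geodesics, by their last states. -/
theorem Within.sum_geos (hS : S.Within St) (f : X → ℚ) :
    ∑ W ∈ S.geos, f (S.tip W) = ∑ x ∈ St, S.sig x * f x := by
  classical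
  rw [← Finset.sum_fiberwise_of_maps_to (g := S.tip) (t := St)
    (fun W hW => hS.tip_mem (hS.mem_geos.1 hW).1)]
  refine Finset.sum_congr rfl fun x _ => ?_
  rw [Finset.sum_congr rfl (g := fun _ => f x) (fun W hW => by rw [(Finset.mem_filter.1 hW).2]),
    Finset.sum_const, nsmul_eq_mul]
  simp only [sig, geosTo]

open scoped Classical in
-- Removing the last label is a bijection from the geodesics to `y` onto the pairs of a geodesic to
-- a state of level `d` and a label from there to `y`.
theorem Within.sig_succ (hS : S.Within St) {y : X} {d : ℕ} (hd : d ≠ 0) (hy : S.lvl y = d + 1) :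
    S.sig y = ∑ x ∈ St with S.lvl x = d, ∑ e ∈ S.arcs with S.ok x e,
      if S.tgt e = y then S.sig x else 0 := by
  have h1 : S.sig y = ∑ W ∈ S.geos, ∑ e ∈ S.arcs,
      if S.lvl (S.tip W) = d ∧ S.ok (S.tip W) e ∧ S.tgt e = y then (1 : ℚ) else 0 := by
    rw [← Finset.sum_product', Finset.sum_boole, sig]
    congr 1
    symm
    refine Finset.card_bij (fun p _ => p.1 ++ [p.2]) ?_ ?_ ?_
    · rintro ⟨W, e⟩ h
      simp only [Finset.mem_filter, Finset.mem_product, hS.mem_geos] at h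
      obtain ⟨⟨hW, he⟩, hl, hok, rfl⟩ := h
      dsimp only at hl hok hW he hy ⊢
      rw [hS.mem_geosTo, geo_snoc]
      exact ⟨⟨hW, he, hok, by omega⟩, by simp⟩
    · rintro ⟨W, e⟩ _ ⟨W', e'⟩ _ h
      obtain ⟨rfl, h2⟩ := List.append_inj' h rfl
      cases h2; rfl
    · intro W hW
      rw [hS.mem_geosTo] at hW
      obtain ⟨hW, rfl⟩ := hW
      induction W using List.reverseRecOn with
      | nil => simp [lvl_start] at hy; omega
      | append_singleton W e _ =>
        rw [geo_snoc] at hW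
        rw [tip_append_singleton] at hy ⊢
        refine ⟨(W, e), ?_, rfl⟩
        simp only [Finset.mem_filter, Finset.mem_product, hS.mem_geos]
        exact ⟨⟨hW.1, hW.2.1⟩, by omega, hW.2.2.1, trivial⟩
  rw [h1, hS.sum_geos (fun x => ∑ e ∈ S.arcs, if S.lvl x = d ∧ S.ok x e ∧ S.tgt e = y then 1 else 0),
    Finset.sum_filter]
  refine Finset.sum_congr rfl fun x _ => ?_
  by_cases hx : S.lvl x = d
  · simp only [hx, true_and, if_true]
    rw [Finset.mul_sum, Finset.sum_filter]
    refine Finset.sum_congr rfl fun e _ => ?_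
    by_cases h1 : S.ok x e <;> by_cases h2 : S.tgt e = y <;> simp [h1, h2]
  · simp [hx]

open scoped Classical in
/-- A proper extension of a geodesic starts with exactly one label. -/
theorem Geo.prefix_ne_iff {W W' : List E} (h : S.Geo W') :
    (if W <+: W' ∧ W ≠ W' then (1 : ℚ) else 0) =
      ∑ e ∈ S.arcs, if W ++ [e] <+: W' then (1 : ℚ) else 0 := by
  split_ifs with hW
  · obtain ⟨⟨t, rfl⟩, hne⟩ := hW
    cases t with
    | nil => simp at hne
    | cons e t =>
      have he : e ∈ S.arcs := h.1.mem S e (by simp)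
      rw [Finset.sum_eq_single_of_mem e he]
      · rw [if_pos ⟨t, by simp⟩]
      · intro e' _ hne'
        rw [if_neg]
        rintro ⟨t', ht'⟩
        rw [List.append_assoc, List.append_cancel_left_eq] at ht'
        exact hne' (by simpa using (List.cons.inj ht').1)
  · symm
    refine Finset.sum_eq_zero fun e _ => if_neg ?_
    rintro ⟨t, rfl⟩
    exact hW ⟨⟨[e] ++ t, by simp⟩, fun h => by simpa using congrArg List.length h⟩

/-- `A` solves the recurrence for the values accumulated along the geodesics. -/
def Accumulates (S : TS E X) (τ A : X → ℚ) : Prop :=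
  open scoped Classical in
  ∀ x, S.lvl x ≠ 0 → A x = ∑ e ∈ S.arcs with S.ok x e,
    if S.lvl (S.tgt e) = S.lvl x + 1 then A (S.tgt e) + τ (S.tgt e) else 0

open scoped Classical in
-- Brandes' backward recurrence. A proper extension of `W` among the geodesics extends exactly one
-- `W ++ [e]`, which is itself a geodesic; the labels `e` that can occur depend on the last state of
-- `W` only. The two sums differ by the term of `W` itself.
theorem Within.sum_prefix (hS : S.Within St) {τ A : X → ℚ} (hA : S.Accumulates τ A) :
    ∀ W, S.Geo W → ∑ W' ∈ S.geos, (if W <+: W' ∧ W ≠ W' then 1 else 0) * τ (S.tip W') =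
        A (S.tip W) ∧
      ∑ W' ∈ S.geos, (if W <+: W' then 1 else 0) * τ (S.tip W') =
        A (S.tip W) + τ (S.tip W) := by
  -- Downward induction on the level; at `r = 0` the level would exceed the bound of
  -- `Within.lvl_le`.
  have key : ∀ r W, S.Geo W → S.lvl (S.tip W) + r = St.card + 1 →
      ∑ W' ∈ S.geos, (if W <+: W' ∧ W ≠ W' then 1 else 0) * τ (S.tip W') = A (S.tip W) ∧
      ∑ W' ∈ S.geos, (if W <+: W' then 1 else 0) * τ (S.tip W') =
        A (S.tip W) + τ (S.tip W) := by
    intro r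
    induction r with
    | zero =>
      intro W hW h
      have := hS.lvl_le (S.tip W)
      omega
    | succ r ih =>
      intro W hW h
      have h1 : ∑ W' ∈ S.geos, (if W <+: W' ∧ W ≠ W' then 1 else 0) * τ (S.tip W') =
          A (S.tip W) := by
        rw [hA _ hW.1.lvl_pos, Finset.sum_congr rfl fun W' hW' => by
          rw [Geo.prefix_ne_iff (S := S) (hS.mem_geos.1 hW'), Finset.sum_mul], Finset.sum_comm,
          Finset.sum_filter]
        refine Finset.sum_congr rfl fun e he => ?_
        -- If `W ++ [e]` is not a geodesic, then no geodesic extends it, and by `geo_snoc` the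
        -- recurrence has no term for `e` either.
        by_cases hg : S.Geo (W ++ [e])
        · have hg' := geo_snoc.1 hg
          rw [if_pos hg'.2.2.1, if_pos hg'.2.2.2]
          have := (ih (W ++ [e]) hg (by rw [tip_append_singleton]; omega)).2
          rwa [tip_append_singleton] at this
        · have : ¬ (S.ok (S.tip W) e ∧ S.lvl (S.tgt e) = S.lvl (S.tip W) + 1) := fun hh =>
            hg (geo_snoc.2 ⟨hW, he, hh⟩)
          rw [← ite_and, if_neg this]
          refine Finset.sum_eq_zero fun W' hW' => ?_
          rw [if_neg fun hp => hg ((hS.mem_geos.1 hW').of_prefix hp), zero_mul]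
      refine ⟨h1, ?_⟩
      rw [← h1, ← Finset.sum_erase_add _ _ (hS.mem_geos.2 hW)]
      conv_rhs => rw [← Finset.sum_erase_add _ _ (hS.mem_geos.2 hW)]
      simp only [List.prefix_rfl, ne_eq, not_true_eq_false, and_false, if_false, if_true, one_mul,
        zero_mul, add_zero]
      congr 1
      refine Finset.sum_congr rfl fun W' hW' => ?_
      simp [(Finset.mem_erase.1 hW').1.symm]
  intro W hW
  have := hS.lvl_le (S.tip W)
  exact key (St.card + 1 - S.lvl (S.tip W)) W hW (by omega)

/-- Two geodesics to the same state that are prefixes of the same list are equal. -/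
theorem Geo.eq_of_prefix {W W' W₂ : List E} (h : S.Geo W) (h' : S.Geo W') (hp : W <+: W₂)
    (hp' : W' <+: W₂) (hs : S.tip W = S.tip W') : W = W' := by
  refine List.IsPrefix.eq_of_length (List.prefix_of_prefix_length_le hp hp' ?_) ?_ <;>
    · have := h.2; have := h'.2; rw [← hs] at this; omega

open scoped Classical in
/-- The weight of the geodesics that pass through `x` on a path with the property `Q`. -/
theorem Within.sum_through (hS : S.Within St) {τ A : X → ℚ} (hA : S.Accumulates τ A) (x : X)
    (Q : List E → Prop) :
    ∑ W' ∈ S.geos, (if ∃ W, W <+: W' ∧ W ≠ W' ∧ S.tip W = x ∧ Q W then 1 else 0) * τ (S.tip W') =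
      ((S.geosTo x).filter Q).card * A x := by
  have h1 : ∀ W' ∈ S.geos,
      (if ∃ W, W <+: W' ∧ W ≠ W' ∧ S.tip W = x ∧ Q W then (1 : ℚ) else 0) =
      ∑ W ∈ (S.geosTo x).filter Q, if W <+: W' ∧ W ≠ W' then 1 else 0 := by
    intro W' hW'
    rw [hS.mem_geos] at hW'
    split_ifs with h
    · obtain ⟨W, hp, hne, rfl, hQ⟩ := h
      have hG := hW'.of_prefix hp
      rw [Finset.sum_eq_single_of_mem W (Finset.mem_filter.2 ⟨hS.mem_geosTo.2 ⟨hG, rfl⟩, hQ⟩),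
        if_pos ⟨hp, hne⟩]
      -- Geodesics to `x` have equal lengths, so at most one of them is a prefix of `W'`.
      intro W₂ hW₂ hne₂
      rw [Finset.mem_filter, hS.mem_geosTo] at hW₂
      exact if_neg fun hh => hne₂ (hW₂.1.1.eq_of_prefix hG hh.1 hp hW₂.1.2)
    · symm
      refine Finset.sum_eq_zero fun W hW => if_neg fun hh => h ⟨W, hh.1, hh.2, ?_⟩
      rw [Finset.mem_filter, hS.mem_geosTo] at hW
      exact ⟨hW.1.2, hW.2⟩
  rw [Finset.sum_congr rfl fun W' hW' => by rw [h1 W' hW', Finset.sum_mul], Finset.sum_comm]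
  trans ∑ W ∈ (S.geosTo x).filter Q, A x
  · refine Finset.sum_congr rfl fun W hW => ?_
    rw [Finset.mem_filter, hS.mem_geosTo] at hW
    rw [(hS.sum_prefix hA W hW.1.1).1, hW.1.2]
  · rw [Finset.sum_const, nsmul_eq_mul]

open scoped Classical in
/-- The weight of the geodesics with a transition that satisfies `p`, provided that no geodesic has
more than one. -/
theorem Within.sum_edge (hS : S.Within St) {τ A : X → ℚ} (hA : S.Accumulates τ A)
    (p : X → E → Prop)
    (hp : ∀ W', S.Geo W' → ∀ W₁ e₁ W₂ e₂, W₁ ++ [e₁] <+: W' → W₂ ++ [e₂] <+: W' →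
      p (S.tip W₁) e₁ → p (S.tip W₂) e₂ → W₁ = W₂) :
    ∑ W' ∈ S.geos,
        (if ∃ W e, W ++ [e] <+: W' ∧ p (S.tip W) e then 1 else 0) * τ (S.tip W') =
      ∑ x ∈ St, S.sig x * ∑ e ∈ S.arcs with S.ok x e,
        if S.lvl (S.tgt e) = S.lvl x + 1 ∧ p x e then A (S.tgt e) + τ (S.tgt e) else 0 := by
  have h1 : ∀ W' ∈ S.geos,
      (if ∃ W e, W ++ [e] <+: W' ∧ p (S.tip W) e then (1 : ℚ) else 0) =
      ∑ W ∈ S.geos, ∑ e ∈ S.arcs, if p (S.tip W) e then (if W ++ [e] <+: W' then 1 else 0)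
        else 0 := by
    intro W' hW'
    rw [hS.mem_geos] at hW'
    rw [← Finset.sum_product']
    split_ifs with h
    · obtain ⟨W, e, hpre, hpe⟩ := h
      have hG := hW'.of_prefix hpre
      have hG' := geo_snoc.1 hG
      rw [Finset.sum_eq_single_of_mem (W, e)
        (Finset.mem_product.2 ⟨hS.mem_geos.2 hG'.1, hG'.2.1⟩), if_pos hpe, if_pos hpre]
      -- By `hp` the position of the transition in `W'` is determined, and with it the label.
      rintro ⟨W₂, e₂⟩ - hne₂
      split_ifs with h1 h2
      · refine absurd ?_ hne₂
        obtain rfl := hp W' hW' _ _ _ _ h2 hpre h1 hpe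
        have := (List.prefix_of_prefix_length_le h2 hpre (by simp)).eq_of_length (by simp)
        simpa using this
      · rfl
      · rfl
    · symm
      refine Finset.sum_eq_zero fun q hq => ?_
      split_ifs with h1 h2
      · exact absurd ⟨_, _, h2, h1⟩ h
      · rfl
      · rfl
  rw [Finset.sum_congr rfl fun W' hW' => by rw [h1 W' hW', Finset.sum_mul], Finset.sum_comm,
    ← hS.sum_geos (fun x => ∑ e ∈ S.arcs with S.ok x e,
        if S.lvl (S.tgt e) = S.lvl x + 1 ∧ p x e then A (S.tgt e) + τ (S.tgt e) else 0)]
  refine Finset.sum_congr rfl fun W hW => ?_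
  rw [hS.mem_geos] at hW
  rw [Finset.sum_congr rfl fun W' _ => Finset.sum_mul _ _ _, Finset.sum_comm, Finset.sum_filter]
  refine Finset.sum_congr rfl fun e he => ?_
  by_cases hpe : p (S.tip W) e
  · simp only [hpe, if_true, and_true]
    by_cases hg : S.Geo (W ++ [e])
    · have hg' := geo_snoc.1 hg
      rw [if_pos hg'.2.2.1, if_pos hg'.2.2.2]
      simpa using (hS.sum_prefix hA _ hg).2
    · have : ¬ (S.ok (S.tip W) e ∧ S.lvl (S.tgt e) = S.lvl (S.tip W) + 1) := fun hh =>
        hg (geo_snoc.2 ⟨hW, he, hh⟩)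
      rw [← ite_and, if_neg this]
      refine Finset.sum_eq_zero fun W' hW' => ?_
      rw [if_neg fun hp => hg ((hS.mem_geos.1 hW').of_prefix hp), zero_mul]
  · simp [hpe]

end finite

end TS

end

section

/-! ## Temporal walks as paths -/

open TS

variable {n : ℕ} (G : TemporalGraph (Fin n)) (st : Strictness) (κ w s : ℕ)

/-- The states are the temporal nodes. The time `0` is that of the start only. -/
def tsys : TS (TArc (Fin n)) (ℕ × ℕ) where
  arcs := G.arcs
  ok x e := (e.src : ℕ) = x.1 ∧ (x.2 = 0 ∨ st.Compatible x.2 e.time ∧ e.time - x.2 ≤ κ)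
  tgt e := (e.dst, e.time)
  start := (s, 0)

def states (n T : ℕ) : Finset (ℕ × ℕ) := Finset.range n ×ˢ Finset.range (T + 1)

theorem card_states (T : ℕ) : (states n T).card = n * (T + 1) := by simp [states]

theorem Strictness.Compatible.le {st : Strictness} {t t' : ℕ} (h : st.Compatible t t') :
    t ≤ t' := by
  cases st
  · exact h
  · exact Nat.le_of_lt h

theorem Strictness.compatible_of_lt (st : Strictness) {t t' : ℕ} (h : t < t') :
    st.Compatible t t' := by
  cases st
  · exact Nat.le_of_lt h
  · exact h

variable {G st κ w s}

theorem within_states (hs : s < n) : (tsys G st κ s).Within (states n G.T) := by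
  refine ⟨by simp [tsys, states, hs], fun e he => ?_⟩
  have := (G.time_mem e he).2
  simp [tsys, states]
  omega

theorem path_time_pos {W : List (TArc (Fin n))} (h : (tsys G st κ s).Path W) (hW : W ≠ []) :
    1 ≤ ((tsys G st κ s).tip W).2 := by
  cases h with
  | nil => simp at hW
  | snoc _ he _ => rw [tip_append_singleton]; exact (G.time_mem _ he).1

theorem path_time_le {W : List (TArc (Fin n))} (h : (tsys G st κ s).Path W) :
    ((tsys G st κ s).tip W).2 ≤ G.T := by
  cases h with
  | nil => simp [tsys]
  | snoc _ he _ => rw [tip_append_singleton]; exact (G.time_mem _ he).2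

theorem ok_time_le {x : ℕ × ℕ} {e : TArc (Fin n)} (h : (tsys G st κ s).ok x e) : x.2 ≤ e.time := by
  rcases h.2 with h | h
  · omega
  · exact h.1.le

theorem path_prefix {W W' : List (TArc (Fin n))} (h : (tsys G st κ s).Path (W ++ W')) :
    (tsys G st κ s).Path W := by
  induction W' using List.reverseRecOn with
  | nil => simpa using h
  | append_singleton l e ih =>
    rw [← List.append_assoc, path_snoc] at h
    exact ih h.1

theorem path_mono {W W' : List (TArc (Fin n))} (h : (tsys G st κ s).Path (W ++ W')) :
    ((tsys G st κ s).tip W).2 ≤ ((tsys G st κ s).tip (W ++ W')).2 := by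
  induction W' using List.reverseRecOn with
  | nil => simp
  | append_singleton l e ih =>
    rw [← List.append_assoc, path_snoc] at h
    rw [← List.append_assoc, tip_append_singleton]
    exact (ih h.1).trans (ok_time_le h.2.2)

theorem tip_eq_of_getLast? {W : List (TArc (Fin n))} {e : TArc (Fin n)}
    (h : W.getLast? = some e) : (tsys G st κ s).tip W = (↑e.dst, e.time) := by
  induction W using List.reverseRecOn with
  | nil => simp at h
  | append_singleton l e' ih =>
    simp only [List.getLast?_append, List.getLast?_singleton, Option.some_or,
      Option.some.injEq] at h
    rw [tip_append_singleton, h]; rfl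

theorem arrival_eq (W : List (TArc (Fin n))) : arrival W = ((tsys G st κ s).tip W).2 := by
  unfold arrival
  rcases h : W.getLast? with _ | e
  · rw [List.getLast?_eq_none_iff] at h
    subst h; rfl
  · rw [tip_eq_of_getLast? h]

/-- The criterion restricts the times by `κ` and minimises arrival time times `w` plus length. -/
structure Matches (T n : ℕ) (cr : Criterion) (κ w : ℕ) : Prop where
  allows : ∀ t t', t' ≤ T → (cr.Allows t t' ↔ t' - t ≤ κ)
  cost : ∀ W : List (TArc (Fin n)), cr.cost n W = arrival W * w + W.length

/-- A condition on consecutive arcs amounts to one on the reached state and the next arc, because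
the state remembers head and time of the last arc. -/
theorem path_iff {cr : Criterion} (hcr : Matches G.T n cr κ w) (W : List (TArc (Fin n))) :
    (tsys G st κ s).Path W ↔ (∀ e ∈ W, e ∈ G.arcs) ∧
      W.IsChain (fun e f => f.src = e.dst ∧ st.Compatible e.time f.time ∧
        cr.Allows e.time f.time) ∧ ∀ e ∈ W.head?, (e.src : ℕ) = s := by
  induction W using List.reverseRecOn with
  | nil => simp [Path.nil]
  | append_singleton l e ih =>
    rw [path_snoc, ih]
    rcases List.eq_nil_or_concat' l with rfl | ⟨l', f, rfl⟩
    · simp [tsys]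
    · rw [tip_append_singleton, List.isChain_append (l₁ := l' ++ [f])]
      have hh : ((l' ++ [f]) ++ [e]).head? = (l' ++ [f]).head? := by
        cases l' <;> simp
      rw [hh]
      constructor
      · rintro ⟨⟨h1, h2, h3⟩, he, hok⟩
        refine ⟨?_, ⟨h2, by simp, ?_⟩, h3⟩
        · intro e' he'
          rcases List.mem_append.1 he' with h | h
          · exact h1 _ h
          · rw [List.mem_singleton.1 h]; exact he
        · intro x hx y hy
          simp only [List.getLast?_append, List.getLast?_singleton, Option.some_or,
            Option.mem_def, Option.some.injEq, List.head?_cons] at hx hy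
          subst hx; subst hy
          have hf := G.time_mem f (h1 f (by simp))
          have he' := G.time_mem e he
          -- The exemption for time `0` concerns the start only: arcs have time at least `1`.
          rcases hok.2 with h0 | h0
          · have : f.time = 0 := h0
            omega
          · exact ⟨Fin.ext hok.1, h0.1, (hcr.allows _ _ he'.2).2 h0.2⟩
      · rintro ⟨h1, ⟨h2, -, h4⟩, h3⟩
        have he := h1 e (by simp)
        refine ⟨⟨fun e' he' => h1 e' (List.mem_append_left _ he'), h2, h3⟩, he, ?_⟩
        obtain ⟨h5, h6, h7⟩ := h4 f (by simp) e (by simp)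
        exact ⟨congrArg Fin.val h5, Or.inr ⟨h6, (hcr.allows _ _ (G.time_mem e he).2).1 h7⟩⟩

theorem mem_walks {cr : Criterion} (hcr : Matches G.T n cr κ w) {s z : Fin n}
    {W : List (TArc (Fin n))} :
    W ∈ G.walks st cr s z ↔
      W ≠ [] ∧ (tsys G st κ s).Path W ∧ ((tsys G st κ s).tip W).1 = z := by
  rw [path_iff hcr]
  constructor
  · rintro ⟨h1, h2, ⟨e, he, hes⟩, f, hf, hfz⟩
    refine ⟨fun h => by simp [h] at he, ⟨h1, h2, fun e' he' => ?_⟩, ?_⟩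
    · rw [he] at he'
      cases he'; rw [hes]
    · rw [tip_eq_of_getLast? hf, hfz]
  · rintro ⟨hne, ⟨h1, h2, h3⟩, h4⟩
    refine ⟨h1, h2, ⟨W.head hne, List.head?_eq_some_head hne, Fin.ext (h3 _ ?_)⟩, W.getLast hne,
      List.getLast?_eq_some_getLast hne, Fin.ext ?_⟩
    · exact List.head?_eq_some_head hne
    · rw [← h4, tip_eq_of_getLast? (List.getLast?_eq_some_getLast hne)]

/-! ## Optimal walks -/

section optimal

variable (G st κ w s)

/-- The larger, the better; positive on all reachable states. -/
noncomputable def score (y : ℕ × ℕ) : ℕ :=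
  n * (G.T + 1) + 1 + (G.T - y.2) * w - (tsys G st κ s).lvl y

/-- The best score among the reachable temporal nodes of a node. -/
noncomputable def best (z : ℕ) : ℕ :=
  (Finset.range (G.T + 1)).sup fun t =>
    if (tsys G st κ s).lvl (z, t) = 0 then 0 else score G st κ w s (z, t)

noncomputable def tot (z : ℕ) : ℚ :=
  ∑ t ∈ Finset.range (G.T + 1),
    if (tsys G st κ s).lvl (z, t) ≠ 0 ∧ score G st κ w s (z, t) = best G st κ w s z then
      (tsys G st κ s).sig (z, t) else 0

/-- The share of a walk in its endpoint pair, if it is optimal and ends at `y`. -/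
noncomputable def share (y : ℕ × ℕ) : ℚ :=
  if y.1 ≠ s ∧ (tsys G st κ s).lvl y ≠ 0 ∧ score G st κ w s y = best G st κ w s y.1 then
    1 / tot G st κ w s y.1 else 0

variable {G st κ w s}

/-- On reachable temporal nodes no subtraction in `score` truncates, since levels are at most `n *
(T + 1)`. So maximising the score is minimising the cost, without ever comparing with an infinite
value for unreachable nodes. -/
theorem score_add (hs : s < n) {y : ℕ × ℕ} (hy : (tsys G st κ s).lvl y ≠ 0) :
    score G st κ w s y + (y.2 * w + (tsys G st κ s).lvl y) = n * (G.T + 1) + 1 + G.T * w := by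
  have h1 := (within_states (G := G) (st := st) (κ := κ) hs).lvl_le y
  have h2 := (within_states (G := G) (st := st) (κ := κ) hs).mem hy
  rw [card_states] at h1
  simp only [states, Finset.mem_product, Finset.mem_range] at h2
  have h3 : (G.T - y.2) * w + y.2 * w = G.T * w := by
    rw [← Nat.add_mul]; congr 1; omega
  unfold score
  omega

theorem score_le_best {y : ℕ × ℕ} (hy : (tsys G st κ s).lvl y ≠ 0) (ht : y.2 ≤ G.T) :
    score G st κ w s y ≤ best G st κ w s y.1 := by
  have := Finset.le_sup (s := Finset.range (G.T + 1)) (f := fun t =>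
    if (tsys G st κ s).lvl (y.1, t) = 0 then 0 else score G st κ w s (y.1, t))
    (Finset.mem_range.2 (Nat.lt_succ_of_le ht))
  unfold best
  simpa [hy] using this

/-- Among the walks to one temporal node the arrival time is constant, so the cost orders them by
length; between the temporal nodes of `z` the score decides. -/
theorem mem_optimalWalks {cr : Criterion} (hcr : Matches G.T n cr κ w) {s z : Fin n} (hsz : s ≠ z)
    {W : List (TArc (Fin n))} :
    W ∈ G.optimalWalks st cr s z ↔ (tsys G st κ s).Geo W ∧ ((tsys G st κ s).tip W).1 = z ∧
      score G st κ w s ((tsys G st κ s).tip W) = best G st κ w s z := by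
  have hS := within_states (G := G) (st := st) (κ := κ) s.2
  have hne : ∀ W, ((tsys G st κ s).tip W).1 = z → W ≠ [] := by
    rintro W h rfl
    exact hsz (Fin.ext h)
  simp only [TemporalGraph.optimalWalks, Set.mem_ofPred_eq, mem_walks hcr, Fintype.card_fin,
    hcr.cost, arrival_eq (G := G) (st := st) (κ := κ) (s := s)]
  constructor
  · rintro ⟨-, ⟨-, hW, hz⟩, hmin⟩
    -- Compare with a geodesic to the same temporal node: it has the same arrival time, so minimal
    -- cost forces minimal length.
    have hg : (tsys G st κ s).Geo W := by
      obtain ⟨W', hW', hs'⟩ := exists_geo hW.lvl_pos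
      have := hmin W' ⟨hne _ (hs' ▸ hz), hW'.1, hs' ▸ hz⟩
      rw [hs'] at this
      have h1 := hW.lvl_le
      have h2 := hW'.2
      rw [hs'] at h2
      exact ⟨hW, by omega⟩
    refine ⟨hg, hz, le_antisymm ?_ ?_⟩
    · rw [← hz]
      exact score_le_best hW.lvl_pos (path_time_le hW)
    · refine Finset.sup_le fun t ht => ?_
      split_ifs with h
      · exact Nat.zero_le _
      · obtain ⟨W', hW', hs'⟩ := exists_geo h
        have h1 := hmin W' ⟨hne _ (by rw [hs']), hW'.1, by rw [hs']⟩
        have h2 := score_add (w := w) s.2 h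
        have h3 := score_add (w := w) s.2 hW.lvl_pos
        have h4 := hW'.2
        have h5 := hg.2
        rw [hs'] at h1 h4
        omega
  · rintro ⟨hg, hz, hb⟩
    refine ⟨hsz, ⟨hne _ hz, hg.1, hz⟩, ?_⟩
    rintro W' ⟨-, hW', hz'⟩
    have h1 := score_le_best (w := w) hW'.lvl_pos (path_time_le hW')
    rw [hz', ← hb] at h1
    have h2 := score_add (w := w) s.2 hW'.lvl_pos
    have h3 := score_add (w := w) s.2 hg.1.lvl_pos
    have h4 := hW'.lvl_le
    have h5 := hg.2
    omega

open scoped Classical in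
theorem sigma_eq_tot {cr : Criterion} (hcr : Matches G.T n cr κ w) {s z : Fin n} (hsz : s ≠ z) :
    (G.sigma st cr s z : ℚ) = tot G st κ w s z := by
  have hS := within_states (G := G) (st := st) (κ := κ) s.2
  have h1 : G.optimalWalks st cr s z = ↑((tsys G st κ s).geos.filter fun W =>
      ((tsys G st κ s).tip W).1 = z ∧
      score G st κ w s ((tsys G st κ s).tip W) = best G st κ w s z) := by
    ext W
    rw [mem_optimalWalks hcr hsz]
    simp [hS.mem_geos]
  rw [TemporalGraph.sigma, h1, Set.ncard_coe_finset, ← Finset.sum_boole,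
    hS.sum_geos (fun x => if x.1 = z ∧ score G st κ w s x = best G st κ w s z then 1 else 0),
    states, Finset.sum_product, Finset.sum_eq_single_of_mem (z : ℕ) (Finset.mem_range.2 z.2), tot]
  · refine Finset.sum_congr rfl fun t _ => ?_
    by_cases h : (tsys G st κ s).lvl (z, t) = 0
    · simp [h, hS.sig_eq_zero h]
    · simp [h]
  · intro z' _ hz'
    simp [hz']

open scoped Classical in
-- Geodesics that are not optimal have share `0`, so the sum may run over all geodesics to the node
-- `z`. The case `s = z` needs no exception since `share` vanishes on the temporal nodes of `s`, and
-- `σ_sz = 0` causes none since a quotient by zero is zero.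
theorem delta_eq {cr : Criterion} (hcr : Matches G.T n cr κ w) (ty : WalkType) (s z v : Fin n)
    (t : ℕ) :
    G.delta ty st cr s z v t = ∑ W ∈ (tsys G st κ s).geos,
      if ((tsys G st κ s).tip W).1 = z then
        (if (↑v, t) ∈ (visited ty G.T W).map (fun x => ((x.1 : ℕ), x.2)) then (1 : ℚ) else 0) *
          share G st κ w s ((tsys G st κ s).tip W) else 0 := by
  have hS := within_states (G := G) (st := st) (κ := κ) s.2
  have hmem : ∀ W : List (TArc (Fin n)),
      (↑v, t) ∈ (visited ty G.T W).map (fun x => ((x.1 : ℕ), x.2)) ↔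
        (v, t) ∈ visited ty G.T W := by
    intro W
    simp only [List.mem_map, Prod.mk.injEq, Prod.exists]
    constructor
    · rintro ⟨a, b, h, h1, rfl⟩
      rwa [← Fin.ext h1]
    · exact fun h => ⟨v, t, h, rfl, rfl⟩
  simp only [hmem]
  by_cases hsz : s = z
  · subst hsz
    have : G.sigma st cr s s = 0 := by
      have h : G.optimalWalks st cr s s = ∅ := by
        ext W; simp [TemporalGraph.optimalWalks]
      simp [TemporalGraph.sigma, h]
    rw [TemporalGraph.delta, if_pos this]
    symm
    refine Finset.sum_eq_zero fun W _ => ?_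
    split_ifs with h1 h2 <;> simp [share, h1]
  · have h1 : {W ∈ G.optimalWalks st cr s z | (v, t) ∈ visited ty G.T W} =
        ↑((tsys G st κ s).geos.filter fun W => ((tsys G st κ s).tip W).1 = z ∧
          score G st κ w s ((tsys G st κ s).tip W) = best G st κ w s z ∧
          (v, t) ∈ visited ty G.T W) := by
      ext W
      simp [mem_optimalWalks hcr hsz, hS.mem_geos, and_assoc]
    have h2 : (G.sigmaThrough ty st cr s z v t : ℚ) = ∑ W ∈ (tsys G st κ s).geos,
        if ((tsys G st κ s).tip W).1 = z ∧
          score G st κ w s ((tsys G st κ s).tip W) = best G st κ w s z ∧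
          (v, t) ∈ visited ty G.T W then 1 else 0 := by
      rw [TemporalGraph.sigmaThrough, h1, Set.ncard_coe_finset, Finset.sum_boole]
    have h3 : G.delta ty st cr s z v t =
        (G.sigmaThrough ty st cr s z v t : ℚ) * (1 / tot G st κ w s z) := by
      rw [TemporalGraph.delta, ← sigma_eq_tot hcr hsz]
      split_ifs with h
      · simp [h]
      · rw [mul_one_div]
    rw [h3, h2, Finset.sum_mul]
    refine Finset.sum_congr rfl fun W hW => ?_
    by_cases hz : ((tsys G st κ s).tip W).1 = z
    · have hzs : ((tsys G st κ s).tip W).1 ≠ s := fun h => hsz (Fin.ext (by omega))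
      have hl := (hS.mem_geos.1 hW).1.lvl_pos
      have hsh : share G st κ w s ((tsys G st κ s).tip W) =
          if score G st κ w s ((tsys G st κ s).tip W) = best G st κ w s z then
            1 / tot G st κ w s z else 0 := by
        simp only [share, ne_eq, hzs, not_false_iff, hl, true_and]
        rw [hz]
      rw [hsh]
      by_cases h5 : score G st κ w s ((tsys G st κ s).tip W) = best G st κ w s z <;>
        by_cases h6 : (v, t) ∈ visited ty G.T W <;> simp [hz, h5, h6]
    · simp [hz]

/-- What a source contributes to the betweenness. -/
noncomputable def contribution (G : TemporalGraph (Fin n)) (st : Strictness) (κ w : ℕ)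
    (ty : WalkType) (s v t : ℕ) : ℚ :=
  open scoped Classical in
  if s = v then 0 else ∑ W ∈ (tsys G st κ s).geos,
    (if ((tsys G st κ s).tip W).1 ≠ v ∧
      (v, t) ∈ (visited ty G.T W).map (fun x => ((x.1 : ℕ), x.2)) then (1 : ℚ) else 0) *
      share G st κ w s ((tsys G st κ s).tip W)

theorem betweenness_eq {cr : Criterion} (hcr : Matches G.T n cr κ w) (ty : WalkType) (v : Fin n)
    (t : ℕ) :
    G.betweenness ty st cr v t = ∑ s ∈ Finset.range n, contribution G st κ w ty s v t := by
  classical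
  rw [TemporalGraph.betweenness, Finset.sum_range]
  refine Finset.sum_congr rfl fun s _ => ?_
  have hS := within_states (G := G) (st := st) (κ := κ) s.2
  by_cases hsv : s = v
  · simp [hsv, contribution]
  · have hsv' : (s : ℕ) ≠ v := fun h => hsv (Fin.ext h)
    rw [contribution, if_neg hsv']
    simp only [ne_eq, hsv, not_false_iff, true_and]
    rw [Finset.sum_congr rfl (g := fun z : Fin n => ∑ W ∈ (tsys G st κ s).geos,
      if ((tsys G st κ s).tip W).1 = z then (if ((tsys G st κ s).tip W).1 ≠ v ∧
        (↑v, t) ∈ (visited ty G.T W).map (fun x => ((x.1 : ℕ), x.2)) then (1 : ℚ) else 0) *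
      share G st κ w s ((tsys G st κ s).tip W) else 0), Finset.sum_comm]
    · refine Finset.sum_congr rfl fun W hW => ?_
      have := hS.tip_mem (hS.mem_geos.1 hW).1
      simp only [states, Finset.mem_product, Finset.mem_range] at this
      rw [Finset.sum_eq_single (⟨_, this.1⟩ : Fin n)]
      · simp
      · intro z _ hz
        rw [if_neg]
        rintro h
        exact hz (Fin.ext h.symm)
      · simp
    · intro z _
      split_ifs with h
      · symm
        refine Finset.sum_eq_zero fun W _ => ?_
        split_ifs with h1 h2
        · exact absurd (h1.trans (by rw [h])) h2.1
        · simp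
        · rfl
      · rw [delta_eq hcr]
        refine Finset.sum_congr rfl fun W _ => ?_
        by_cases h1 : ((tsys G st κ s).tip W).1 = z
        · have : ((tsys G st κ s).tip W).1 ≠ v := fun h2 => h (Fin.ext (by omega))
          rw [if_pos h1, if_pos h1]
          simp only [this, ne_eq, not_false_iff, true_and]
        · simp [h1]

/-- Optimal walks end at their first visit to their last node. -/
theorem tip_ne_of_prefix (hs : s < n) {W W' : List (TArc (Fin n))}
    (hW' : (tsys G st κ s).Geo W') (h : share G st κ w s ((tsys G st κ s).tip W') ≠ 0)
    (hp : W <+: W') (hne : W ≠ W') :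
    ((tsys G st κ s).tip W').1 ≠ ((tsys G st κ s).tip W).1 := by
  intro heq
  have hW := hW'.of_prefix hp
  have hlen : W.length < W'.length :=
    lt_of_le_of_ne hp.length_le fun h => hne (hp.eq_of_length h)
  have h1 := score_le_best (w := w) hW.1.lvl_pos (path_time_le hW.1)
  have h2 : score G st κ w s ((tsys G st κ s).tip W') =
      best G st κ w s ((tsys G st κ s).tip W').1 := by
    unfold share at h
    by_contra h'
    simp [h'] at h
  -- The prefix reaches the same node no later and with fewer arcs, so its score would exceed the
  -- best one.
  rw [← heq, ← h2] at h1
  have h3 := score_add (w := w) hs hW.1.lvl_pos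
  have h4 := score_add (w := w) hs hW'.1.lvl_pos
  have h5 := hW.2
  have h6 := hW'.2
  have h7 : ((tsys G st κ s).tip W).2 ≤ ((tsys G st κ s).tip W').2 := by
    obtain ⟨t, rfl⟩ := hp
    exact path_mono hW'.1
  have h8 := Nat.mul_le_mul_right w h7
  omega

/-! ## Passive walks -/

/-- The states passed are the heads of the arcs with their times. The visited `(u₁, t₁)` is not a
state, and the state `(s, 0)` of the empty prefix is not visited; both belong to the node `s ≠ v`.
-/
theorem mem_visited_passive {W : List (TArc (Fin n))} {v t : ℕ} (hW : (tsys G st κ s).Path W)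
    (hv : s ≠ v) :
    (v, t) ∈ (visited .passive G.T W).map (fun x => ((x.1 : ℕ), x.2)) ↔
      ∃ W₁, W₁ <+: W ∧ (tsys G st κ s).tip W₁ = (v, t) := by
  have h1 : (v, t) ∈ (visited .passive G.T W).map (fun x => ((x.1 : ℕ), x.2)) ↔
      ∃ e ∈ W, ((e.dst : ℕ), e.time) = (v, t) := by
    have h0 : (v, t) ∉ (visitedStart W).map (fun x => ((x.1 : ℕ), x.2)) := by
      cases W with
      | nil => simp [visitedStart]
      | cons e W =>
        have h1 : (tsys G st κ s).Path ([] ++ [e]) := path_prefix (W' := W) (by simpa using hW)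
        have h2 : (e.src : ℕ) = s := (path_snoc _ |>.1 h1).2.2.1
        simp only [visitedStart, List.map_cons, List.map_nil, List.mem_singleton, Prod.mk.injEq,
          not_and]
        intro h; omega
    rw [visited, List.map_append, List.mem_append, or_iff_right h0]
    simp
  rw [h1]
  constructor
  · rintro ⟨e, he, h⟩
    obtain ⟨A, B, rfl⟩ := List.append_of_mem he
    exact ⟨A ++ [e], ⟨B, by simp⟩, by rw [tip_append_singleton]; exact h⟩
  · rintro ⟨W₁, ⟨B, rfl⟩, h⟩
    induction W₁ using List.reverseRecOn with
    | nil => exact absurd (congrArg Prod.fst h) hv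
    | append_singleton A e _ =>
      rw [tip_append_singleton] at h
      exact ⟨e, by simp, h⟩

/-- By `tip_ne_of_prefix`, for walks of nonzero share, passing through `(v, t)` properly is the same
as visiting it and ending at another node. So `Within.sum_through` applies with a trivial `Q`. -/
theorem contribution_passive (hs : s < n) {v t : ℕ} (hv : s ≠ v) {A : ℕ × ℕ → ℚ}
    (hA : (tsys G st κ s).Accumulates (share G st κ w s) A) :
    contribution G st κ w .passive s v t = (tsys G st κ s).sig (v, t) * A (v, t) := by
  classical
  have hS := within_states (G := G) (st := st) (κ := κ) hs
  have := hS.sum_through hA (v, t) (fun _ => True)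
  simp only [Finset.filter_true] at this
  rw [sig, ← this, contribution, if_neg hv]
  refine Finset.sum_congr rfl fun W hW => ?_
  rw [hS.mem_geos] at hW
  by_cases hsh : share G st κ w s ((tsys G st κ s).tip W) = 0
  · simp [hsh]
  · congr 1
    refine if_congr ?_ rfl rfl
    rw [mem_visited_passive hW.1 hv]
    constructor
    · rintro ⟨h1, W₁, h2, h3⟩
      exact ⟨W₁, h2, fun h => h1 (by rw [← h, h3]), h3, trivial⟩
    · rintro ⟨W₁, h2, h1, h3, -⟩
      refine ⟨fun h => ?_, W₁, h2, h3⟩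
      exact tip_ne_of_prefix hs hW hsh h2 h1 (by rw [h, h3])

end optimal

end

section

open TS

variable {n : ℕ} {G : TemporalGraph (Fin n)} {st : Strictness} {κ w s : ℕ}

/-! ## Active walks -/

theorem mem_stay {V : Type*} {v u : V} {a b t : ℕ} :
    (v, t) ∈ stay u a b ↔ u = v ∧ a ≤ t ∧ t ≤ b := by
  simp only [stay, List.mem_map, List.mem_range'_1, Prod.mk.injEq]
  constructor
  · rintro ⟨t', h, h1, rfl⟩
    exact ⟨h1, by omega, by omega⟩
  · rintro ⟨h1, h2, h3⟩
    exact ⟨t, by omega, h1, rfl⟩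

theorem mem_visitedActive {V : Type*} {v : V} {t : ℕ} (W : List (TArc V)) :
    (v, t) ∈ visitedActive W ↔
      (∃ A e f B, W = A ++ e :: f :: B ∧ e.dst = v ∧ e.time ≤ t ∧ t ≤ f.time) ∨
      ∃ e ∈ W.getLast?, e.dst = v ∧ e.time = t := by
  induction W with
  | nil => simp [visitedActive]
  | cons e W ih =>
    cases W with
    | nil =>
      simp only [visitedActive, List.mem_singleton, Prod.mk.injEq, List.getLast?_singleton,
        Option.mem_def, Option.some.injEq, exists_eq_left']
      constructor
      · rintro ⟨rfl, rfl⟩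
        exact Or.inr ⟨rfl, rfl⟩
      · rintro (⟨A, e', f, B, h, -⟩ | ⟨rfl, rfl⟩)
        · have := congrArg List.length h
          simp at this
          omega
        · exact ⟨rfl, rfl⟩
    | cons f W =>
      rw [visitedActive, List.mem_append, ih, mem_stay, List.getLast?_cons_cons, ← or_assoc]
      refine or_congr_left ⟨?_, ?_⟩
      · rintro (h | ⟨A, e', f', B, h, h'⟩)
        · exact ⟨[], e, f, W, rfl, h⟩
        · exact ⟨e :: A, e', f', B, by simp [h], h'⟩
      · rintro ⟨A, e', f', B, h, h'⟩
        cases A with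
        | nil =>
          simp only [List.nil_append, List.cons.injEq] at h
          obtain ⟨rfl, rfl, rfl⟩ := h
          exact Or.inl h'
        | cons a A =>
          simp only [List.cons_append, List.cons.injEq] at h
          exact Or.inr ⟨A, e', f', B, h.2, h'⟩

/-- The walk `W'` waits on `v` at the time `t`, having arrived earlier. -/
def Waits (v t : ℕ) (x : ℕ × ℕ) (e : TArc (Fin n)) : Prop := x.1 = v ∧ x.2 < t ∧ t ≤ e.time

/-- As `v` is neither the source nor the last node, only the stays between consecutive arcs matter.
The first moment of a stay is an arrival, all later ones are waiting. The conjunct `True` gives the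
first alternative the shape required by `Within.sum_through`. -/
theorem mem_visited_active {W : List (TArc (Fin n))} {v t : ℕ} (hW : (tsys G st κ s).Path W)
    (hv : s ≠ v) (hz : ((tsys G st κ s).tip W).1 ≠ v) :
    (v, t) ∈ (visited .active G.T W).map (fun x => ((x.1 : ℕ), x.2)) ↔
      (∃ W₁, W₁ <+: W ∧ W₁ ≠ W ∧ (tsys G st κ s).tip W₁ = (v, t) ∧ True) ∨
      ∃ W₁ e, W₁ ++ [e] <+: W ∧ Waits v t ((tsys G st κ s).tip W₁) e := by
  have hlast : ∀ e ∈ W.getLast?, (e.dst : ℕ) ≠ v := by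
    intro e he h
    rw [tip_eq_of_getLast? he] at hz
    exact hz h
  have h1 : (v, t) ∈ (visited .active G.T W).map (fun x => ((x.1 : ℕ), x.2)) ↔
      ∃ A e f B, W = A ++ e :: f :: B ∧ (e.dst : ℕ) = v ∧ e.time ≤ t ∧ t ≤ f.time := by
    simp only [visited, List.mem_map, List.mem_append, Prod.mk.injEq, Prod.exists]
    constructor
    · rintro ⟨u, t', (h | h) | h, rfl, rfl⟩
      · cases W with
        | nil => simp [visitedStart] at h
        | cons e W =>
          have h1 : (tsys G st κ s).Path ([] ++ [e]) := path_prefix (W' := W) (by simpa using hW)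
          have h2 : (e.src : ℕ) = s := (path_snoc _ |>.1 h1).2.2.1
          simp only [visitedStart, List.mem_singleton, Prod.mk.injEq] at h
          exact absurd (h.1 ▸ h2.symm) hv
      · rcases (mem_visitedActive W).1 h with ⟨A, e, f, B, h1, rfl, h3⟩ | ⟨e, he, rfl, -⟩
        · exact ⟨A, e, f, B, h1, rfl, h3⟩
        · exact absurd rfl (hlast e he)
      · unfold visitedExtension at h
        rcases he : W.getLast? with _ | e
        · simp [he] at h
        · rw [he] at h
          simp only [mem_stay] at h
          exact absurd (congrArg Fin.val h.1) (hlast e he)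
    · rintro ⟨A, e, f, B, h1, rfl, h3⟩
      exact ⟨e.dst, t, Or.inl (Or.inr ((mem_visitedActive W).2 (Or.inl ⟨A, e, f, B, h1, rfl, h3⟩))),
        rfl, rfl⟩
  rw [h1]
  constructor
  · rintro ⟨A, e, f, B, rfl, h2, h3, h4⟩
    rcases h3.eq_or_lt with h5 | h5
    · refine Or.inl ⟨A ++ [e], ⟨f :: B, by simp⟩, by simp, ?_, trivial⟩
      rw [tip_append_singleton, ← h2, ← h5]; rfl
    · refine Or.inr ⟨A ++ [e], f, ⟨B, by simp⟩, ?_⟩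
      rw [tip_append_singleton]
      exact ⟨h2, h5, h4⟩
  · have key : ∀ W₁ f, W₁ ++ [f] <+: W → ((tsys G st κ s).tip W₁).1 = v →
        ((tsys G st κ s).tip W₁).2 ≤ t → t ≤ f.time →
        ∃ A e f B, W = A ++ e :: f :: B ∧ (e.dst : ℕ) = v ∧ e.time ≤ t ∧ t ≤ f.time := by
      rintro W₁ f ⟨B, rfl⟩ h2 h3 h4
      induction W₁ using List.reverseRecOn with
      | nil => exact absurd h2 hv
      | append_singleton A e _ =>
        rw [tip_append_singleton] at h2 h3
        exact ⟨A, e, f, B, by simp, h2, h3, h4⟩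
    rintro (⟨W₁, ⟨B, rfl⟩, h3, h4, -⟩ | ⟨W₁, f, h2, h3, h4, h5⟩)
    · cases B with
      | nil => simp at h3
      | cons f B =>
        have h5 : (tsys G st κ s).Path (W₁ ++ [f]) := path_prefix (W' := B) (by simpa using hW)
        have h6 := ok_time_le (path_snoc _ |>.1 h5).2.2
        rw [h4] at h6
        exact key W₁ f ⟨B, by simp⟩ (by rw [h4]) (by rw [h4]) h6
    · exact key W₁ f h2 h3 h4.le h5

/-- Times do not decrease along a path: once it has left `v` at a time `≥ t`, no later state has a
time `< t`. -/
theorem Waits.unique {W : List (TArc (Fin n))} {v t : ℕ} (hW : (tsys G st κ s).Path W)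
    {W₁ W₂ : List (TArc (Fin n))} {e₁ e₂ : TArc (Fin n)} (h₁ : W₁ ++ [e₁] <+: W)
    (h₂ : W₂ ++ [e₂] <+: W) (hw₁ : Waits v t ((tsys G st κ s).tip W₁) e₁)
    (hw₂ : Waits v t ((tsys G st κ s).tip W₂) e₂) : W₁ = W₂ := by
  have key : ∀ {W₁ W₂ : List (TArc (Fin n))} {e₁ e₂ : TArc (Fin n)}, W₁ ++ [e₁] <+: W →
      W₂ ++ [e₂] <+: W → Waits v t ((tsys G st κ s).tip W₁) e₁ →
      Waits v t ((tsys G st κ s).tip W₂) e₂ → ¬ W₁.length < W₂.length := by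
    intro W₁ W₂ e₁ e₂ h₁ h₂ hw₁ hw₂ hlt
    have h₂' : W₂ <+: W := (List.prefix_append _ _).trans h₂
    obtain ⟨C, rfl⟩ := List.prefix_of_prefix_length_le h₁ h₂' (by simp; omega)
    obtain ⟨D, rfl⟩ := h₂'
    have := path_mono (path_prefix hW)
    rw [tip_append_singleton] at this
    have h3 := hw₁.2.2
    have h4 := hw₂.2.1
    have h5 : ((tsys G st κ s).tgt e₁).2 = e₁.time := rfl
    omega
  refine (List.prefix_of_prefix_length_le ((List.prefix_append _ _).trans h₁)
    ((List.prefix_append _ _).trans h₂) ?_).eq_of_length ?_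
  · have := key h₂ h₁ hw₂ hw₁; omega
  · have := key h₂ h₁ hw₂ hw₁; have := key h₁ h₂ hw₁ hw₂; omega

/-! ### Returns within one time step -/

/-- With `κ = 0` only the first arc, which leaves the artificial time `0`, is free in its time. So
the system with `κ = 0` describes the walks from `v` inside a single time step; in the strict
version these have at most one arc. -/
theorem time_eq_of_path_zero {v : ℕ} {C : List (TArc (Fin n))} (h : (tsys G st 0 v).Path C) :
    ∀ e ∈ C, e.time = ((tsys G st 0 v).tip C).2 := by
  induction h with
  | nil => simp
  | @snoc W e h he hok ih =>
    intro e' he'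
    rw [tip_append_singleton]
    rcases List.mem_append.1 he' with h1 | h1
    · have h2 := path_time_pos h (List.ne_nil_of_mem h1)
      have h3 := ih e' h1
      rcases hok.2 with h4 | ⟨h4, h5⟩
      · omega
      · have h6 := h4.le
        have h7 : ((tsys G st 0 v).tgt e).2 = e.time := rfl
        omega
    · rw [List.mem_singleton.1 h1]; rfl

/-- Only the junction has to be checked: passing from `t₁` to `t > t₁` is allowed even for strict
walks, and the wait `t - t₁` is at most `κ`. -/
theorem path_append_zero {v t t₁ : ℕ} {W C : List (TArc (Fin n))} (hW : (tsys G st κ s).Path W)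
    (hs : (tsys G st κ s).tip W = (v, t₁)) (h1 : t₁ < t) (h2 : t - t₁ ≤ κ)
    (hC : (tsys G st 0 v).Path C) (ht : ∀ e ∈ C, e.time = t) :
    (tsys G st κ s).Path (W ++ C) ∧
      (C ≠ [] → (tsys G st κ s).tip (W ++ C) = (tsys G st 0 v).tip C) := by
  induction C using List.reverseRecOn with
  | nil => simpa using hW
  | append_singleton C e ih =>
    rw [path_snoc] at hC
    have := ih hC.1 fun e' he' => ht e' (by simp [he'])
    have hte := ht e (by simp)
    rw [← List.append_assoc, path_snoc, tip_append_singleton, tip_append_singleton]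
    refine ⟨⟨this.1, hC.2.1, ?_⟩, fun _ => rfl⟩
    rcases eq_or_ne C [] with rfl | hne
    · rw [List.append_nil, hs]
      exact ⟨hC.2.2.1, Or.inr ⟨st.compatible_of_lt (by dsimp only; omega), by dsimp only; omega⟩⟩
    · rw [this.2 hne]
      refine ⟨hC.2.2.1, hC.2.2.2.imp_right fun h => ⟨h.1, h.2.trans (Nat.zero_le _)⟩⟩

theorem path_zero_of_append {v t t₁ : ℕ} {W C : List (TArc (Fin n))}
    (hs : (tsys G st κ s).tip W = (v, t₁)) (hC : (tsys G st κ s).Path (W ++ C))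
    (ht : ∀ e ∈ C, e.time = t) :
    (tsys G st 0 v).Path C ∧
      (C ≠ [] → (tsys G st κ s).tip (W ++ C) = (tsys G st 0 v).tip C) := by
  induction C using List.reverseRecOn with
  | nil => simp [Path.nil]
  | append_singleton C e ih =>
    rw [← List.append_assoc, path_snoc] at hC
    have := ih hC.1 fun e' he' => ht e' (by simp [he'])
    have hte := ht e (by simp)
    rw [← List.append_assoc, path_snoc, tip_append_singleton, tip_append_singleton]
    refine ⟨⟨this.1, hC.2.1, ?_⟩, fun _ => rfl⟩
    rcases eq_or_ne C [] with rfl | hne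
    · rw [List.append_nil, hs] at hC
      exact ⟨hC.2.2.1, Or.inl rfl⟩
    · have h3 := time_eq_of_path_zero this.1 (C.getLast hne) (List.getLast_mem hne)
      rw [ht _ (by simp)] at h3
      rw [← this.2 hne]
      refine ⟨hC.2.2.1, hC.2.2.2.imp_right fun h => ⟨h.1, ?_⟩⟩
      rw [this.2 hne]
      omega

/-- The temporal node `(v, t)` is reached from `(v, t₁)` by a shortest closed walk at the
time `t`. -/
def Returns (G : TemporalGraph (Fin n)) (st : Strictness) (κ s v t t₁ : ℕ) : Prop :=
  t - t₁ ≤ κ ∧ (tsys G st κ s).lvl (v, t₁) ≠ 0 ∧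
    (tsys G st κ s).lvl (v, t₁) < (tsys G st κ s).lvl (v, t) ∧
    (tsys G st κ s).lvl (v, t) - (tsys G st κ s).lvl (v, t₁) = (tsys G st 0 v).lvl (v, t) - 1

open scoped Classical in
-- Cut such a geodesic at the transition that ends the waiting, which is unique. The first piece is
-- a geodesic to some `(v, t₁)`, the second a shortest closed walk at `v` of time `t`. Conversely,
-- whether two such pieces compose to a geodesic depends on their lengths and the waiting time only,
-- and that is what `Returns` says.
theorem card_returns (hs : s < n) {v : ℕ} (hvn : v < n) (hv : s ≠ v) (t : ℕ) :
    ((((tsys G st κ s).geosTo (v, t)).filter fun W => ∃ W₁ e, W₁ ++ [e] <+: W ∧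
      Waits v t ((tsys G st κ s).tip W₁) e).card : ℚ) =
    ∑ t₁ ∈ Finset.range t, if Returns G st κ s v t t₁ then
      (tsys G st κ s).sig (v, t₁) * (tsys G st 0 v).sig (v, t) else 0 := by
  have hS := within_states (G := G) (st := st) (κ := κ) hs
  have hS₀ := within_states (G := G) (st := st) (κ := 0) hvn
  rw [← Finset.sum_filter]
  simp only [sig]
  rw [← Finset.sum_congr rfl fun t₁ _ => Nat.cast_mul _ _, ← Nat.cast_sum, Nat.cast_inj]
  simp only [← Finset.card_product]
  rw [← Finset.card_sigma (s := (Finset.range t).filter (Returns G st κ s v t))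
    (t := fun t₁ => (tsys G st κ s).geosTo (v, t₁) ×ˢ (tsys G st 0 v).geosTo (v, t))]
  have key : ∀ t₁ W C, t₁ < t → Returns G st κ s v t t₁ → (tsys G st κ s).Geo W →
      (tsys G st κ s).tip W = (v, t₁) → (tsys G st 0 v).Geo C →
      (tsys G st 0 v).tip C = (v, t) → (tsys G st κ s).Geo (W ++ C) ∧
      (tsys G st κ s).tip (W ++ C) = (v, t) ∧ ∃ e, W ++ [e] <+: W ++ C ∧
        Waits v t ((tsys G st κ s).tip W) e := by
    rintro t₁ W C h1 ⟨h2, h3, h4, h5⟩ hW hWs hC hCs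
    have hne : C ≠ [] := by
      rintro rfl
      have : 0 = t := congrArg Prod.snd hCs
      omega
    have htC : ∀ e ∈ C, e.time = t := fun e he => by
      rw [time_eq_of_path_zero hC.1 e he, hCs]
    obtain ⟨h6, h7⟩ := path_append_zero hW.1 hWs h1 h2 hC.1 htC
    have h8 := (h7 hne).trans hCs
    have hl := hW.2
    have hl' := hC.2
    rw [hWs] at hl
    rw [hCs] at hl'
    refine ⟨⟨h6, ?_⟩, h8, C.head hne, ⟨C.tail, by simp⟩, ?_⟩
    · rw [h8, List.length_append]
      omega
    · rw [hWs]
      exact ⟨rfl, h1, (htC _ (List.head_mem hne)).ge⟩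
  symm
  refine Finset.card_bij (fun q _ => q.2.1 ++ q.2.2) ?_ ?_ ?_
  · rintro ⟨t₁, W, C⟩ h
    simp only [Finset.mem_sigma, Finset.mem_filter, Finset.mem_range, Finset.mem_product,
      hS.mem_geosTo, hS₀.mem_geosTo] at h
    obtain ⟨⟨h1, h2⟩, ⟨h3, h4⟩, h5, h6⟩ := h
    obtain ⟨h7, h8, e, h9⟩ := key t₁ W C h1 h2 h3 h4 h5 h6
    rw [Finset.mem_filter, hS.mem_geosTo]
    exact ⟨⟨h7, h8⟩, W, e, h9⟩
  · rintro ⟨t₁, W, C⟩ h ⟨t₁', W', C'⟩ h' heq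
    simp only [Finset.mem_sigma, Finset.mem_filter, Finset.mem_range, Finset.mem_product,
      hS.mem_geosTo, hS₀.mem_geosTo] at h h'
    obtain ⟨⟨h1, h2⟩, ⟨h3, h4⟩, h5, h6⟩ := h
    obtain ⟨⟨h1', h2'⟩, ⟨h3', h4'⟩, h5', h6'⟩ := h'
    obtain ⟨h7, h8, e, h9, h10⟩ := key t₁ W C h1 h2 h3 h4 h5 h6
    obtain ⟨h7', h8', e', h9', h10'⟩ := key t₁' W' C' h1' h2' h3' h4' h5' h6'
    dsimp only at heq
    rw [← heq] at h9'
    obtain rfl := Waits.unique h7.1 h9 h9' h10 h10'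
    obtain rfl := List.append_cancel_left heq
    rw [h4] at h4'
    cases h4'
    rfl
  · intro W hW
    rw [Finset.mem_filter, hS.mem_geosTo] at hW
    obtain ⟨⟨hG, hWs⟩, W₁, e, ⟨C', rfl⟩, hw⟩ := hW
    have hG₁' := hG.of_append
    have hG₁ := geo_snoc.1 hG₁'
    obtain ⟨t₁, ht₁⟩ : ∃ t₁, (tsys G st κ s).tip W₁ = (v, t₁) := ⟨_, Prod.ext hw.1 rfl⟩
    have hne₁ : W₁ ≠ [] := by
      rintro rfl
      exact hv (congrArg Prod.fst ht₁)
    have hpos := path_time_pos hG₁.1.1 hne₁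
    have hok := hG₁.2.2.1
    rw [ht₁] at hw hok hpos
    obtain ⟨-, h1, h2⟩ := hw
    dsimp only at h1 hpos
    set C := [e] ++ C' with hCdef
    have hCne : C ≠ [] := by simp [hCdef]
    rw [List.append_assoc, ← hCdef] at hG hWs
    -- The first arc of `C` has time at least `t`, the walk ends at time `t`, and times are
    -- monotone.
    have htC : ∀ f ∈ C, f.time = t := by
      intro f hf
      obtain ⟨A, B, hAB⟩ := List.append_of_mem hf
      have h3 : W₁ ++ C = (W₁ ++ A ++ [f]) ++ B := by simp [hAB]
      have hP := hG.1
      rw [h3] at hP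
      have h4 := path_mono hP
      rw [← h3, hWs, tip_append_singleton] at h4
      have h5 : f.time ≤ t := h4
      have h6 : e.time ≤ f.time := by
        cases A with
        | nil =>
          simp only [hCdef, List.cons_append, List.nil_append, List.cons.injEq] at hAB
          rw [hAB.1]
        | cons a A =>
          simp only [hCdef, List.cons_append, List.nil_append, List.cons.injEq] at hAB
          obtain ⟨rfl, -⟩ := hAB
          have h7 : W₁ ++ (e :: A) ++ [f] = (W₁ ++ [e]) ++ (A ++ [f]) := by simp
          have h8 := path_prefix hP
          rw [h7] at h8
          have h9 := path_mono h8
          rw [← h7, tip_append_singleton, tip_append_singleton] at h9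
          exact h9
      omega
    obtain ⟨hC, hCs⟩ := path_zero_of_append ht₁ hG.1 htC
    have hCs := (hCs hCne).symm.trans hWs
    have hκ : t - t₁ ≤ κ := by
      rcases hok.2 with h | h
      · have : t₁ = 0 := h
        omega
      · have h3 := htC e (by simp [hCdef])
        have h4 := h.2
        dsimp only at h4
        omega
    have hl := hG.2
    have hl₁ := hG₁.1.2
    rw [hWs, List.length_append] at hl
    rw [ht₁] at hl₁
    have hCpos : 1 ≤ C.length := List.length_pos_iff.2 hCne
    -- Exchange argument: a shorter closed walk of time `t` could replace `C` in the geodesic.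
    have hCg : (tsys G st 0 v).Geo C := by
      have h3 := hC.lvl_le
      have h4 := hC.lvl_pos
      rw [hCs] at h3 h4
      obtain ⟨C₀, hC₀, hC₀s⟩ := exists_geo h4
      have hl₀ := hC₀.2
      rw [hC₀s] at hl₀
      have htC₀ : ∀ e ∈ C₀, e.time = t := fun e he => by
        rw [time_eq_of_path_zero hC₀.1 e he, hC₀s]
      obtain ⟨h5, h6⟩ := path_append_zero hG₁.1.1 ht₁ h1 hκ hC₀.1 htC₀
      have hne₀ : C₀ ≠ [] := by
        rintro rfl
        have : 0 = t := congrArg Prod.snd hC₀s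
        omega
      have h7 := h5.lvl_le
      rw [h6 hne₀, hC₀s, List.length_append] at h7
      refine ⟨hC, ?_⟩
      rw [hCs]
      omega
    have hl₀ := hCg.2
    rw [hCs] at hl₀
    refine ⟨⟨t₁, W₁, C⟩, ?_, by simp [hCdef]⟩
    simp only [Finset.mem_sigma, Finset.mem_filter, Finset.mem_range, Finset.mem_product,
      hS.mem_geosTo, hS₀.mem_geosTo]
    exact ⟨⟨h1, hκ, by omega, by omega, by omega⟩, ⟨hG₁.1, ht₁⟩, hCg, hCs⟩

/-- Inclusion and exclusion. In the first sum the terms `t₁ < t` are the walks that wait across `t`,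
and `t₁ = t` gives those that arrive at `(v, t)`; the subtracted product is the weight of the walks
that do both. -/
theorem contribution_active (hs : s < n) {v t : ℕ} (hvn : v < n) (ht : t ≤ G.T) (hv : s ≠ v)
    {A : ℕ × ℕ → ℚ} (hA : (tsys G st κ s).Accumulates (share G st κ w s) A) :
    open scoped Classical in
    contribution G st κ w .active s v t =
      ∑ t₁ ∈ Finset.range (t + 1), (tsys G st κ s).sig (v, t₁) *
        ∑ e ∈ G.arcs with (tsys G st κ s).ok (v, t₁) e,
          (if (tsys G st κ s).lvl (e.dst, e.time) = (tsys G st κ s).lvl (v, t₁) + 1 ∧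
            t ≤ e.time then A (e.dst, e.time) + share G st κ w s (e.dst, e.time) else 0) -
      A (v, t) * ∑ t₁ ∈ Finset.range t, if Returns G st κ s v t t₁ then
        (tsys G st κ s).sig (v, t₁) * (tsys G st 0 v).sig (v, t) else 0 := by
  classical
  have hS := within_states (G := G) (st := st) (κ := κ) hs
  have h1 := hS.sum_through hA (v, t) (fun _ => True)
  have h2 := hS.sum_through hA (v, t) (fun W => ∃ W₁ e, W₁ ++ [e] <+: W ∧
      Waits v t ((tsys G st κ s).tip W₁) e)
  have h3 := hS.sum_edge hA (Waits v t) fun W' hW' W₁ e₁ W₂ e₂ hp hp' hw hw' =>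
    Waits.unique hW'.1 hp hp' hw hw'
  simp only [Finset.filter_true] at h1
  rw [card_returns hs hvn hv] at h2
  -- For `t₁ = t` the condition `t ≤ e.time` is automatic, and the inner sum is the recurrence for
  -- `A (v, t)`.
  have h4 : ∑ t₁ ∈ Finset.range (t + 1), (tsys G st κ s).sig (v, t₁) *
        ∑ e ∈ G.arcs with (tsys G st κ s).ok (v, t₁) e,
          (if (tsys G st κ s).lvl (e.dst, e.time) = (tsys G st κ s).lvl (v, t₁) + 1 ∧
            t ≤ e.time then A (e.dst, e.time) + share G st κ w s (e.dst, e.time) else 0) =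
      ∑ x ∈ states n G.T, (tsys G st κ s).sig x *
        ∑ e ∈ (tsys G st κ s).arcs with (tsys G st κ s).ok x e,
          (if (tsys G st κ s).lvl ((tsys G st κ s).tgt e) = (tsys G st κ s).lvl x + 1 ∧
            Waits v t x e then A ((tsys G st κ s).tgt e) + share G st κ w s ((tsys G st κ s).tgt e)
            else 0) + (tsys G st κ s).sig (v, t) * A (v, t) := by
    rw [Finset.sum_range_succ]
    congr 1
    · rw [states, Finset.sum_product, Finset.sum_eq_single_of_mem v (Finset.mem_range.2 hvn)]
      · rw [← Finset.sum_subset (Finset.range_subset_range.2 (show t ≤ G.T + 1 by omega))]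
        · refine Finset.sum_congr rfl fun t₁ ht₁ => ?_
          rw [Finset.mem_range] at ht₁
          simp [Waits, ht₁, tsys]
        · intro t₁ _ ht₁
          rw [Finset.mem_range] at ht₁
          simp [Waits, ht₁]
      · intro v' _ hv'
        simp [Waits, hv']
    · by_cases hl : (tsys G st κ s).lvl (v, t) = 0
      · rw [hS.sig_eq_zero hl]; simp
      · rw [hA _ hl]
        congr 1
        refine Finset.sum_congr rfl fun e he => ?_
        have := ok_time_le (Finset.mem_filter.1 he).2
        dsimp only at this
        simp only [this, and_true]
        rfl
  rw [h4, ← h3, mul_comm (A _), ← h2, sig, ← h1, contribution, if_neg hv, ← Finset.sum_add_distrib,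
    ← Finset.sum_sub_distrib]
  refine Finset.sum_congr rfl fun W hW => ?_
  rw [hS.mem_geos] at hW
  by_cases hsh : share G st κ w s ((tsys G st κ s).tip W) = 0
  · simp [hsh]
  · rw [← add_mul, ← sub_mul]
    congr 1
    by_cases hz : ((tsys G st κ s).tip W).1 = v
    · have h5 : ¬ ∃ W₁ e, W₁ ++ [e] <+: W ∧ Waits v t ((tsys G st κ s).tip W₁) e := by
        rintro ⟨W₁, e, hp, hw⟩
        refine tip_ne_of_prefix hs hW hsh ((List.prefix_append _ _).trans hp) ?_
          (hz.trans hw.1.symm)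
        rintro rfl
        simpa using hp.length_le
      have h6 : ∀ Q : List (TArc (Fin n)) → Prop, ¬ ∃ W₁, W₁ <+: W ∧ W₁ ≠ W ∧
          (tsys G st κ s).tip W₁ = (v, t) ∧ Q W₁ := by
        rintro Q ⟨W₁, hp, hne, hst, -⟩
        exact tip_ne_of_prefix hs hW hsh hp hne (by rw [hz, hst])
      rw [if_neg h5, if_neg (h6 _), if_neg (h6 _), if_neg fun h => h.1 hz]
      norm_num
    · have h5 := mem_visited_active (t := t) hW.1 hv hz
      -- A waiting anywhere in `W` happens before the arrival at `(v, t)`: after it the times are at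
      -- least `t`, whereas waiting starts at a time `< t`.
      have h6 : (∃ W₁, W₁ <+: W ∧ W₁ ≠ W ∧ (tsys G st κ s).tip W₁ = (v, t) ∧
            ∃ W₂ e, W₂ ++ [e] <+: W₁ ∧ Waits v t ((tsys G st κ s).tip W₂) e) ↔
          (∃ W₁, W₁ <+: W ∧ W₁ ≠ W ∧ (tsys G st κ s).tip W₁ = (v, t) ∧ True) ∧
          ∃ W₂ e, W₂ ++ [e] <+: W ∧ Waits v t ((tsys G st κ s).tip W₂) e := by
        constructor
        · rintro ⟨W₁, a, b, c, W₂, e, d, f⟩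
          exact ⟨⟨W₁, a, b, c, trivial⟩, W₂, e, d.trans a, f⟩
        · rintro ⟨⟨W₁, a, b, c, -⟩, W₂, e, d, f⟩
          refine ⟨W₁, a, b, c, W₂, e, ?_, f⟩
          rcases Nat.lt_or_ge W₂.length W₁.length with h | h
          · exact List.prefix_of_prefix_length_le d a (by simp; omega)
          · obtain ⟨C, rfl⟩ := List.prefix_of_prefix_length_le a ((List.prefix_append _ _).trans d) h
            have := path_mono (hW.of_prefix ((List.prefix_append _ _).trans d)).1
            rw [c] at this
            have h7 := f.2.1
            dsimp only at this
            omega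
      rw [if_congr (and_iff_right hz) rfl rfl, if_congr h5 rfl rfl, if_congr h6 rfl rfl]
      have aux : ∀ (p q : Prop) [Decidable p] [Decidable q], (if p ∨ q then (1 : ℚ) else 0) =
          (if q then 1 else 0) + (if p then 1 else 0) - if p ∧ q then 1 else 0 := by
        intro p q _ _
        by_cases hp : p <;> by_cases hq : q <;> simp [hp, hq]
      exact aux _ _

end

section

open TS

/-! ## The program

Word variables: `0`–`3` input, `4` the bound `κ` on waiting, `5` the weight `w` of the arrival time,
`7` the source, `8` the level, and `9`–`14`, `16` loop variables, with the bounds in `17`–`23`.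

Word arrays: `3`, `4`, `5` number, heads and times of the arcs out of a node, `6` level of a
temporal node, `7`, `8`, `9` number, nodes and times of the members of a level, `10` score of a time,
`11` best score of a node, `12` level of the return to a node at a time, `13` number of temporal
nodes, `14` scratch.

Rational arrays: `0` result, `1` number of geodesics, `2` accumulated shares, `3` share,
`4` number of optimal walks, `5` number of returns, `6` and `7` scratch. -/

open WExpr in
/-- The arc found by a scan can prolong the walks to the scanned temporal node. -/
def okTest (st : Strictness) : BExpr :=
  .or (.eq (var 11) (lit 0))
    (.and (match st with
      | .nonStrict => .not (.lt (var 14) (var 11))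
      | .strict => .lt (var 11) (var 14))
      (.not (.lt (var 4) (sub (var 14) (var 11)))))

open WExpr in
/-- Run `body` for the arcs out of the node in variable `10` that prolong the walks to the temporal
node in the variables `10`, `11`. -/
def scanNodeProg (st : Strictness) (body : Prog) : Prog :=
  forLoop 12 18 (get 3 (var 10) (lit 0))
    (.seq (.assign 13 (get 4 (var 10) (var 12)))
      (.seq (.assign 14 (get 5 (var 10) (var 12))) (.ite (okTest st) body .skip)))

open WExpr in
/-- Run `body` for all arcs out of the members of the level in variable `8`. -/
def scanLevelProg (st : Strictness) (body : Prog) : Prog :=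
  forLoop 9 17 (get 7 (var 8) (lit 0))
    (.seq (.assign 10 (get 8 (var 8) (var 9)))
      (.seq (.assign 11 (get 9 (var 8) (var 9))) (scanNodeProg st body)))

variable {n : ℕ} {G : TemporalGraph (Fin n)} {st : Strictness} {κ w s : ℕ}
  {L : List (TArc (Fin n))}

/-! ### Adjacency lists in memory and scans over them -/

def outArcs (L : List (TArc (Fin n))) (u : ℕ) : List (TArc (Fin n)) :=
  L.filter fun e => (e.src : ℕ) = u

theorem sum_outArcs (L : List (TArc (Fin n))) :
    ∑ u ∈ Finset.range n, (outArcs L u).length = L.length := by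
  induction L with
  | nil => simp [outArcs]
  | cons e L ih =>
    have : ∀ u, (outArcs (e :: L) u).length =
        (if (e.src : ℕ) = u then 1 else 0) + (outArcs L u).length := by
      intro u
      by_cases h : (e.src : ℕ) = u <;> simp [outArcs, h, Nat.add_comm]
    simp only [this, Finset.sum_add_distrib, ih]
    simp [Nat.add_comm]

structure GraphRep (L : List (TArc (Fin n))) (arr : ℕ → ℕ → ℕ → ℕ) : Prop where
  deg : ∀ u < n, arr 3 u 0 = (outArcs L u).length
  dst : ∀ u < n, ∀ i (h : i < (outArcs L u).length), arr 4 u i = (outArcs L u)[i].dst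
  time : ∀ u < n, ∀ i (h : i < (outArcs L u).length), arr 5 u i = (outArcs L u)[i].time

theorem GraphRep.congr {arr arr' : ℕ → ℕ → ℕ → ℕ} (h : GraphRep L arr) (h3 : arr' 3 = arr 3)
    (h4 : arr' 4 = arr 4) (h5 : arr' 5 = arr 5) : GraphRep L arr' :=
  ⟨by rw [h3]; exact h.deg, by rw [h4]; exact h.dst, by rw [h5]; exact h.time⟩

/-- The level `d` of the memory holds the list. -/
structure LevelRep (arr : ℕ → ℕ → ℕ → ℕ) (d : ℕ) (l : List (ℕ × ℕ)) : Prop where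
  card : arr 7 d 0 = l.length
  node : ∀ j (h : j < l.length), arr 8 d j = l[j].1
  time : ∀ j (h : j < l.length), arr 9 d j = l[j].2

theorem okTest_time (st : Strictness) : (okTest st).time ≤ 15 := by
  cases st <;> decide

theorem okTest_holds {σ : Mem} {x : ℕ × ℕ} {e : TArc (Fin n)} (h4 : σ.var 4 = κ)
    (h11 : σ.var 11 = x.2) (h14 : σ.var 14 = e.time) (hsrc : (e.src : ℕ) = x.1) :
    (okTest st).Holds σ ↔ (tsys G st κ s).ok x e := by
  cases st <;>
    simp [okTest, BExpr.Holds, WExpr.eval, tsys, Strictness.Compatible, h4, h11, h14, hsrc]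

open scoped Classical in
/-- The arcs that prolong the walks to the temporal node `x`, as the program finds them. -/
noncomputable def okArcs (S : TS (TArc (Fin n)) (ℕ × ℕ)) (L : List (TArc (Fin n))) (x : ℕ × ℕ) :
    List (TArc (Fin n)) := (outArcs L x.1).filter fun e => S.ok x e

/-- The invariant is indexed by the list of admissible arcs handled so far, so that it can be a
partial sum over that list. Every arc out of the node is paid for, admissible or not: 7 for the loop
and at most 25 for loading and testing, besides `c`. -/
theorem Runs.scanNode {body : Prog} {σ : Mem} {x : ℕ × ℕ}
    (I : List (TArc (Fin n)) → (ℕ → ℕ → ℕ → ℕ) → (ℕ → ℕ → ℕ → ℚ) → Prop) (c : ℕ)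
    (hV : ∀ y, body.wV y = false) (h3 : body.wA 3 = false) (h4 : body.wA 4 = false)
    (h5 : body.wA 5 = false)
    (hκ : σ.var 4 = κ) (hx1 : σ.var 10 = x.1) (hx2 : σ.var 11 = x.2) (hx : x.1 < n)
    (hG : GraphRep L σ.arr) (h0 : I [] σ.arr σ.num)
    (hstep : ∀ p e σ', e ∈ L → (tsys G st κ s).ok x e →
      (scanNodeProg st body).Keeps σ σ' → σ'.var 13 = e.dst → σ'.var 14 = e.time →
      I p σ'.arr σ'.num → Runs body σ' c fun σ'' => I (p ++ [e]) σ''.arr σ''.num) :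
    Runs (scanNodeProg st body) σ ((outArcs L x.1).length * (c + 32) + 10)
      fun σ' => I (okArcs (tsys G st κ s) L x) σ'.arr σ'.num := by
  classical
  have hrun := Runs.forUp_const (i := 12) (b := 18) (hi := .get 3 (.var 10) (.lit 0))
    (body := .seq (.assign 13 (.get 4 (.var 10) (.var 12)))
      (.seq (.assign 14 (.get 5 (.var 10) (.var 12))) (.ite (okTest st) body .skip))) (σ := σ)
    (fun i arr num => I (((outArcs L x.1).take i).filter fun e => (tsys G st κ s).ok x e) arr num)
    (c + 25) (N := (outArcs L x.1).length)
    (B := (outArcs L x.1).length * (c + 32) + 10)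
    (by simp [WExpr.eval, hx1, hG.deg _ hx]) rfl
    (by simp [Prog.wV, hV]) (by simp [Prog.wV, hV]) (by simp [WExpr.time]) (by simpa using h0) ?_
  · refine hrun.mono le_rfl fun σ' _ h => ?_
    simpa [okArcs] using h
  · intro i hi σ₁ hk hi₁ hI
    have k10 : σ₁.var 10 = x.1 := by rw [hk.var 10 (by simp [forLoop, Prog.wV, hV]), hx1]
    have k11 : σ₁.var 11 = x.2 := by rw [hk.var 11 (by simp [forLoop, Prog.wV, hV]), hx2]
    have k4 : σ₁.var 4 = κ := by rw [hk.var 4 (by simp [forLoop, Prog.wV, hV]), hκ]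
    have hG₁ : GraphRep L σ₁.arr := hG.congr (hk.arr 3 (by simp [forLoop, Prog.wA, h3]))
      (hk.arr 4 (by simp [forLoop, Prog.wA, h4])) (hk.arr 5 (by simp [forLoop, Prog.wA, h5]))
    set e := (outArcs L x.1)[i] with he
    have heo : e ∈ outArcs L x.1 := List.getElem_mem hi
    have heL : e ∈ L := List.mem_of_mem_filter heo
    have hsrc : (e.src : ℕ) = x.1 := by
      have := List.of_mem_filter heo
      simpa using this
    have htake : ((outArcs L x.1).take (i + 1)).filter (fun e => (tsys G st κ s).ok x e) =
        ((outArcs L x.1).take i).filter (fun e => (tsys G st κ s).ok x e) ++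
          if (tsys G st κ s).ok x e then [e] else [] := by
      rw [List.take_succ_eq_append_getElem hi, List.filter_append]
      by_cases h : (tsys G st κ s).ok x e <;> simp [h, ← he]
    set σ₂ := σ₁.setVar 13 (WExpr.eval σ₁ (.get 4 (.var 10) (.var 12))) with hσ₂
    set σ₃ := σ₂.setVar 14 (WExpr.eval σ₂ (.get 5 (.var 10) (.var 12))) with hσ₃
    have v13 : σ₃.var 13 = e.dst := by
      simp [hσ₃, hσ₂, Mem.setVar, WExpr.eval, k10, hi₁, hG₁.dst _ hx i hi, he]
    have v14 : σ₃.var 14 = e.time := by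
      simp [hσ₃, hσ₂, Mem.setVar, WExpr.eval, k10, hi₁, hG₁.time _ hx i hi, he]
    have hk₃ : (scanNodeProg st body).Keeps σ σ₃ := by
      refine ⟨fun y hy => ?_, hk.arr, hk.num⟩
      have h13 : y ≠ 13 := by
        rintro rfl; simp [scanNodeProg, forLoop, Prog.wV] at hy
      have h14 : y ≠ 14 := by
        rintro rfl; simp [scanNodeProg, forLoop, Prog.wV] at hy
      rw [← hk.var y hy]
      simp [hσ₃, hσ₂, Mem.setVar, h13, h14]
    have hok := okTest_holds (G := G) (st := st) (κ := κ) (s := s) (σ := σ₃) (x := x) (e := e)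
      (by simpa [hσ₃, hσ₂, Mem.setVar] using k4) (by simpa [hσ₃, hσ₂, Mem.setVar] using k11) v14 hsrc
    have ht := okTest_time st
    refine (Runs.seq (Runs.assign (Runs.seq (Runs.assign (Runs.ite (B := c + 1) ?_ ?_))))).le
      (by simp only [WExpr.time]; omega)
    · intro hb
      have hb' := hok.1 hb
      refine (hstep _ e σ₃ heL hb' hk₃ v13 v14 hI).mono (by omega) fun σ' _ h => ?_
      rw [htake, if_pos hb']
      exact h
    · intro hb
      have hb' := fun h => hb (hok.2 h)
      refine (Runs.skip (Q := fun σ' => I _ σ'.arr σ'.num) ?_).le (by omega)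
      rw [htake, if_neg hb', List.append_nil]
      exact hI

theorem sum_map_eq_range {α : Type*} (l : List α) (f : α → ℕ) (a : α) :
    (l.map f).sum = ∑ j ∈ Finset.range l.length, f (l.getD j a) := by
  induction l with
  | nil => simp
  | cons b l ih => simp [Finset.sum_range_succ', ih, Nat.add_comm]

/-- The temporal nodes of a level with the arcs that prolong the walks to them. -/
noncomputable def okPairs (S : TS (TArc (Fin n)) (ℕ × ℕ)) (L : List (TArc (Fin n)))
    (l : List (ℕ × ℕ)) : List ((ℕ × ℕ) × TArc (Fin n)) :=
  l.flatMap fun x => (okArcs S L x).map (x, ·)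

/-- The hypothesis `hI` makes the invariant protect the scanned level itself: the search changes the
arrays that hold the levels while it scans one of them. -/
theorem Runs.scanLevel {body : Prog} {σ : Mem} {l : List (ℕ × ℕ)} {d : ℕ}
    (I : List ((ℕ × ℕ) × TArc (Fin n)) → (ℕ → ℕ → ℕ → ℕ) → (ℕ → ℕ → ℕ → ℚ) → Prop) (c : ℕ)
    (hV : ∀ y, body.wV y = false) (h3 : body.wA 3 = false) (h4 : body.wA 4 = false)
    (h5 : body.wA 5 = false)
    (hκ : σ.var 4 = κ) (hd : σ.var 8 = d) (hl : ∀ x ∈ l, x.1 < n)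
    (hG : GraphRep L σ.arr) (hI : ∀ p arr num, I p arr num → LevelRep arr d l)
    (h0 : I [] σ.arr σ.num)
    (hstep : ∀ p x e σ', x ∈ l → e ∈ L → (tsys G st κ s).ok x e →
      (scanLevelProg st body).Keeps σ σ' → σ'.var 10 = x.1 → σ'.var 11 = x.2 →
      σ'.var 13 = e.dst → σ'.var 14 = e.time → I p σ'.arr σ'.num →
      Runs body σ' c fun σ'' => I (p ++ [(x, e)]) σ''.arr σ''.num) :
    Runs (scanLevelProg st body) σ
      ((c + 32) * (l.map fun x => 1 + (outArcs L x.1).length).sum + 10)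
      fun σ' => I (okPairs (tsys G st κ s) L l) σ'.arr σ'.num := by
  have hrun := Runs.forUp (i := 9) (b := 17) (hi := .get 7 (.var 8) (.lit 0))
    (body := .seq (.assign 10 (.get 8 (.var 8) (.var 9)))
      (.seq (.assign 11 (.get 9 (.var 8) (.var 9))) (scanNodeProg st body)))
    (σ := σ)
    (fun j arr num => I (okPairs (tsys G st κ s) L (l.take j)) arr num)
    (fun j => (outArcs L (l.getD j (0, 0)).1).length * (c + 32) + 18) (N := l.length)
    (by simp [WExpr.eval, hd, (hI _ _ _ h0).card]) rfl
    (by simp [scanNodeProg, forLoop, Prog.wV, hV])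
    (by simp [scanNodeProg, forLoop, Prog.wV, hV])
    (by simpa [okPairs] using h0) ?_
  · refine hrun.mono ?_ fun σ' _ h => by simpa using h
    rw [sum_map_eq_range _ _ (0, 0), Finset.mul_sum]
    have : ∑ j ∈ Finset.range l.length, ((outArcs L (l.getD j (0, 0)).1).length * (c + 32) + 18 + 7) ≤
        ∑ j ∈ Finset.range l.length, (c + 32) * (1 + (outArcs L (l.getD j (0, 0)).1).length) := by
      refine Finset.sum_le_sum fun j _ => ?_
      ring_nf
      omega
    simp only [WExpr.time]
    omega
  · intro j hj σ₁ hk hj₁ hI₁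
    have hrep := hI _ _ _ hI₁
    have k8 : σ₁.var 8 = d := by
      rw [hk.var 8 (by simp [scanNodeProg, forLoop, Prog.wV, hV]), hd]
    have k4 : σ₁.var 4 = κ := by
      rw [hk.var 4 (by simp [scanNodeProg, forLoop, Prog.wV, hV]), hκ]
    have hG₁ : GraphRep L σ₁.arr := hG.congr
      (hk.arr 3 (by simp [scanNodeProg, forLoop, Prog.wA, h3]))
      (hk.arr 4 (by simp [scanNodeProg, forLoop, Prog.wA, h4]))
      (hk.arr 5 (by simp [scanNodeProg, forLoop, Prog.wA, h5]))
    set x := l[j] with hx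
    have hxl : x ∈ l := List.getElem_mem hj
    have hget : l.getD j (0, 0) = x := by simp [hj, hx]
    set σ₂ := σ₁.setVar 10 (WExpr.eval σ₁ (.get 8 (.var 8) (.var 9))) with hσ₂
    set σ₃ := σ₂.setVar 11 (WExpr.eval σ₂ (.get 9 (.var 8) (.var 9))) with hσ₃
    have v10 : σ₃.var 10 = x.1 := by
      simp [hσ₃, hσ₂, Mem.setVar, WExpr.eval, k8, hj₁, hrep.node j hj, hx]
    have v11 : σ₃.var 11 = x.2 := by
      simp [hσ₃, hσ₂, Mem.setVar, WExpr.eval, k8, hj₁, hrep.time j hj, hx]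
    have key := Runs.scanNode (G := G) (st := st) (κ := κ) (s := s) (L := L) (σ := σ₃) (x := x)
      (body := body) (fun p arr num => I (okPairs (tsys G st κ s) L (l.take j) ++ p.map (x, ·)) arr num) c
      hV h3 h4 h5 (by simpa [hσ₃, hσ₂, Mem.setVar] using k4) v10 v11 (hl x hxl) hG₁
      (by simp only [List.map_nil, List.append_nil]; exact hI₁) ?_
    · refine (Runs.seq (Runs.assign (Runs.seq (Runs.assign (key.mono le_rfl ?_))))).le ?_
      · intro σ' _ h
        rw [List.take_succ_eq_append_getElem hj, ← hx]
        simpa [okPairs] using h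
      · simp only [WExpr.time]
        rw [hget]
        omega
    · intro p e σ₄ heL hok hk₄ v13 v14 hI₄
      have h10 : σ₄.var 10 = x.1 := by
        rw [hk₄.var 10 (by simp [scanNodeProg, forLoop, Prog.wV, hV]), v10]
      have h11 : σ₄.var 11 = x.2 := by
        rw [hk₄.var 11 (by simp [scanNodeProg, forLoop, Prog.wV, hV]), v11]
      refine (hstep _ x e σ₄ hxl heL hok ⟨fun y hy => ?_, fun a ha => ?_, fun a ha => ?_⟩ h10 h11 v13
        v14 hI₄).mono le_rfl fun σ' _ h => by simpa using h
      · have hy' := hy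
        simp only [scanLevelProg, forLoop, Prog.wV, Bool.or_eq_false_iff,
          beq_eq_false_iff_ne] at hy'
        rw [hk₄.var y hy'.2.2.1.2.2, ← hk.var y hy]
        simp only [hσ₃, hσ₂, Mem.setVar]
        rw [if_neg hy'.2.2.1.2.1.symm, if_neg hy'.2.2.1.1.symm]
      · have hy' := ha
        simp only [scanLevelProg, forLoop, Prog.wA, Bool.or_eq_false_iff] at hy'
        rw [hk₄.arr a hy'.2.2.1.2.2, ← hk.arr a ha]
        rfl
      · have hy' := ha
        simp only [scanLevelProg, forLoop, Prog.wN, Bool.or_eq_false_iff] at hy'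
        rw [hk₄.num a hy'.2.2.1.2.2, ← hk.num a ha]
        rfl

end

section

open TS

variable {n : ℕ} {G : TemporalGraph (Fin n)} {st : Strictness} {κ w s : ℕ}
  {L : List (TArc (Fin n))}

/-! ### Sums over the scanned arcs -/

/-- The list `L` enumerates the temporal arcs. -/
structure Lists (L : List (TArc (Fin n))) (G : TemporalGraph (Fin n)) : Prop where
  nodup : L.Nodup
  mem : ∀ e, e ∈ L ↔ e ∈ G.arcs

theorem mem_okArcs {x : ℕ × ℕ} {e : TArc (Fin n)} :
    e ∈ okArcs (tsys G st κ s) L x ↔ e ∈ L ∧ (tsys G st κ s).ok x e := by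
  simp only [okArcs, outArcs, List.mem_filter, decide_eq_true_eq]
  exact ⟨fun h => ⟨h.1.1, h.2⟩, fun h => ⟨⟨h.1, h.2.1⟩, h.2⟩⟩

open scoped Classical in
theorem sum_okArcs (hL : Lists L G) (x : ℕ × ℕ) (f : TArc (Fin n) → ℚ) :
    ((okArcs (tsys G st κ s) L x).map f).sum =
      ∑ e ∈ (tsys G st κ s).arcs with (tsys G st κ s).ok x e, f e := by
  have hnd : (okArcs (tsys G st κ s) L x).Nodup := (hL.nodup.filter _).filter _
  rw [← List.sum_toFinset f hnd]
  refine Finset.sum_congr ?_ fun _ _ => rfl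
  ext e
  rw [List.mem_toFinset, mem_okArcs, Finset.mem_filter, hL.mem]
  rfl

theorem mem_okPairs {l : List (ℕ × ℕ)} {q : (ℕ × ℕ) × TArc (Fin n)} :
    q ∈ okPairs (tsys G st κ s) L l ↔ q.1 ∈ l ∧ q.2 ∈ L ∧ (tsys G st κ s).ok q.1 q.2 := by
  simp only [okPairs, List.mem_flatMap, List.mem_map, mem_okArcs]
  constructor
  · rintro ⟨x, hx, e, he, rfl⟩
    exact ⟨hx, he⟩
  · rintro ⟨h1, h2⟩
    exact ⟨q.1, h1, q.2, h2, rfl⟩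

/-- The list consists of the temporal nodes of the level `d + 1`. -/
structure IsLevel (S : TS (TArc (Fin n)) (ℕ × ℕ)) (d : ℕ) (l : List (ℕ × ℕ)) : Prop where
  nodup : l.Nodup
  mem : ∀ x, x ∈ l ↔ S.lvl x = d + 1

theorem IsLevel.sum_map {M : Type*} [AddCommMonoid M] {l : List (ℕ × ℕ)} {d : ℕ}
    (h : IsLevel (tsys G st κ s) d l) (hs : s < n) (f : ℕ × ℕ → M) :
    (l.map f).sum = ∑ x ∈ states n G.T with (tsys G st κ s).lvl x = d + 1, f x := by
  rw [← List.sum_toFinset f h.nodup]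
  refine Finset.sum_congr ?_ fun _ _ => rfl
  ext x
  rw [List.mem_toFinset, h.mem, Finset.mem_filter]
  exact ⟨fun hx => ⟨(within_states hs).mem (by rw [hx]; omega), hx⟩, fun hx => hx.2⟩

open scoped Classical in
theorem IsLevel.sum_okPairs {l : List (ℕ × ℕ)} {d : ℕ} (h : IsLevel (tsys G st κ s) d l)
    (hs : s < n) (hL : Lists L G) (f : (ℕ × ℕ) × TArc (Fin n) → ℚ) :
    ((okPairs (tsys G st κ s) L l).map f).sum =
      ∑ x ∈ states n G.T with (tsys G st κ s).lvl x = d + 1,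
        ∑ e ∈ (tsys G st κ s).arcs with (tsys G st κ s).ok x e, f (x, e) := by
  rw [← h.sum_map hs]
  have : ∀ l, ((okPairs (tsys G st κ s) L l).map f).sum = (l.map fun x =>
      ((okArcs (tsys G st κ s) L x).map fun e => f (x, e)).sum).sum := by
    intro l
    induction l with
    | nil => simp [okPairs]
    | cons x l ih =>
      rw [List.map_cons, List.sum_cons, ← ih]
      simp [okPairs, Function.comp_def]
  rw [this]
  congr 2
  ext x
  exact sum_okArcs hL x fun e => f (x, e)

/-- The number of steps of a scan of the level `d + 1`, up to a constant. -/
noncomputable def levelWork (S : TS (TArc (Fin n)) (ℕ × ℕ)) (L : List (TArc (Fin n))) (T d : ℕ) :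
    ℕ :=
  ∑ x ∈ states n T with S.lvl x = d + 1, (1 + (outArcs L x.1).length)

/-- Every temporal node lies in at most one level, and the out-degrees sum to the number of arcs,
once for each of the `T + 1` times. -/
theorem sum_levelWork (S : TS (TArc (Fin n)) (ℕ × ℕ)) (L : List (TArc (Fin n))) (T N : ℕ) :
    ∑ d ∈ Finset.range N, levelWork S L T d ≤ (n + L.length) * (T + 1) := by
  have h1 : ∑ x ∈ states n T, (1 + (outArcs L x.1).length) = (n + L.length) * (T + 1) := by
    rw [states, Finset.sum_product]
    simp only [Finset.sum_const, Finset.card_range, smul_eq_mul]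
    rw [← Finset.mul_sum, Finset.sum_add_distrib, sum_outArcs]
    simp [Nat.mul_comm]
  rw [← h1]
  simp only [levelWork, Finset.sum_filter]
  rw [Finset.sum_comm]
  refine Finset.sum_le_sum fun x _ => ?_
  rw [Finset.sum_congr rfl (g := fun d => if S.lvl x - 1 = d then
    (if S.lvl x = d + 1 then 1 + (outArcs L x.1).length else 0) else 0) fun d _ => by
      split_ifs <;> first | rfl | omega, Finset.sum_ite_eq]
  split_ifs <;> omega

/-- All `n * (T + 1)` possible levels are run through, empty ones included; their overhead `b + 7`
is still within the bound. -/
theorem sum_work_le (S : TS (TArc (Fin n)) (ℕ × ℕ)) (L : List (TArc (Fin n))) (T a b : ℕ) :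
    ∑ d ∈ Finset.range (n * (T + 1)), (a * levelWork S L T d + b + 7) ≤
      (a + (b + 7)) * ((n + L.length) * (T + 1)) := by
  rw [Finset.sum_congr rfl fun d _ => Nat.add_assoc _ _ _, Finset.sum_add_distrib,
    ← Finset.mul_sum, Finset.sum_const, Finset.card_range, smul_eq_mul, Nat.add_mul]
  have h1 := sum_levelWork S L T (n * (T + 1))
  have h2 : n * (T + 1) ≤ (n + L.length) * (T + 1) := Nat.mul_le_mul_right _ (by omega)
  exact Nat.add_le_add (Nat.mul_le_mul_left _ h1)
    ((Nat.mul_comm _ _).le.trans (Nat.mul_le_mul_left _ h2))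

/-! ### One source -/

/-- What the memory holds independently of the source. -/
structure Env (G : TemporalGraph (Fin n)) (L : List (TArc (Fin n))) (κ w : ℕ) (σ : Mem) :
    Prop where
  nodes : σ.var 0 = n
  tmax : σ.var 1 = G.T
  wait : σ.var 4 = κ
  graph : GraphRep L σ.arr
  card : σ.arr 13 0 0 = n * (G.T + 1)
  base : ∀ t ≤ G.T, σ.arr 10 t 0 = n * (G.T + 1) + 1 + (G.T - t) * w

/-- The program does not write to what `Env` speaks about. -/
structure Prog.Safe (p : Prog) : Prop where
  v0 : p.wV 0 = false
  v1 : p.wV 1 = false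
  v4 : p.wV 4 = false
  a3 : p.wA 3 = false
  a4 : p.wA 4 = false
  a5 : p.wA 5 = false
  a10 : p.wA 10 = false
  a13 : p.wA 13 = false

theorem Env.keeps {σ σ' : Mem} (h : Env G L κ w σ) {p : Prog} (hk : p.Keeps σ σ') (hp : p.Safe) :
    Env G L κ w σ' :=
  ⟨(hk.var 0 hp.v0).trans h.nodes, (hk.var 1 hp.v1).trans h.tmax, (hk.var 4 hp.v4).trans h.wait,
    h.graph.congr (hk.arr 3 hp.a3) (hk.arr 4 hp.a4) (hk.arr 5 hp.a5), by rw [hk.arr 13 hp.a13, h.card],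
    by rw [hk.arr 10 hp.a10]; exact h.base⟩

open WExpr in
def clearProg : Prog :=
  forLoop 10 19 (var 0) (forLoop 11 20 (succ (var 1))
    (.seq (.store 6 (var 10) (var 11) (lit 0))
      (.seq (.storeQ 1 (var 10) (var 11) (.lit 0)) (.storeQ 2 (var 10) (var 11) (.lit 0)))))

theorem Runs.clear {σ : Mem} (hn : σ.var 0 = n) {T : ℕ} (hT : σ.var 1 = T) :
    Runs clearProg σ (n * ((T + 1) * 19 + 16) + 8) fun σ' => ∀ v < n, ∀ t ≤ T,
      σ'.arr 6 v t = 0 ∧ σ'.num 1 v t = 0 ∧ σ'.num 2 v t = 0 := by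
  refine Runs.forUp_const (fun k arr num => ∀ v < k, ∀ t ≤ T,
      arr 6 v t = 0 ∧ num 1 v t = 0 ∧ num 2 v t = 0) ((T + 1) * 19 + 9) (by simp [WExpr.eval, hn])
      rfl rfl rfl (by simp [WExpr.time]) (by simp) ?_
  intro v hv σ₁ hk h10 hI
  refine (Runs.forUp_const (fun k arr num => (∀ v' < v, ∀ t ≤ T,
      arr 6 v' t = 0 ∧ num 1 v' t = 0 ∧ num 2 v' t = 0) ∧ ∀ t < k,
      arr 6 v t = 0 ∧ num 1 v t = 0 ∧ num 2 v t = 0) 12 (N := T + 1)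
      (by simp [WExpr.eval, hk.var 1 rfl, hT]) rfl rfl rfl (by simp [WExpr.time]) ⟨hI, by simp⟩
      ?_).mono le_rfl ?_
  · intro t ht σ₂ hk₂ h11 ⟨hI₁, hI₂⟩
    have h10' : σ₂.var 10 = v := (hk₂.var 10 rfl).trans h10
    refine (Runs.seq (Runs.store (Runs.seq (Runs.storeQ (Runs.storeQ ?_))))).le
      (by simp [WExpr.time, QExpr.time])
    simp only [Mem.setArr, Mem.setNum, WExpr.eval, QExpr.eval, h10', h11]
    refine ⟨fun v' hv' t' ht' => ?_, fun t' ht' => ?_⟩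
    · have : v' ≠ v := by omega
      simpa [this] using hI₁ v' hv' t' ht'
    · rcases eq_or_ne t' t with rfl | hne
      · simp
      · simpa [hne] using hI₂ t' (by omega)
  · rintro σ' - ⟨h1, h2⟩ v' hv' t ht
    rcases eq_or_ne v' v with rfl | hne
    · exact h2 t (by omega)
    · exact h1 v' (by omega) t ht

open WExpr in
def initProg : Prog :=
  .seq clearProg (.seq (forLoop 8 21 (succ (get 13 (lit 0) (lit 0))) (.store 7 (var 8) (lit 0) (lit 0)))
    (.seq (.store 6 (var 7) (lit 0) (lit 1))
      (.seq (.storeQ 1 (var 7) (lit 0) (.lit 1))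
        (.seq (.store 7 (lit 0) (lit 0) (lit 1))
          (.seq (.store 8 (lit 0) (lit 0) (var 7)) (.store 9 (lit 0) (lit 0) (lit 0)))))))

theorem Runs.init {σ : Mem} (hσ : Env G L κ w σ) (h7 : σ.var 7 = s) (hs : s < n) :
    Runs initProg σ (100 * (n * (G.T + 1))) fun σ' =>
      (∀ v < n, ∀ t ≤ G.T, σ'.arr 6 v t = (if (v, t) = (s, 0) then 1 else 0) ∧
        σ'.num 1 v t = (if (v, t) = (s, 0) then 1 else 0) ∧ σ'.num 2 v t = 0) ∧
      (∀ d ≤ n * (G.T + 1), d ≠ 0 → σ'.arr 7 d 0 = 0) ∧ LevelRep σ'.arr 0 [(s, 0)] := by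
  have hpos : 1 ≤ n * (G.T + 1) := Nat.mul_pos (by omega) (by omega)
  have hle : n ≤ n * (G.T + 1) := Nat.le_mul_of_pos_right _ (by omega)
  -- One counter more than there are scanned levels is cleared, because the scan of the last level
  -- refers to the next one.
  refine (Runs.seq_keeps (Runs.clear hσ.nodes hσ.tmax) fun σ₁ k₁ hI₁ => Runs.seq_keeps
    (Runs.forUp_const (fun k arr num => (∀ v < n, ∀ t ≤ G.T,
      arr 6 v t = 0 ∧ num 1 v t = 0 ∧ num 2 v t = 0) ∧ ∀ d < k, arr 7 d 0 = 0) 4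
      (N := n * (G.T + 1) + 1) (B := (n * (G.T + 1) + 1) * 11 + 11)
      (by simp [WExpr.eval, k₁.arr 13 rfl, hσ.card])
      rfl rfl rfl (by simp [WExpr.time]) ⟨hI₁, by simp⟩ ?_) fun σ₂ k₂ hI₂ =>
    Runs.seq (Runs.store (Runs.seq (Runs.storeQ (Runs.seq (Runs.store (Runs.seq (Runs.store
      (Runs.store ?_))))))))).le ?_
  · intro d hd σ₂ hk₂ h8 ⟨hI₁, hI₂⟩
    refine Runs.store ?_
    simp only [Mem.setArr, WExpr.eval, h8]
    refine ⟨by simpa using hI₁, fun d' hd' => ?_⟩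
    rcases eq_or_ne d' d with rfl | hne
    · simp
    · simpa [hne] using hI₂ d' (by omega)
  · have h7' : σ₂.var 7 = s := by rw [k₂.var 7 rfl, k₁.var 7 rfl, h7]
    simp only [Mem.setArr, Mem.setNum, WExpr.eval, QExpr.eval, h7']
    refine ⟨fun v hv t ht => ?_, fun d hd hd0 => ?_, ⟨?_, ?_, ?_⟩⟩
    · have := hI₂.1 v hv t ht
      simp only [Prod.mk.injEq]
      split_ifs <;> simp_all
    · simpa [hd0] using hI₂.2 d (by omega)
    · simp
    · intro j h
      have : j = 0 := by simpa using h
      subst this; simp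
    · intro j h
      have : j = 0 := by simpa using h
      subst this; simp
  · simp only [WExpr.time, QExpr.time]
    ring_nf at hpos hle ⊢
    omega

/-! ### Levels -/

open WExpr in
-- The list with index `d` holds the temporal nodes with `lvl = d + 1`, so those found from it get
-- `d + 2`. The entry `0` marks a temporal node as unreached.
def searchBody : Prog :=
  .ite (.eq (get 6 (var 13) (var 14)) (lit 0))
    (.seq (.store 6 (var 13) (var 14) (succ (succ (var 8))))
      (.seq (.store 8 (succ (var 8)) (get 7 (succ (var 8)) (lit 0)) (var 13))
        (.seq (.store 9 (succ (var 8)) (get 7 (succ (var 8)) (lit 0)) (var 14))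
          (.store 7 (succ (var 8)) (lit 0) (succ (get 7 (succ (var 8)) (lit 0)))))))
    .skip

open WExpr in
def searchProg (st : Strictness) : Prog :=
  forLoop 8 21 (get 13 (lit 0) (lit 0)) (scanLevelProg st searchBody)

/-- The memory holds the levels below `d`. -/
def LevelsRep (S : TS (TArc (Fin n)) (ℕ × ℕ)) (d : ℕ) (arr : ℕ → ℕ → ℕ → ℕ) : Prop :=
  ∀ d' < d, ∃ l, IsLevel S d' l ∧ LevelRep arr d' l

theorem LevelsRep.congr {S : TS (TArc (Fin n)) (ℕ × ℕ)} {d : ℕ} {arr arr' : ℕ → ℕ → ℕ → ℕ}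
    (h : LevelsRep S d arr) (h' : ∀ d' < d, ∀ j, arr' 7 d' j = arr 7 d' j ∧ arr' 8 d' j = arr 8 d' j ∧
      arr' 9 d' j = arr 9 d' j) : LevelsRep S d arr' := by
  intro d' hd'
  obtain ⟨l, h1, h2, h3, h4⟩ := h d' hd'
  exact ⟨l, h1, by rw [(h' d' hd' 0).1, h2], fun j hj => by rw [(h' d' hd' j).2.1, h3 j hj],
    fun j hj => by rw [(h' d' hd' j).2.2, h4 j hj]⟩

theorem IsLevel.lt {l : List (ℕ × ℕ)} {d : ℕ} (h : IsLevel (tsys G st κ s) d l) (hs : s < n)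
    {x : ℕ × ℕ} (hx : x ∈ l) : x.1 < n ∧ x.2 ≤ G.T := by
  have := (within_states (G := G) (st := st) (κ := κ) hs).mem (x := x) (by rw [(h.mem x).1 hx]; omega)
  simp only [states, Finset.mem_product, Finset.mem_range] at this
  omega

theorem search_step {σ : Mem} {l N : List (ℕ × ℕ)} {d D : ℕ}
    {p : List ((ℕ × ℕ) × TArc (Fin n))} {x : ℕ × ℕ} {e : TArc (Fin n)} (hd : σ.var 8 = d)
    (h13 : σ.var 13 = e.dst) (h14 : σ.var 14 = e.time) (hx : (tsys G st κ s).lvl x = d + 1)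
    (he : e ∈ G.arcs) (hok : (tsys G st κ s).ok x e)
    (hlow : LevelsRep (tsys G st κ s) (d + 1) σ.arr ∧ LevelRep σ.arr d l)
    (hcnt : ∀ d' ≤ D, d + 1 < d' → σ.arr 7 d' 0 = 0) (hN : N.Nodup)
    (hmem : ∀ y, y ∈ N ↔ d + 1 < (tsys G st κ s).lvl y ∧ ∃ q ∈ p, (tsys G st κ s).tgt q.2 = y)
    (hrep : LevelRep σ.arr (d + 1) N)
    (hdist : ∀ v < n, ∀ t ≤ G.T, σ.arr 6 v t = if (tsys G st κ s).lvl (v, t) ≤ d + 1 then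
      (tsys G st κ s).lvl (v, t) else if (v, t) ∈ N then d + 2 else 0) :
    Runs searchBody σ 40 fun σ' =>
      (LevelsRep (tsys G st κ s) (d + 1) σ'.arr ∧ LevelRep σ'.arr d l) ∧
      (∀ d' ≤ D, d + 1 < d' → σ'.arr 7 d' 0 = 0) ∧ ∃ N : List (ℕ × ℕ), N.Nodup ∧
      (∀ y, y ∈ N ↔ d + 1 < (tsys G st κ s).lvl y ∧
        ∃ q ∈ p ++ [(x, e)], (tsys G st κ s).tgt q.2 = y) ∧ LevelRep σ'.arr (d + 1) N ∧
      ∀ v < n, ∀ t ≤ G.T, σ'.arr 6 v t = if (tsys G st κ s).lvl (v, t) ≤ d + 1 then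
        (tsys G st κ s).lvl (v, t) else if (v, t) ∈ N then d + 2 else 0 := by
  have hT : e.time ≤ G.T := (G.time_mem e he).2
  have hpos := lvl_tgt_pos (S := tsys G st κ s) (x := x) (by rw [hx]; omega) he hok
  have htgt : (tsys G st κ s).tgt e = (↑e.dst, e.time) := rfl
  rw [htgt] at hpos
  have hcase := hdist e.dst e.dst.2 e.time hT
  refine (Runs.ite (B := 32) (fun hb => ?_) fun hb => ?_).le (by simp [BExpr.time, WExpr.time])
  · simp only [BExpr.Holds, WExpr.eval, h13, h14] at hb
    rw [hb] at hcase
    -- The target is reachable, so an entry `0` cannot be its level; it is neither on an earlier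
    -- level nor found already in this scan.
    have hlt : d + 1 < (tsys G st κ s).lvl (↑e.dst, e.time) := by
      by_contra h
      rw [if_pos (by omega)] at hcase
      omega
    have hnot : ((e.dst : ℕ), e.time) ∉ N := fun h => by
      rw [if_neg (by omega), if_pos h] at hcase
      omega
    refine (Runs.seq (Runs.store (Runs.seq (Runs.store (Runs.seq (Runs.store
      (Runs.store ?_))))))).le (by simp [WExpr.time])
    simp only [Mem.setArr, WExpr.eval, hd, h13, h14]
    refine ⟨⟨hlow.1.congr fun d' hd' j => ?_, ?_, ?_, ?_⟩, fun d' hd' hd'' => ?_,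
      N ++ [((e.dst : ℕ), e.time)], ?_, fun y => ?_, ⟨?_, ?_, ?_⟩, fun v hv t ht => ?_⟩
    · have : d' ≠ d + 1 := by omega
      simp [this]
    · simpa using hlow.2.card
    · simpa using hlow.2.node
    · simpa using hlow.2.time
    · have : d' ≠ d + 1 := by omega
      simpa [this] using hcnt d' hd' hd''
    · rw [List.nodup_append]
      refine ⟨hN, by simp, ?_⟩
      rintro a ha b hb rfl
      rw [List.mem_singleton] at hb
      exact hnot (hb ▸ ha)
    · rw [List.mem_append, hmem, List.mem_singleton]
      constructor
      · rintro (⟨h1, q, h2, h3⟩ | rfl)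
        · exact ⟨h1, q, List.mem_append_left _ h2, h3⟩
        · exact ⟨hlt, (x, e), by simp, rfl⟩
      · rintro ⟨h1, q, h2, h3⟩
        rcases List.mem_append.1 h2 with h2 | h2
        · exact Or.inl ⟨h1, q, h2, h3⟩
        · rw [List.mem_singleton] at h2
          subst h2
          exact Or.inr h3.symm
    · simp [hrep.card]
    · intro j hj
      rcases Nat.lt_or_ge j N.length with h | h
      · have : j ≠ N.length := by omega
        simpa [hrep.card, this, List.getElem_append_left h] using hrep.node j h
      · have : j = N.length := by simp at hj; omega
        subst this
        simp [hrep.card]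
    · intro j hj
      rcases Nat.lt_or_ge j N.length with h | h
      · have : j ≠ N.length := by omega
        simpa [hrep.card, this, List.getElem_append_left h] using hrep.time j h
      · have : j = N.length := by simp at hj; omega
        subst this
        simp [hrep.card]
    · by_cases hvt : v = e.dst ∧ t = e.time
      · obtain ⟨rfl, rfl⟩ := hvt
        simp [show ¬ (tsys G st κ s).lvl (↑e.dst, e.time) ≤ d + 1 by omega]
      · have h1 : (v, t) ≠ ((e.dst : ℕ), e.time) := by simpa using hvt
        simp only [List.mem_append, List.mem_singleton, h1, or_false]
        simpa [hvt] using hdist v hv t ht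
  · simp only [BExpr.Holds, WExpr.eval, h13, h14] at hb
    refine (Runs.skip ?_).le (by omega)
    refine ⟨hlow, hcnt, N, hN, fun y => ?_, hrep, hdist⟩
    rw [hmem]
    constructor
    · rintro ⟨h1, q, h2, h3⟩
      exact ⟨h1, q, List.mem_append_left _ h2, h3⟩
    · rintro ⟨h1, q, h2, h3⟩
      rcases List.mem_append.1 h2 with h2 | h2
      · exact ⟨h1, q, h2, h3⟩
      · rw [List.mem_singleton] at h2
        subst h2
        rw [htgt] at h3
        subst h3
        rw [hcase, if_neg (by omega)] at hb
        have : ((e.dst : ℕ), e.time) ∈ N := by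
          by_contra h
          simp [h] at hb
        exact (hmem _).1 this

theorem Runs.search {σ : Mem} (hL : Lists L G) (hσ : Env G L κ w σ) (hs : s < n)
    (hdist : ∀ v < n, ∀ t ≤ G.T, σ.arr 6 v t = if (v, t) = (s, 0) then 1 else 0)
    (hcnt : ∀ d ≤ n * (G.T + 1), d ≠ 0 → σ.arr 7 d 0 = 0) (h0 : LevelRep σ.arr 0 [(s, 0)]) :
    Runs (searchProg st) σ (100 * ((n + L.length) * (G.T + 1))) fun σ' =>
      (∀ v < n, ∀ t ≤ G.T, σ'.arr 6 v t = (tsys G st κ s).lvl (v, t)) ∧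
      LevelsRep (tsys G st κ s) (n * (G.T + 1)) σ'.arr := by
  have hS := within_states (G := G) (st := st) (κ := κ) hs
  have hpos : 1 ≤ n * (G.T + 1) := Nat.mul_pos (by omega) (by omega)
  have hstart : (tsys G st κ s).start = (s, 0) := rfl
  refine (Runs.forUp (fun d arr _ =>
    (∀ v < n, ∀ t ≤ G.T, arr 6 v t = if (tsys G st κ s).lvl (v, t) ≤ d + 1 then
      (tsys G st κ s).lvl (v, t) else 0) ∧ LevelsRep (tsys G st κ s) (d + 1) arr ∧
    ∀ d' ≤ n * (G.T + 1), d < d' → arr 7 d' 0 = 0)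
    (fun d => (40 + 32) * levelWork (tsys G st κ s) L G.T d + 10) (N := n * (G.T + 1))
    (by simp [WExpr.eval, hσ.card]) rfl rfl rfl ⟨?_, ?_, ?_⟩ ?_).mono ?_ ?_
  · intro v hv t ht
    rw [hdist v hv t ht, ← hstart]
    by_cases h : (v, t) = (tsys G st κ s).start
    · rw [if_pos h, h, lvl_start]; rfl
    · have := mt (lvl_eq_one (S := tsys G st κ s)).1 h
      rw [if_neg h]
      split_ifs <;> omega
  · intro d hd
    obtain rfl : d = 0 := by omega
    refine ⟨_, ⟨by simp, fun x => ?_⟩, h0⟩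
    rw [List.mem_singleton, ← hstart, zero_add, lvl_eq_one]
  · exact fun d hd h => hcnt d hd (by omega)
  · rintro d hd σ₁ hk h8 ⟨hI1, hI2, hI3⟩
    obtain ⟨l, hl, hrep⟩ := hI2 d (by omega)
    have hE := hσ.keeps hk ⟨rfl, rfl, rfl, rfl, rfl, rfl, rfl, rfl⟩
    have key := Runs.scanLevel (G := G) (st := st) (κ := κ) (s := s) (L := L) (σ := σ₁) (l := l)
      (d := d) (body := searchBody) (fun p arr _ =>
        (LevelsRep (tsys G st κ s) (d + 1) arr ∧ LevelRep arr d l) ∧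
        (∀ d' ≤ n * (G.T + 1), d + 1 < d' → arr 7 d' 0 = 0) ∧ ∃ N : List (ℕ × ℕ), N.Nodup ∧
        (∀ y, y ∈ N ↔ d + 1 < (tsys G st κ s).lvl y ∧
          ∃ q ∈ p, (tsys G st κ s).tgt q.2 = y) ∧ LevelRep arr (d + 1) N ∧
        ∀ v < n, ∀ t ≤ G.T, arr 6 v t = if (tsys G st κ s).lvl (v, t) ≤ d + 1 then
          (tsys G st κ s).lvl (v, t) else if (v, t) ∈ N then d + 2 else 0) 40
      (fun _ => rfl) rfl rfl rfl hE.wait h8 (fun x hx => (hl.lt hs hx).1) hE.graph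
      (fun _ _ _ h => h.1.2) ?_ ?_
    · refine key.mono ?_ ?_
      · rw [hl.sum_map hs]; rfl
      rintro σ₂ - ⟨⟨h1, -⟩, h2, N, hN, hmem, hNrep, hdist'⟩
      -- After the complete scan `N` consists of all new targets from level `d + 1`, which by
      -- `lvl_eq_succ` form the next level.
      have hmem' : ∀ y, y ∈ N ↔ (tsys G st κ s).lvl y = d + 1 + 1 := by
        intro y
        rw [hmem, lvl_eq_succ (by omega)]
        constructor
        · rintro ⟨h3, q, hq, rfl⟩
          rw [mem_okPairs, hl.mem, hL.mem] at hq
          exact ⟨Or.inr h3, q.1, q.2, hq.1, hq.2.1, hq.2.2, rfl⟩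
        · rintro ⟨h3, x, e, hx, he, hok, rfl⟩
          have := lvl_tgt_pos (S := tsys G st κ s) (x := x) (by rw [hx]; omega) he hok
          exact ⟨h3.resolve_left this, (x, e), mem_okPairs.2
            ⟨(hl.mem x).2 hx, (hL.mem e).2 he, hok⟩, rfl⟩
      refine ⟨fun v hv t ht => ?_, fun d' hd' => ?_, h2⟩
      · rw [hdist' v hv t ht]
        simp only [hmem']
        split_ifs <;> omega
      · rcases Nat.lt_or_ge d' (d + 1) with h | h
        · exact h1 d' h
        · obtain rfl : d' = d + 1 := by omega
          exact ⟨N, ⟨hN, hmem'⟩, hNrep⟩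
    · refine ⟨⟨hI2, hrep⟩, fun d' h h' => hI3 d' h (by omega), [], by simp, by simp,
        ⟨?_, by simp, by simp⟩, ?_⟩
      · simpa using hI3 (d + 1) (by omega) (by omega)
      · simpa using hI1
    · rintro p x e σ₂ hx he hok hk₂ - - h13 h14 ⟨hlow, hcnt', N, hN, hmem, hNrep, hdist'⟩
      exact search_step ((hk₂.var 8 rfl).trans h8) h13 h14 ((hl.mem x).1 hx) ((hL.mem e).1 he) hok
        hlow hcnt' hN hmem hNrep hdist'
  · have h1 := sum_work_le (tsys G st κ s) L G.T (40 + 32) 10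
    have h2 : n * (G.T + 1) ≤ (n + L.length) * (G.T + 1) := Nat.mul_le_mul_right _ (by omega)
    simp only [WExpr.time]
    omega
  · rintro σ' - ⟨h1, h2, -⟩
    refine ⟨fun v hv t ht => ?_, fun d hd => h2 d (by omega)⟩
    have := hS.lvl_le (v, t)
    rw [card_states] at this
    rw [h1 v hv t ht, if_pos (by omega)]

end

section

open TS

variable {n : ℕ} {G : TemporalGraph (Fin n)} {st : Strictness} {κ w s : ℕ}
  {L : List (TArc (Fin n))}

/-! ### Counting geodesics -/

open WExpr in
def countBody : Prog :=
  .ite (.eq (get 6 (var 13) (var 14)) (succ (succ (var 8))))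
    (.storeQ 1 (var 13) (var 14)
      (.add (.get 1 (var 13) (var 14)) (.get 1 (var 10) (var 11)))) .skip

open WExpr in
def countProg (st : Strictness) : Prog :=
  forLoop 8 21 (get 13 (lit 0) (lit 0)) (scanLevelProg st countBody)

/-- The memory holds the levels of all temporal nodes. -/
def DistRep (S : TS (TArc (Fin n)) (ℕ × ℕ)) (T : ℕ) (arr : ℕ → ℕ → ℕ → ℕ) : Prop :=
  ∀ v < n, ∀ t ≤ T, arr 6 v t = S.lvl (v, t)

theorem Runs.count {σ : Mem} (hL : Lists L G) (hσ : Env G L κ w σ) (hs : s < n)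
    (hdist : DistRep (tsys G st κ s) G.T σ.arr)
    (hlev : LevelsRep (tsys G st κ s) (n * (G.T + 1)) σ.arr)
    (h1 : ∀ v < n, ∀ t ≤ G.T, σ.num 1 v t = if (v, t) = (s, 0) then 1 else 0) :
    Runs (countProg st) σ (100 * ((n + L.length) * (G.T + 1))) fun σ' =>
      ∀ v < n, ∀ t ≤ G.T, σ'.num 1 v t = (tsys G st κ s).sig (v, t) := by
  classical
  have hS := within_states (G := G) (st := st) (κ := κ) hs
  have hpos : 1 ≤ n * (G.T + 1) := Nat.mul_pos (by omega) (by omega)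
  have hstart : (tsys G st κ s).start = (s, 0) := rfl
  refine (Runs.forUp (fun d _ num => ∀ v < n, ∀ t ≤ G.T, num 1 v t =
      if (tsys G st κ s).lvl (v, t) ≤ d + 1 then (tsys G st κ s).sig (v, t) else 0)
    (fun d => (20 + 32) * levelWork (tsys G st κ s) L G.T d + 10) (N := n * (G.T + 1))
    (by simp [WExpr.eval, hσ.card]) rfl rfl rfl ?_ ?_).mono ?_ ?_
  · intro v hv t ht
    rw [h1 v hv t ht, ← hstart]
    by_cases h : (v, t) = (tsys G st κ s).start
    · rw [if_pos h, h, hS.sig_start, if_pos lvl_start.le]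
    · have := mt (lvl_eq_one (S := tsys G st κ s)).1 h
      rw [if_neg h]
      split_ifs with h'
      · rw [hS.sig_eq_zero (by omega)]
      · rfl
  · rintro d hd σ₁ hk h8 hI
    have hE := hσ.keeps hk ⟨rfl, rfl, rfl, rfl, rfl, rfl, rfl, rfl⟩
    have h6 : σ₁.arr 6 = σ.arr 6 := hk.arr 6 rfl
    obtain ⟨l, hl, hrep⟩ := hlev.congr (arr' := σ₁.arr) (fun d' _ j => by
      rw [hk.arr 7 rfl, hk.arr 8 rfl, hk.arr 9 rfl]; exact ⟨rfl, rfl, rfl⟩) d hd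
    -- During the scan counts are read on level `d + 1`, where they are final, and changed on level
    -- `d + 2`, where they are partial sums of `sig_succ`.
    have key := Runs.scanLevel (G := G) (st := st) (κ := κ) (s := s) (L := L) (σ := σ₁) (l := l)
      (d := d) (body := countBody) (fun p arr num => arr = σ₁.arr ∧ ∀ v < n, ∀ t ≤ G.T, num 1 v t =
        if (tsys G st κ s).lvl (v, t) ≤ d + 1 then (tsys G st κ s).sig (v, t) else
        if (tsys G st κ s).lvl (v, t) = d + 2 then (p.map fun q =>
          if (tsys G st κ s).tgt q.2 = (v, t) then (tsys G st κ s).sig q.1 else 0).sum else 0) 20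
      (fun _ => rfl) rfl rfl rfl hE.wait h8 (fun x hx => (hl.lt hs hx).1) hE.graph
      (fun _ _ _ h => h.1 ▸ hrep) ⟨rfl, ?_⟩ ?_
    · refine key.mono ?_ ?_
      · rw [hl.sum_map hs]; rfl
      rintro σ₂ - ⟨-, h2⟩ v hv t ht
      rw [h2 v hv t ht, hl.sum_okPairs hs hL]
      by_cases h3 : (tsys G st κ s).lvl (v, t) ≤ d + 1
      · rw [if_pos h3, if_pos (by omega)]
      · rw [if_neg h3]
        by_cases h4 : (tsys G st κ s).lvl (v, t) = d + 2
        · rw [if_pos h4, if_pos (by omega)]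
          convert (hS.sig_succ (d := d + 1) (by omega) h4).symm
        · rw [if_neg h4, if_neg (by omega)]
    · intro v hv t ht
      rw [hI v hv t ht]
      simp
    · rintro p x e σ₂ hx heL hok hk₂ h10 h11 h13 h14 ⟨harr, hI₂⟩
      have he := (hL.mem e).1 heL
      have hT : e.time ≤ G.T := (G.time_mem e he).2
      have hxn := hl.lt hs hx
      have hlx := (hl.mem x).1 hx
      have h8' : σ₂.var 8 = d := (hk₂.var 8 rfl).trans h8
      have htgt : (tsys G st κ s).tgt e = (↑e.dst, e.time) := rfl
      have hval : σ₂.arr 6 e.dst e.time = (tsys G st κ s).lvl (↑e.dst, e.time) := by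
        rw [harr, h6]; exact hdist _ e.dst.2 _ hT
      refine (Runs.ite (B := 12) (fun hb => ?_) fun hb => ?_).le (by simp [BExpr.time, WExpr.time])
      · simp only [BExpr.Holds, WExpr.eval, h13, h14, h8', hval] at hb
        refine (Runs.storeQ ?_).le (by simp [WExpr.time, QExpr.time])
        refine ⟨harr, fun v hv t ht => ?_⟩
        simp only [Mem.setNum, WExpr.eval, QExpr.eval, h13, h14, h10, h11, List.map_append,
          List.sum_append, List.map_cons, List.map_nil, List.sum_cons, List.sum_nil, add_zero, htgt]
        by_cases hvt : v = e.dst ∧ t = e.time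
        · obtain ⟨rfl, rfl⟩ := hvt
          rw [hI₂ _ hv _ ht, hI₂ _ hxn.1 _ hxn.2]
          simp [hb, hlx]
        · have h1' : ((e.dst : ℕ), e.time) ≠ (v, t) := fun h => hvt
            ⟨(congrArg Prod.fst h).symm, (congrArg Prod.snd h).symm⟩
          simp only [true_and, hvt, if_false, h1', add_zero]
          exact hI₂ v hv t ht
      · simp only [BExpr.Holds, WExpr.eval, h13, h14, h8', hval] at hb
        refine (Runs.skip ?_).le (by omega)
        refine ⟨harr, fun v hv t ht => ?_⟩
        rw [hI₂ v hv t ht]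
        by_cases hvt : ((e.dst : ℕ), e.time) = (v, t)
        · have : ¬ (tsys G st κ s).lvl (v, t) = d + 2 := by rw [← hvt]; omega
          simp [this]
        · simp [htgt, hvt]
  · have h := sum_work_le (tsys G st κ s) L G.T (20 + 32) 10
    have h2 : n * (G.T + 1) ≤ (n + L.length) * (G.T + 1) := Nat.mul_le_mul_right _ (by omega)
    simp only [WExpr.time]
    omega
  · intro σ' _ h v hv t ht
    have := hS.lvl_le (v, t)
    rw [card_states] at this
    rw [h v hv t ht, if_pos (by omega)]

/-- What the memory holds about the source. -/
structure SourceRep (S : TS (TArc (Fin n)) (ℕ × ℕ)) (T : ℕ) (σ : Mem) : Prop where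
  dist : DistRep S T σ.arr
  levels : LevelsRep S (n * (T + 1)) σ.arr
  sig : ∀ v < n, ∀ t ≤ T, σ.num 1 v t = S.sig (v, t)

def sourceProg (st : Strictness) : Prog := .seq initProg (.seq (searchProg st) (countProg st))

theorem Runs.source {σ : Mem} (hL : Lists L G) (hσ : Env G L κ w σ) (hs : s < n)
    (h7 : σ.var 7 = s) :
    Runs (sourceProg st) σ (300 * ((n + L.length) * (G.T + 1))) fun σ' =>
      SourceRep (tsys G st κ s) G.T σ' ∧ ∀ v < n, ∀ t ≤ G.T, σ'.num 2 v t = 0 := by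
  have h2 : n * (G.T + 1) ≤ (n + L.length) * (G.T + 1) := Nat.mul_le_mul_right _ (by omega)
  refine (Runs.seq_keeps (Runs.init hσ h7 hs) fun σ₁ k₁ h₁ => Runs.seq_keeps
    (Runs.search hL (hσ.keeps k₁ ⟨rfl, rfl, rfl, rfl, rfl, rfl, rfl, rfl⟩) hs
      (fun v hv t ht => (h₁.1 v hv t ht).1) h₁.2.1 h₁.2.2) fun σ₂ k₂ h₂ =>
    (Runs.count hL ((hσ.keeps k₁ ⟨rfl, rfl, rfl, rfl, rfl, rfl, rfl, rfl⟩).keeps k₂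
      ⟨rfl, rfl, rfl, rfl, rfl, rfl, rfl, rfl⟩) hs h₂.1 h₂.2 fun v hv t ht => by
        rw [k₂.num 1 rfl]; exact (h₁.1 v hv t ht).2.1).mono le_rfl fun σ₃ k₃ h₃ => ?_).le
      (by omega)
  refine ⟨⟨fun v hv t ht => ?_, h₂.2.congr fun d' _ j => ?_, h₃⟩, fun v hv t ht => ?_⟩
  · rw [k₃.arr 6 rfl]
    exact h₂.1 v hv t ht
  · rw [k₃.arr 7 rfl, k₃.arr 8 rfl, k₃.arr 9 rfl]
    exact ⟨rfl, rfl, rfl⟩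
  · rw [k₃.num 2 rfl, k₂.num 2 rfl]
    exact (h₁.1 v hv t ht).2.2

/-! ### Shares of the optimal walks -/

open WExpr in
def scoreExpr : WExpr := sub (get 10 (var 11) (lit 0)) (get 6 (var 10) (var 11))

open WExpr in
def reachedTest : BExpr := .not (.eq (get 6 (var 10) (var 11)) (lit 0))

open WExpr in
-- Three runs over the times of a node: the maximal score, the number of geodesics that attain it,
-- and the resulting shares.
def shareNodeProg : Prog :=
  .seq (.store 11 (var 10) (lit 0) (lit 0))
  (.seq (forLoop 11 20 (succ (var 1))
    (.ite (.and reachedTest (.lt (get 11 (var 10) (lit 0)) scoreExpr))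
      (.store 11 (var 10) (lit 0) scoreExpr) .skip))
  (.seq (.storeQ 4 (var 10) (lit 0) (.lit 0))
  (.seq (forLoop 11 20 (succ (var 1))
    (.ite (.and reachedTest (.eq scoreExpr (get 11 (var 10) (lit 0))))
      (.storeQ 4 (var 10) (lit 0) (.add (.get 4 (var 10) (lit 0)) (.get 1 (var 10) (var 11)))) .skip))
  (forLoop 11 20 (succ (var 1))
    (.ite (.and (.not (.eq (var 10) (var 7)))
        (.and reachedTest (.eq scoreExpr (get 11 (var 10) (lit 0)))))
      (.storeQ 3 (var 10) (var 11) (.div (.lit 1) (.get 4 (var 10) (lit 0))))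
      (.storeQ 3 (var 10) (var 11) (.lit 0)))))))

theorem Runs.shareNode {σ : Mem} (hσ : Env G L κ w σ) (h7 : σ.var 7 = s)
    (hsrc : SourceRep (tsys G st κ s) G.T σ) {v : ℕ} (hv : v < n) (h10 : σ.var 10 = v) :
    Runs shareNodeProg σ (160 * (G.T + 1)) fun σ' =>
      (∀ t ≤ G.T, σ'.num 3 v t = share G st κ w s (v, t)) ∧
      ∀ v' ≠ v, ∀ t ≤ G.T, σ'.num 3 v' t = σ.num 3 v' t := by
  classical
  have hscore : ∀ σ' : Mem, σ'.arr 10 = σ.arr 10 → σ'.arr 6 = σ.arr 6 → σ'.var 10 = σ.var 10 →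
      ∀ t ≤ G.T, σ'.var 11 = t → scoreExpr.eval σ' = score G st κ w s (v, t) := by
    intro σ' h1 h2 h3 t ht h4
    simp only [scoreExpr, WExpr.eval, h1, h2, h3, h10, h4, hσ.base t ht, hsrc.dist v hv t ht, score]
  have hreach : ∀ σ' : Mem, σ'.arr 6 = σ.arr 6 → σ'.var 10 = σ.var 10 →
      ∀ t ≤ G.T, σ'.var 11 = t → (reachedTest.Holds σ' ↔ (tsys G st κ s).lvl (v, t) ≠ 0) := by
    intro σ' h2 h3 t ht h4
    simp only [reachedTest, BExpr.Holds, WExpr.eval, h2, h3, h10, h4, hsrc.dist v hv t ht, ne_eq]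
  refine (Runs.seq_keeps (Runs.store (Q := fun σ' => σ'.arr 11 v 0 = 0) ?_) fun σ₁ k₁ h₁ =>
    Runs.seq_keeps (Runs.forUp_const (fun k arr _ => arr 11 v 0 = (Finset.range k).sup fun t =>
      if (tsys G st κ s).lvl (v, t) = 0 then 0 else score G st κ w s (v, t)) 31 (N := G.T + 1)
      (by simp [WExpr.eval, k₁.var 1 rfl, hσ.tmax]) rfl rfl rfl le_rfl (by simpa using h₁) ?_)
      fun σ₂ k₂ h₂ =>
    Runs.seq_keeps (Runs.storeQ (Q := fun σ' => σ'.num 4 v 0 = 0) ?_) fun σ₃ k₃ h₃ =>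
    Runs.seq_keeps (Runs.forUp_const (fun k _ num => num 4 v 0 = ∑ t ∈ Finset.range k,
      if (tsys G st κ s).lvl (v, t) ≠ 0 ∧ score G st κ w s (v, t) = best G st κ w s v then
      (tsys G st κ s).sig (v, t) else 0) 30 (N := G.T + 1)
      (by simp [WExpr.eval, k₃.var 1 rfl, k₂.var 1 rfl, k₁.var 1 rfl, hσ.tmax]) rfl rfl rfl le_rfl
      (by simpa using h₃) ?_)
      fun σ₄ k₄ h₄ =>
    Runs.forUp_const (fun k _ num => (∀ t < k, num 3 v t = share G st κ w s (v, t)) ∧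
      ∀ v' ≠ v, ∀ t ≤ G.T, num 3 v' t = σ.num 3 v' t) 32 (N := G.T + 1)
      (by simp [WExpr.eval, k₄.var 1 rfl, k₃.var 1 rfl, k₂.var 1 rfl, k₁.var 1 rfl, hσ.tmax])
      rfl rfl rfl le_rfl ⟨by simp, fun v' _ t _ => by
        rw [k₄.num 3 rfl, k₃.num 3 rfl, k₂.num 3 rfl, k₁.num 3 rfl]⟩ ?_).mono ?_ ?_
  · simp [Mem.setArr, WExpr.eval, h10]
  · intro t ht σ₂ k₂ h11 hI
    have a10 : σ₂.arr 10 = σ.arr 10 := by rw [k₂.arr 10 rfl, k₁.arr 10 rfl]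
    have a6 : σ₂.arr 6 = σ.arr 6 := by rw [k₂.arr 6 rfl, k₁.arr 6 rfl]
    have v10 : σ₂.var 10 = σ.var 10 := by rw [k₂.var 10 rfl, k₁.var 10 rfl]
    have e1 := hscore σ₂ a10 a6 v10 t (by omega) h11
    have e2 := hreach σ₂ a6 v10 t (by omega) h11
    refine (Runs.ite (B := 11) (fun hb => ?_) fun hb => ?_).le
      (by simp [BExpr.time, WExpr.time, reachedTest, scoreExpr])
    · simp only [BExpr.Holds, e1, e2, WExpr.eval, v10, h10, hI] at hb
      refine (Runs.store ?_).le (by simp [WExpr.time, scoreExpr])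
      rw [Finset.range_add_one, Finset.sup_insert, if_neg hb.1, sup_eq_left.2 hb.2.le]
      simp only [Mem.setArr, WExpr.eval, e1, v10, h10, and_self, if_true]
    · simp only [BExpr.Holds, e1, e2, WExpr.eval, v10, h10, hI] at hb
      refine (Runs.skip ?_).le (by omega)
      rw [Finset.range_add_one, Finset.sup_insert, hI]
      symm
      rw [sup_eq_right]
      split_ifs with h
      · exact Nat.zero_le _
      · by_contra h'
        exact hb ⟨h, not_le.1 h'⟩
  · simp [Mem.setNum, WExpr.eval, QExpr.eval, k₂.var 10 rfl, k₁.var 10 rfl, h10]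
  · intro t ht σ₄ k₄ h11 hI
    have a10 : σ₄.arr 10 = σ.arr 10 := by
      rw [k₄.arr 10 rfl, k₃.arr 10 rfl, k₂.arr 10 rfl, k₁.arr 10 rfl]
    have a6 : σ₄.arr 6 = σ.arr 6 := by rw [k₄.arr 6 rfl, k₃.arr 6 rfl, k₂.arr 6 rfl, k₁.arr 6 rfl]
    have a11 : σ₄.arr 11 v 0 = best G st κ w s v := by rw [k₄.arr 11 rfl, k₃.arr 11 rfl, h₂]; rfl
    have n1 : σ₄.num 1 = σ.num 1 := by rw [k₄.num 1 rfl, k₃.num 1 rfl, k₂.num 1 rfl, k₁.num 1 rfl]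
    have v10 : σ₄.var 10 = σ.var 10 := by
      rw [k₄.var 10 rfl, k₃.var 10 rfl, k₂.var 10 rfl, k₁.var 10 rfl]
    have e1 := hscore σ₄ a10 a6 v10 t (by omega) h11
    have e2 := hreach σ₄ a6 v10 t (by omega) h11
    rw [Finset.sum_range_succ]
    refine (Runs.ite (B := 10) (fun hb => ?_) fun hb => ?_).le
      (by simp [BExpr.time, WExpr.time, reachedTest, scoreExpr])
    · simp only [BExpr.Holds, e1, e2, WExpr.eval, v10, h10, a11] at hb
      refine (Runs.storeQ ?_).le (by simp [WExpr.time, QExpr.time])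
      rw [if_pos hb]
      simp only [Mem.setNum, WExpr.eval, QExpr.eval, v10, h10, h11, and_self, if_true, hI, n1,
        hsrc.sig v hv t (by omega)]
    · simp only [BExpr.Holds, e1, e2, WExpr.eval, v10, h10, a11] at hb
      refine (Runs.skip ?_).le (by omega)
      rw [if_neg hb, add_zero, hI]
  · intro t ht σ₅ k₅ h11 ⟨hI, hI'⟩
    have a10 : σ₅.arr 10 = σ.arr 10 := by
      rw [k₅.arr 10 rfl, k₄.arr 10 rfl, k₃.arr 10 rfl, k₂.arr 10 rfl, k₁.arr 10 rfl]
    have a6 : σ₅.arr 6 = σ.arr 6 := by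
      rw [k₅.arr 6 rfl, k₄.arr 6 rfl, k₃.arr 6 rfl, k₂.arr 6 rfl, k₁.arr 6 rfl]
    have a11 : σ₅.arr 11 v 0 = best G st κ w s v := by
      rw [k₅.arr 11 rfl, k₄.arr 11 rfl, k₃.arr 11 rfl, h₂]; rfl
    have n4 : σ₅.num 4 v 0 = tot G st κ w s v := by rw [k₅.num 4 rfl, h₄]; rfl
    have v10 : σ₅.var 10 = σ.var 10 := by
      rw [k₅.var 10 rfl, k₄.var 10 rfl, k₃.var 10 rfl, k₂.var 10 rfl, k₁.var 10 rfl]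
    have v7 : σ₅.var 7 = s := by
      rw [k₅.var 7 rfl, k₄.var 7 rfl, k₃.var 7 rfl, k₂.var 7 rfl, k₁.var 7 rfl, h7]
    have e1 := hscore σ₅ a10 a6 v10 t (by omega) h11
    have e2 := hreach σ₅ a6 v10 t (by omega) h11
    have fin : ∀ q : ℚ, q = share G st κ w s (v, t) →
        (∀ t' < t + 1, (σ₅.setNum 3 v t q).num 3 v t' = share G st κ w s (v, t')) ∧
        ∀ v' ≠ v, ∀ t' ≤ G.T, (σ₅.setNum 3 v t q).num 3 v' t' = σ.num 3 v' t' := by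
      rintro q rfl
      refine ⟨fun t' ht' => ?_, fun v' hv' t' ht' => ?_⟩
      · rcases eq_or_ne t' t with rfl | hne
        · simp [Mem.setNum]
        · simpa [Mem.setNum, hne] using hI t' (by omega)
      · simpa [Mem.setNum, hv'] using hI' v' hv' t' ht'
    refine (Runs.ite (B := 8) (fun hb => ?_) fun hb => ?_).le
      (by simp [BExpr.time, WExpr.time, reachedTest, scoreExpr])
    · simp only [BExpr.Holds, e1, e2, WExpr.eval, v10, h10, a11, v7] at hb
      refine (Runs.storeQ ?_).le (by simp [WExpr.time, QExpr.time])
      simp only [WExpr.eval, QExpr.eval, v10, h10, h11, n4]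
      exact fin _ (by rw [share, if_pos hb])
    · simp only [BExpr.Holds, e1, e2, WExpr.eval, v10, h10, a11, v7] at hb
      refine (Runs.storeQ ?_).le (by simp [WExpr.time, QExpr.time])
      simp only [WExpr.eval, QExpr.eval, v10, h10, h11]
      exact fin _ (by rw [share, if_neg hb])
  · simp only [WExpr.time, QExpr.time]
    omega
  · rintro σ' - ⟨h1, h2⟩
    exact ⟨fun t ht => h1 t (by omega), h2⟩

def shareProg : Prog := forLoop 10 19 (.var 0) shareNodeProg

theorem Runs.share {σ : Mem} (hσ : Env G L κ w σ) (h7 : σ.var 7 = s)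
    (hsrc : SourceRep (tsys G st κ s) G.T σ) (hs : s < n) :
    Runs shareProg σ (180 * (n * (G.T + 1))) fun σ' =>
      ∀ v < n, ∀ t ≤ G.T, σ'.num 3 v t = TemporalBetweenness.share G st κ w s (v, t) := by
  have hpos : 1 ≤ n * (G.T + 1) := Nat.mul_pos (by omega) (by omega)
  have hle : n ≤ n * (G.T + 1) := Nat.le_mul_of_pos_right _ (by omega)
  refine Runs.forUp_const (fun k _ num => ∀ v < k, ∀ t ≤ G.T, num 3 v t =
    TemporalBetweenness.share G st κ w s (v, t)) (160 * (G.T + 1)) (by simp [WExpr.eval, hσ.nodes])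
    rfl rfl rfl ?_ (by simp) ?_
  · simp only [WExpr.time]
    ring_nf at hpos hle ⊢
    omega
  · intro v hv σ₁ k₁ h10 hI
    refine (Runs.shareNode (st := st) (s := s) (hσ.keeps k₁ ⟨rfl, rfl, rfl, rfl, rfl, rfl, rfl, rfl⟩)
      ((k₁.var 7 rfl).trans h7) ⟨?_, ?_, ?_⟩ hv h10).mono le_rfl ?_
    · intro v hv t ht
      rw [k₁.arr 6 rfl]
      exact hsrc.dist v hv t ht
    · exact hsrc.levels.congr fun d' _ j => by
        rw [k₁.arr 7 rfl, k₁.arr 8 rfl, k₁.arr 9 rfl]; exact ⟨rfl, rfl, rfl⟩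
    · intro v hv t ht
      rw [k₁.num 1 rfl]
      exact hsrc.sig v hv t ht
    · rintro σ' - ⟨h1, h2⟩ v' hv' t ht
      rcases eq_or_ne v' v with rfl | hne
      · exact h1 t ht
      · rw [h2 v' hne t ht]
        exact hI v' (by omega) t ht

end

section

open TS

variable {n : ℕ} {G : TemporalGraph (Fin n)} {st : Strictness} {κ w s : ℕ}
  {L : List (TArc (Fin n))}

theorem SourceRep.keeps {S : TS (TArc (Fin n)) (ℕ × ℕ)} {T : ℕ} {σ σ' : Mem} {p : Prog}
    (h : SourceRep S T σ) (hk : p.Keeps σ σ') (h6 : p.wA 6 = false) (h7 : p.wA 7 = false)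
    (h8 : p.wA 8 = false) (h9 : p.wA 9 = false) (h1 : p.wN 1 = false) : SourceRep S T σ' := by
  refine ⟨fun v hv t ht => ?_, h.levels.congr fun d' _ j => ?_, fun v hv t ht => ?_⟩
  · rw [hk.arr 6 h6]
    exact h.dist v hv t ht
  · rw [hk.arr 7 h7, hk.arr 8 h8, hk.arr 9 h9]
    exact ⟨rfl, rfl, rfl⟩
  · rw [hk.num 1 h1]
    exact h.sig v hv t ht

/-! ### Accumulating the shares -/

open WExpr in
def collectBody : Prog :=
  .ite (.eq (get 6 (var 13) (var 14)) (succ (succ (var 8))))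
    (.storeQ 2 (var 10) (var 11)
      (.add (.get 2 (var 10) (var 11)) (.add (.get 2 (var 13) (var 14)) (.get 3 (var 13) (var 14)))))
    .skip

open WExpr in
-- The levels are taken in descending order, so the values read from the next level are final.
def collectProg (st : Strictness) : Prog :=
  forLoop 16 23 (get 13 (lit 0) (lit 0))
    (.seq (.assign 8 (sub (get 13 (lit 0) (lit 0)) (succ (var 16)))) (scanLevelProg st collectBody))

open scoped Classical in
-- Accumulated values are written on level `d + 1` and taken over from level `d + 2`, so the result
-- can be stated in terms of the initial values.
theorem collect_level {σ : Mem} {τ : ℕ × ℕ → ℚ} {l : List (ℕ × ℕ)} {d : ℕ} (hL : Lists L G)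
    (hσ : Env G L κ w σ) (hs : s < n) (h8 : σ.var 8 = d)
    (hdist : DistRep (tsys G st κ s) G.T σ.arr) (hl : IsLevel (tsys G st κ s) d l)
    (hrep : LevelRep σ.arr d l) (hτ : ∀ v < n, ∀ t ≤ G.T, σ.num 3 v t = τ (v, t))
    (h0 : ∀ v < n, ∀ t ≤ G.T, (tsys G st κ s).lvl (v, t) = d + 1 → σ.num 2 v t = 0) :
    Runs (scanLevelProg st collectBody) σ ((25 + 32) * levelWork (tsys G st κ s) L G.T d + 10)
      fun σ' => ∀ v < n, ∀ t ≤ G.T, σ'.num 2 v t =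
        if (tsys G st κ s).lvl (v, t) = d + 1 then
          ∑ e ∈ (tsys G st κ s).arcs with (tsys G st κ s).ok (v, t) e,
            if (tsys G st κ s).lvl ((tsys G st κ s).tgt e) = d + 2 then
              σ.num 2 e.dst e.time + τ ((tsys G st κ s).tgt e) else 0
        else σ.num 2 v t := by
  have key := Runs.scanLevel (G := G) (st := st) (κ := κ) (s := s) (L := L) (σ := σ) (l := l)
    (d := d) (body := collectBody) (fun p arr num => (arr = σ.arr ∧ num 3 = σ.num 3) ∧
      ∀ v < n, ∀ t ≤ G.T,
      num 2 v t = if (tsys G st κ s).lvl (v, t) = d + 1 then (p.map fun q =>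
        if q.1 = (v, t) ∧ (tsys G st κ s).lvl ((tsys G st κ s).tgt q.2) = d + 2 then
          σ.num 2 q.2.dst q.2.time + τ ((tsys G st κ s).tgt q.2) else 0).sum else σ.num 2 v t) 25
    (fun _ => rfl) rfl rfl rfl hσ.wait h8 (fun x hx => (hl.lt hs hx).1) hσ.graph
    (fun _ _ _ h => h.1.1 ▸ hrep) ⟨⟨rfl, rfl⟩, ?_⟩ ?_
  · refine key.mono ?_ ?_
    · rw [hl.sum_map hs]; rfl
    rintro σ₂ - ⟨-, h2⟩ v hv t ht
    rw [h2 v hv t ht, hl.sum_okPairs hs hL]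
    refine if_ctx_congr Iff.rfl (fun h => ?_) fun _ => rfl
    rw [Finset.sum_eq_single_of_mem (v, t)]
    · refine Finset.sum_congr rfl fun e _ => ?_
      simp
    · simp [h, (within_states hs).mem (show (tsys G st κ s).lvl (v, t) ≠ 0 by omega)]
    · intro x _ hx
      refine Finset.sum_eq_zero fun e _ => ?_
      simp [hx]
  · intro v hv t ht
    split_ifs with h
    · simpa using h0 v hv t ht h
    · rfl
  · rintro p x e σ₂ hx heL hok hk₂ h10 h11 h13 h14 ⟨⟨harr, hn3⟩, hI₂⟩
    have he := (hL.mem e).1 heL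
    have hT : e.time ≤ G.T := (G.time_mem e he).2
    have hxn := hl.lt hs hx
    have hlx := (hl.mem x).1 hx
    have h8' : σ₂.var 8 = d := (hk₂.var 8 rfl).trans h8
    have htgt : (tsys G st κ s).tgt e = (↑e.dst, e.time) := rfl
    have hval : σ₂.arr 6 e.dst e.time = (tsys G st κ s).lvl (↑e.dst, e.time) := by
      rw [harr]; exact hdist _ e.dst.2 _ hT
    refine (Runs.ite (B := 17) (fun hb => ?_) fun hb => ?_).le (by simp [BExpr.time, WExpr.time])
    · simp only [BExpr.Holds, WExpr.eval, h13, h14, h8', hval] at hb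
      refine (Runs.storeQ ?_).le (by simp [WExpr.time, QExpr.time])
      refine ⟨⟨harr, by simp [Mem.setNum, hn3]⟩, fun v hv t ht => ?_⟩
      simp only [Mem.setNum, WExpr.eval, QExpr.eval, h13, h14, h10, h11, List.map_append,
        List.sum_append, List.map_cons, List.map_nil, List.sum_cons, List.sum_nil, add_zero, htgt,
        hb, and_true, true_and]
      by_cases hvt : x = (v, t)
      · subst hvt
        rw [hI₂ _ hv _ ht, hI₂ _ e.dst.2 _ hT, hn3, hτ _ e.dst.2 _ hT]
        simp [hlx, hb]
      · have h1' : ¬ (v = x.1 ∧ t = x.2) := fun h => hvt (Prod.ext h.1.symm h.2.symm)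
        simp only [h1', if_false, hvt, add_zero]
        exact hI₂ v hv t ht
    · simp only [BExpr.Holds, WExpr.eval, h13, h14, h8', hval] at hb
      refine (Runs.skip ?_).le (by omega)
      refine ⟨⟨harr, hn3⟩, fun v hv t ht => ?_⟩
      rw [hI₂ v hv t ht]
      simp [htgt, hb]

theorem Runs.collect {σ : Mem} {τ : ℕ × ℕ → ℚ} (hL : Lists L G) (hσ : Env G L κ w σ) (hs : s < n)
    (hsrc : SourceRep (tsys G st κ s) G.T σ)
    (hτ : ∀ v < n, ∀ t ≤ G.T, σ.num 3 v t = τ (v, t))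
    (h0 : ∀ v < n, ∀ t ≤ G.T, σ.num 2 v t = 0) :
    Runs (collectProg st) σ (100 * ((n + L.length) * (G.T + 1))) fun σ' =>
      (tsys G st κ s).Accumulates τ fun x => σ'.num 2 x.1 x.2 := by
  classical
  have hS := within_states (G := G) (st := st) (κ := κ) hs
  have hpos : 1 ≤ n * (G.T + 1) := Nat.mul_pos (by omega) (by omega)
  have hmem : ∀ x, (tsys G st κ s).lvl x ≠ 0 → x.1 < n ∧ x.2 ≤ G.T := by
    intro x hx
    have := hS.mem hx
    simp only [states, Finset.mem_product, Finset.mem_range] at this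
    omega
  -- After `k` rounds the recurrence holds on the top `k` levels, and the entries below are still
  -- zero.
  refine (Runs.forUp (fun k _ num => ∀ v < n, ∀ t ≤ G.T,
      ((tsys G st κ s).lvl (v, t) ≤ n * (G.T + 1) - k → num 2 v t = 0) ∧
      (n * (G.T + 1) - k < (tsys G st κ s).lvl (v, t) → num 2 v t =
        ∑ e ∈ (tsys G st κ s).arcs with (tsys G st κ s).ok (v, t) e,
          if (tsys G st κ s).lvl ((tsys G st κ s).tgt e) = (tsys G st κ s).lvl (v, t) + 1 then
            num 2 e.dst e.time + τ ((tsys G st κ s).tgt e) else 0))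
    (fun k => (25 + 32) * levelWork (tsys G st κ s) L G.T (n * (G.T + 1) - 1 - k) + 17)
    (N := n * (G.T + 1))
    (by simp [WExpr.eval, hσ.card]) rfl rfl rfl ?_ ?_).mono ?_ ?_
  · intro v hv t ht
    refine ⟨fun _ => h0 v hv t ht, fun h => ?_⟩
    have := hS.lvl_le (v, t)
    rw [card_states] at this
    omega
  · rintro k hk σ₁ hk₁ h16 hI
    have hE := hσ.keeps hk₁ ⟨rfl, rfl, rfl, rfl, rfl, rfl, rfl, rfl⟩
    have hsrc₁ := hsrc.keeps hk₁ rfl rfl rfl rfl rfl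
    obtain ⟨d, hd⟩ : ∃ d, d = n * (G.T + 1) - (k + 1) := ⟨_, rfl⟩
    obtain ⟨l, hl, hrep⟩ := hsrc₁.levels d (by omega)
    have hd' : n * (G.T + 1) - 1 - k = d := by omega
    have hdk : n * (G.T + 1) - k = d + 1 := by omega
    rw [hd', ← hd]
    rw [hdk] at hI
    have key := collect_level (st := st) (s := s) (τ := τ) (w := w) (κ := κ) (σ := σ₁.setVar 8 d)
      hL ⟨hE.nodes, hE.tmax, hE.wait, hE.graph, hE.card, hE.base⟩ hs (by simp [Mem.setVar])
      hsrc₁.dist hl hrep (fun v hv t ht => by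
        have := hτ v hv t ht
        rwa [← hk₁.num 3 rfl] at this)
      (fun v hv t ht h => (hI v hv t ht).1 h.le)
    have hset : σ₁.setVar 8 (WExpr.eval σ₁ (.sub (.get 13 (.lit 0) (.lit 0)) (.succ (.var 16)))) =
        σ₁.setVar 8 d := by
      simp [WExpr.eval, hE.card, h16, hd]
    refine (Runs.seq (Runs.assign ?_)).le (le_of_eq (Nat.add_comm 7 _))
    rw [hset]
    refine key.mono le_rfl ?_
    rintro σ₂ - h v hv t ht
    have hnum : (σ₁.setVar 8 d).num = σ₁.num := rfl
    rw [hnum] at h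
    refine ⟨fun h1 => ?_, fun h1 => ?_⟩
    · rw [h v hv t ht, if_neg (by omega)]
      exact (hI v hv t ht).1 (by omega)
    -- The summands of the recurrence on the finished levels come from still higher levels, which
    -- this round leaves alone.
    · have hnew : ∀ e ∈ (tsys G st κ s).arcs.filter fun e => (tsys G st κ s).ok (v, t) e,
          (tsys G st κ s).lvl ((tsys G st κ s).tgt e) = (tsys G st κ s).lvl (v, t) + 1 →
          σ₂.num 2 e.dst e.time = σ₁.num 2 e.dst e.time := by
        intro e he hlt
        have htgt : (tsys G st κ s).tgt e = (↑e.dst, e.time) := rfl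
        rw [htgt] at hlt
        rw [h _ e.dst.2 _ (G.time_mem e (Finset.mem_filter.1 he).1).2, if_neg (by omega)]
      have hold : σ₂.num 2 v t =
          ∑ e ∈ (tsys G st κ s).arcs with (tsys G st κ s).ok (v, t) e,
          if (tsys G st κ s).lvl ((tsys G st κ s).tgt e) = (tsys G st κ s).lvl (v, t) + 1 then
            σ₁.num 2 e.dst e.time + τ ((tsys G st κ s).tgt e) else 0 := by
        rw [h v hv t ht]
        split_ifs with h2
        · rw [h2]
        · exact (hI v hv t ht).2 (by omega)
      rw [hold]
      refine Finset.sum_congr rfl fun e he => ?_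
      split_ifs with h2
      · rw [hnew e he h2]
      · rfl
  · have h := sum_work_le (tsys G st κ s) L G.T (25 + 32) 17
    have h2 : n * (G.T + 1) ≤ (n + L.length) * (G.T + 1) := Nat.mul_le_mul_right _ (by omega)
    rw [Finset.sum_range_reflect
      (fun d => (25 + 32) * levelWork (tsys G st κ s) L G.T d + 17 + 7) (n * (G.T + 1))]
    simp only [WExpr.time]
    omega
  · intro σ' _ h x hx
    obtain ⟨h1, h2⟩ := hmem x hx
    exact (h x.1 h1 x.2 h2).2 (by simpa using Nat.pos_of_ne_zero hx)

/-! ### Passive walks -/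

open WExpr in
def passiveProg : Prog :=
  forLoop 10 19 (var 0) (.ite (.eq (var 10) (var 7)) .skip
    (forLoop 11 20 (succ (var 1)) (.storeQ 0 (var 10) (var 11)
      (.add (.get 0 (var 10) (var 11))
        (.mul (.get 1 (var 10) (var 11)) (.get 2 (var 10) (var 11)))))))

theorem Runs.passive {σ : Mem} (hσ : Env G L κ w σ) (hs : s < n) (h7 : σ.var 7 = s)
    (hsrc : SourceRep (tsys G st κ s) G.T σ)
    (hA : (tsys G st κ s).Accumulates (TemporalBetweenness.share G st κ w s)
      fun x => σ.num 2 x.1 x.2) :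
    Runs passiveProg σ (100 * (n * (G.T + 1))) fun σ' => ∀ v < n, ∀ t ≤ G.T,
      σ'.num 0 v t = σ.num 0 v t + contribution G st κ w .passive s v t := by
  have hpos : 1 ≤ n * (G.T + 1) := Nat.mul_pos (by omega) (by omega)
  have hle : n ≤ n * (G.T + 1) := Nat.le_mul_of_pos_right _ (by omega)
  refine (Runs.forUp_const (fun k _ num => ∀ v < n, ∀ t ≤ G.T, num 0 v t = σ.num 0 v t +
      if v < k then contribution G st κ w .passive s v t else 0) ((G.T + 1) * 25 + 20) (N := n)
    (by simp [WExpr.eval, hσ.nodes])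
    rfl rfl rfl le_rfl (by simp) ?_).mono ?_ fun σ' _ h v hv t ht => by simpa [hv] using h v hv t ht
  · intro v hv σ₁ k₁ h10 hI
    have h7' : σ₁.var 7 = s := (k₁.var 7 rfl).trans h7
    refine (Runs.ite (B := (G.T + 1) * 25 + 9) (fun hb => ?_) fun hb => ?_).le
      (by simp [BExpr.time, WExpr.time]; omega)
    · simp only [BExpr.Holds, WExpr.eval, h10, h7'] at hb
      refine (Runs.skip ?_).le (by omega)
      intro v' hv' t ht
      rw [hI v' hv' t ht]
      rcases eq_or_ne v' v with rfl | hne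
      · simp [contribution, hb]
      · congr 1
        exact if_congr (by omega) rfl rfl
    · simp only [BExpr.Holds, WExpr.eval, h10, h7'] at hb
      refine (Runs.forUp_const (fun k _ num => ∀ v' < n, ∀ t ≤ G.T, num 0 v' t = σ.num 0 v' t +
        if v' < v ∨ v' = v ∧ t < k then contribution G st κ w .passive s v' t else 0) 18
        (N := G.T + 1) (by simp [WExpr.eval, k₁.var 1 rfl, hσ.tmax]) rfl rfl rfl
        (by simp only [WExpr.time]; omega) ?_ ?_).mono le_rfl ?_
      · intro v' hv' t ht
        rw [hI v' hv' t ht]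
        simp
      · intro t ht σ₂ k₂ h11 hI₂
        have h10' : σ₂.var 10 = v := (k₂.var 10 rfl).trans h10
        refine (Runs.storeQ ?_).le (by simp [WExpr.time, QExpr.time])
        intro v' hv' t' ht'
        simp only [Mem.setNum, WExpr.eval, QExpr.eval, h10', h11, true_and]
        by_cases hvt : v' = v ∧ t' = t
        · obtain ⟨rfl, rfl⟩ := hvt
          rw [if_pos ⟨rfl, rfl⟩, hI₂ v' hv' t' ht', contribution_passive hs (Ne.symm hb) hA]
          have e1 : σ₂.num 1 v' t' = (tsys G st κ s).sig (v', t') := by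
            rw [k₂.num 1 rfl, k₁.num 1 rfl, hsrc.sig v' hv' t' ht']
          have e2 : σ₂.num 2 v' t' = σ.num 2 v' t' := by rw [k₂.num 2 rfl, k₁.num 2 rfl]
          simp [e1, e2]
        · rw [if_neg hvt, hI₂ v' hv' t' ht']
          congr 1
          exact if_congr (by omega) rfl rfl
      · intro σ₂ _ h v' hv' t ht
        rw [h v' hv' t ht]
        congr 1
        exact if_congr (by omega) rfl rfl
  · simp only [WExpr.time]
    ring_nf at hpos hle ⊢
    omega

end

section

open TS

variable {n : ℕ} {G : TemporalGraph (Fin n)} {st : Strictness} {κ w s : ℕ}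
  {L : List (TArc (Fin n))}

/-! ### Active walks -/

open scoped Classical in
/-- The shares of the walks that leave the node `v` after an arrival at time `t₁`, and not before
the time `t`. -/
noncomputable def laterSum (S : TS (TArc (Fin n)) (ℕ × ℕ)) (A τ : ℕ × ℕ → ℚ) (v t₁ t : ℕ) : ℚ :=
  ∑ e ∈ S.arcs with S.ok (v, t₁) e,
    if S.lvl (e.dst, e.time) = S.lvl (v, t₁) + 1 ∧ t ≤ e.time then
      A (e.dst, e.time) + τ (e.dst, e.time) else 0

open scoped Classical in
/-- The contribution to an active temporal node `(v, t)` of the walks that wait at `v` from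
time `t₁`. -/
noncomputable def activeTerm (G : TemporalGraph (Fin n)) (st : Strictness) (κ s : ℕ)
    (A τ : ℕ × ℕ → ℚ) (v t t₁ : ℕ) : ℚ :=
  (if t₁ ≤ t then (tsys G st κ s).sig (v, t₁) * laterSum (tsys G st κ s) A τ v t₁ t else 0) -
    if t₁ < t ∧ Returns G st κ s v t t₁ then
      A (v, t) * ((tsys G st κ s).sig (v, t₁) * (tsys G st 0 v).sig (v, t)) else 0

theorem contribution_eq_sum_activeTerm (hs : s < n) {v t : ℕ} (hvn : v < n) (ht : t ≤ G.T)
    (hv : s ≠ v) {A : ℕ × ℕ → ℚ} (hA : (tsys G st κ s).Accumulates (share G st κ w s) A) :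
    contribution G st κ w .active s v t =
      ∑ t₁ ∈ Finset.range (G.T + 1), activeTerm G st κ s A (share G st κ w s) v t t₁ := by
  classical
  simp only [contribution_active hs hvn ht hv hA, activeTerm, Finset.sum_sub_distrib]
  congr 1
  · rw [← Finset.sum_subset (Finset.range_subset_range.2 (show t + 1 ≤ G.T + 1 by omega))]
    · refine Finset.sum_congr rfl fun t₁ h => ?_
      rw [Finset.mem_range] at h
      rw [if_pos (by omega), laterSum]
      rfl
    · intro t₁ _ h
      rw [Finset.mem_range] at h
      rw [if_neg (by omega)]
  · rw [Finset.mul_sum, ← Finset.sum_subset (Finset.range_subset_range.2 (show t ≤ G.T + 1 by omega))]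
    · refine Finset.sum_congr rfl fun t₁ h => ?_
      rw [Finset.mem_range] at h
      simp [h]
    · intro t₁ _ h
      rw [Finset.mem_range] at h
      simp [h]

open WExpr in
def laterBody : Prog :=
  .ite (.eq (get 6 (var 13) (var 14)) (succ (get 6 (var 10) (var 11))))
    (.storeQ 6 (var 14) (lit 0) (.add (.get 6 (var 14) (lit 0))
      (.add (.get 2 (var 13) (var 14)) (.get 3 (var 13) (var 14))))) .skip

open WExpr in
-- Bucketing by departure time: entry `t` of the scratch array `6` collects the arcs that leave
-- exactly at `t`. A separate scan for each `t` would cost a factor `T` on the degree.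
def laterProg (st : Strictness) : Prog :=
  .seq (forLoop 9 17 (succ (var 1)) (.storeQ 6 (var 9) (lit 0) (.lit 0)))
    (scanNodeProg st laterBody)

open scoped Classical in
theorem Runs.later {σ : Mem} {v t₁ : ℕ} (hL : Lists L G) (hσ : Env G L κ w σ)
    (hdist : DistRep (tsys G st κ s) G.T σ.arr) (hv : v < n) (ht₁ : t₁ ≤ G.T) (h10 : σ.var 10 = v)
    (h11 : σ.var 11 = t₁) :
    Runs (laterProg st) σ (60 * (G.T + 1) + 60 * (outArcs L v).length) fun σ' =>
      ∀ t ≤ G.T, σ'.num 6 t 0 = ∑ e ∈ (tsys G st κ s).arcs with (tsys G st κ s).ok (v, t₁) e,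
        if (tsys G st κ s).lvl (e.dst, e.time) = (tsys G st κ s).lvl (v, t₁) + 1 ∧ e.time = t then
          σ.num 2 e.dst e.time + σ.num 3 e.dst e.time else 0 := by
  refine (Runs.seq_keeps (Runs.forUp_const (fun k _ num => ∀ t < k, num 6 t 0 = 0) 4 (N := G.T + 1)
    (by simp [WExpr.eval, hσ.tmax]) rfl rfl rfl le_rfl (by simp) ?_) fun σ₁ k₁ h₁ =>
    (Runs.scanNode (G := G) (st := st) (κ := κ) (s := s) (L := L) (x := (v, t₁)) (fun p _ num =>
      ∀ t ≤ G.T, num 6 t 0 = (p.map fun e => if (tsys G st κ s).lvl (e.dst, e.time) =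
        (tsys G st κ s).lvl (v, t₁) + 1 ∧ e.time = t then
          σ.num 2 e.dst e.time + σ.num 3 e.dst e.time else 0).sum) 23
      (fun _ => rfl) rfl rfl rfl ((k₁.var 4 rfl).trans hσ.wait) ((k₁.var 10 rfl).trans h10)
      ((k₁.var 11 rfl).trans h11) hv
      (hσ.graph.congr (k₁.arr 3 rfl) (k₁.arr 4 rfl) (k₁.arr 5 rfl))
      (by simpa [Nat.lt_succ_iff] using h₁) ?_).mono le_rfl fun σ₂ _ h t ht => ?_).le ?_
  · intro j _ σ₁ k₁ h9 hI
    refine (Runs.storeQ ?_).le (by simp [WExpr.time, QExpr.time])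
    intro t ht
    rcases eq_or_ne t j with rfl | hne
    · simp [Mem.setNum, WExpr.eval, QExpr.eval, h9]
    · simpa [Mem.setNum, WExpr.eval, h9, hne] using hI t (by omega)
  · intro p e σ₂ heL hok k₂ h13 h14 hI
    have hT : e.time ≤ G.T := (G.time_mem e ((hL.mem e).1 heL)).2
    have a6 : σ₂.arr 6 = σ.arr 6 := by rw [k₂.arr 6 rfl, k₁.arr 6 rfl]
    have n2 : σ₂.num 2 = σ.num 2 := by rw [k₂.num 2 rfl, k₁.num 2 rfl]
    have n3 : σ₂.num 3 = σ.num 3 := by rw [k₂.num 3 rfl, k₁.num 3 rfl]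
    have v10 : σ₂.var 10 = v := by rw [k₂.var 10 rfl, k₁.var 10 rfl, h10]
    have v11 : σ₂.var 11 = t₁ := by rw [k₂.var 11 rfl, k₁.var 11 rfl, h11]
    refine (Runs.ite (B := 14) (fun hb => ?_) fun hb => ?_).le (by simp [BExpr.time, WExpr.time])
    · simp only [BExpr.Holds, WExpr.eval, h13, h14, v10, v11, a6, hdist _ e.dst.2 _ hT,
        hdist _ hv _ ht₁] at hb
      refine (Runs.storeQ fun t ht => ?_).le (by simp [WExpr.time, QExpr.time])
      simp only [Mem.setNum, WExpr.eval, QExpr.eval, h13, h14, n2, n3, List.map_append,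
        List.sum_append, List.map_cons, List.map_nil, List.sum_cons, List.sum_nil, add_zero, hb]
      rcases eq_or_ne t e.time with rfl | hne
      · simp [hI _ hT]
      · simp [hI t ht, hne, hne.symm]
    · simp only [BExpr.Holds, WExpr.eval, h13, h14, v10, v11, a6, hdist _ e.dst.2 _ hT,
        hdist _ hv _ ht₁] at hb
      refine (Runs.skip fun t ht => ?_).le (by omega)
      simp [hb, hI t ht]
  · rw [h t ht, sum_okArcs hL]
  · simp only [WExpr.time]
    omega

open WExpr in
def spreadProg : Prog :=
  .seq (.storeQ 7 (lit 0) (lit 0) (.lit 0))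
    (forLoop 9 17 (sub (succ (var 1)) (var 11))
      (.seq (.assign 14 (sub (var 1) (var 9)))
        (.seq (.storeQ 7 (lit 0) (lit 0) (.add (.get 7 (lit 0) (lit 0)) (.get 6 (var 14) (lit 0))))
          (.storeQ 0 (var 10) (var 14) (.add (.get 0 (var 10) (var 14))
            (.mul (.get 1 (var 10) (var 11)) (.get 7 (lit 0) (lit 0))))))))

/-- Suffix sums. -/
theorem Runs.spread {σ : Mem} {v t₁ T : ℕ} (hT : σ.var 1 = T) (h10 : σ.var 10 = v)
    (h11 : σ.var 11 = t₁) (ht₁ : t₁ ≤ T) :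
    Runs spreadProg σ (60 * (T + 1)) fun σ' =>
      (∀ t ≤ T, σ'.num 0 v t = σ.num 0 v t +
        if t₁ ≤ t then σ.num 1 v t₁ * ∑ r ∈ Finset.Ico t (T + 1), σ.num 6 r 0 else 0) ∧
      ∀ v' ≠ v, σ'.num 0 v' = σ.num 0 v' := by
  refine (Runs.seq_keeps (Runs.storeQ (Q := fun σ' => σ'.num 7 0 0 = 0)
    (by simp [Mem.setNum, WExpr.eval, QExpr.eval])) fun σ₁ k₁ h₁ =>
    (Runs.forUp_const (fun k _ num => num 7 0 0 = ∑ r ∈ Finset.Ico (T + 1 - k) (T + 1), σ.num 6 r 0 ∧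
      (∀ t ≤ T, num 0 v t = σ.num 0 v t + if T < t + k then
        σ.num 1 v t₁ * ∑ r ∈ Finset.Ico t (T + 1), σ.num 6 r 0 else 0) ∧
      ∀ v' ≠ v, num 0 v' = σ.num 0 v') 28 (N := T + 1 - t₁)
      (by simp [WExpr.eval, k₁.var 1 rfl, k₁.var 11 rfl, h11, hT]) rfl rfl rfl le_rfl
      ⟨by simpa using h₁, fun t ht => ?_, fun v' _ => by rw [k₁.num 0 rfl]⟩ ?_).mono le_rfl
      fun σ₂ _ h => ⟨fun t ht => ?_, h.2.2⟩).le ?_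
  · rw [k₁.num 0 rfl, if_neg (by omega), add_zero]
  · rintro k hk σ₂ k₂ h9 ⟨hI, hI₁, hI₂⟩
    have v1 : σ₂.var 1 = T := by rw [k₂.var 1 rfl, k₁.var 1 rfl, hT]
    have v10 : σ₂.var 10 = v := by rw [k₂.var 10 rfl, k₁.var 10 rfl, h10]
    have v11 : σ₂.var 11 = t₁ := by rw [k₂.var 11 rfl, k₁.var 11 rfl, h11]
    have n6 : σ₂.num 6 = σ.num 6 := by rw [k₂.num 6 rfl, k₁.num 6 rfl]
    have n1 : σ₂.num 1 = σ.num 1 := by rw [k₂.num 1 rfl, k₁.num 1 rfl]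
    have hsum : ∑ r ∈ Finset.Ico (T - k) (T + 1), σ.num 6 r 0 = σ₂.num 7 0 0 + σ.num 6 (T - k) 0 := by
      rw [hI, Finset.sum_eq_sum_Ico_succ_bot (by omega), add_comm,
        show T + 1 - k = T - k + 1 by omega]
    refine (Runs.seq (Runs.assign (Runs.seq (Runs.storeQ (Runs.storeQ ?_))))).le
      (by simp [WExpr.time, QExpr.time])
    simp only [Mem.setNum, Mem.setVar, WExpr.eval, QExpr.eval, v1, h9, v10, v11]
    refine ⟨?_, fun t ht => ?_, fun v' hv' => ?_⟩
    · rw [show T + 1 - (k + 1) = T - k by omega, hsum]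
      simp [n6]
    · by_cases h : t = T - k
      · subst h
        simp [n6, n1, hI₁ (T - k) (by omega), show ¬ T < T - k + k by omega,
          show T < T - k + (k + 1) by omega, hsum]
      · have := hI₁ t ht
        simp only [if_true, h, and_false, if_false, OfNat.zero_ne_ofNat, false_and, this]
        congr 1
        exact if_congr (by omega) rfl rfl
    · funext t
      simp [hv', hI₂ v' hv']
  · simp only [WExpr.time, QExpr.time]
    omega
  · rw [h.2.1 t ht]
    congr 1
    exact if_congr (by omega) rfl rfl

open WExpr in
-- The strict growth of the level also rejects the case without a closed walk, in which the level
-- `0` of the return minus one truncates to `0`.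
def returnTest : BExpr :=
  .and (.lt (var 11) (var 9)) (.and (.not (.lt (var 4) (sub (var 9) (var 11))))
    (.and (.not (.eq (get 6 (var 10) (var 11)) (lit 0)))
      (.and (.lt (get 6 (var 10) (var 11)) (get 6 (var 10) (var 9)))
        (.eq (sub (get 6 (var 10) (var 9)) (get 6 (var 10) (var 11)))
          (sub (get 12 (var 10) (var 9)) (lit 1))))))

open WExpr in
def returnProg : Prog :=
  forLoop 9 17 (succ (var 1)) (.ite returnTest
    (.storeQ 0 (var 10) (var 9) (.sub (.get 0 (var 10) (var 9)) (.mul (.get 2 (var 10) (var 9))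
      (.mul (.get 1 (var 10) (var 11)) (.get 5 (var 10) (var 9)))))) .skip)

/-- The memory holds the levels and numbers of the instantaneous returns to the nodes. -/
structure ReturnRep (G : TemporalGraph (Fin n)) (st : Strictness) (σ : Mem) : Prop where
  lvl : ∀ v < n, ∀ t ≤ G.T, σ.arr 12 v t = (tsys G st 0 v).lvl (v, t)
  sig : ∀ v < n, ∀ t ≤ G.T, σ.num 5 v t = (tsys G st 0 v).sig (v, t)

theorem ReturnRep.keeps {σ σ' : Mem} {p : Prog} (h : ReturnRep G st σ) (hk : p.Keeps σ σ')
    (h12 : p.wA 12 = false) (h5 : p.wN 5 = false) : ReturnRep G st σ' :=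
  ⟨by rw [hk.arr 12 h12]; exact h.lvl, by rw [hk.num 5 h5]; exact h.sig⟩

open scoped Classical in
theorem Runs.return {σ : Mem} {v t₁ : ℕ} (hσ : Env G L κ w σ)
    (hsrc : SourceRep (tsys G st κ s) G.T σ) (hret : ReturnRep G st σ) (hv : v < n) (ht₁ : t₁ ≤ G.T)
    (h10 : σ.var 10 = v) (h11 : σ.var 11 = t₁) :
    Runs returnProg σ (80 * (G.T + 1)) fun σ' =>
      (∀ t ≤ G.T, σ'.num 0 v t = σ.num 0 v t - if t₁ < t ∧ Returns G st κ s v t t₁ then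
        σ.num 2 v t * ((tsys G st κ s).sig (v, t₁) * (tsys G st 0 v).sig (v, t)) else 0) ∧
      ∀ v' ≠ v, σ'.num 0 v' = σ.num 0 v' := by
  refine (Runs.forUp_const (fun k _ num => (∀ t ≤ G.T, num 0 v t = σ.num 0 v t -
      if t < k ∧ t₁ < t ∧ Returns G st κ s v t t₁ then
        σ.num 2 v t * ((tsys G st κ s).sig (v, t₁) * (tsys G st 0 v).sig (v, t)) else 0) ∧
      ∀ v' ≠ v, num 0 v' = σ.num 0 v') 60 (N := G.T + 1) (by simp [WExpr.eval, hσ.tmax]) rfl rfl rfl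
      le_rfl (by simp) ?_).mono (by simp only [WExpr.time]; omega)
      fun σ' _ h => ⟨fun t ht => ?_, h.2⟩
  · rintro t ht σ₁ k₁ h9 ⟨hI₁, hI₂⟩
    have v10 : σ₁.var 10 = v := by rw [k₁.var 10 rfl, h10]
    have v11 : σ₁.var 11 = t₁ := by rw [k₁.var 11 rfl, h11]
    have v4 : σ₁.var 4 = κ := by rw [k₁.var 4 rfl, hσ.wait]
    have ht' : t ≤ G.T := by omega
    have htest : returnTest.Holds σ₁ ↔ t₁ < t ∧ Returns G st κ s v t t₁ := by
      simp only [returnTest, BExpr.Holds, WExpr.eval, v10, v11, v4, h9, k₁.arr 6 rfl, k₁.arr 12 rfl,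
        hsrc.dist v hv t ht', hsrc.dist v hv t₁ ht₁, hret.lvl v hv t ht', Returns, not_lt, ne_eq]
    refine (Runs.ite (B := 18) (fun hb => ?_) fun hb => ?_).le
      (by simp [returnTest, BExpr.time, WExpr.time])
    · rw [htest] at hb
      refine (Runs.storeQ ⟨fun t' ht' => ?_, fun v' hv' => ?_⟩).le (by simp [WExpr.time, QExpr.time])
      · simp only [Mem.setNum, WExpr.eval, QExpr.eval, v10, v11, h9, true_and]
        by_cases htt : t' = t
        · subst htt
          rw [if_pos rfl, if_pos ⟨by omega, hb⟩, hI₁ t' ht', if_neg (by omega), k₁.num 2 rfl,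
            k₁.num 1 rfl, k₁.num 5 rfl, hsrc.sig v hv t₁ ht₁, hret.sig v hv t' ht', sub_zero]
        · rw [if_neg htt, hI₁ t' ht']
          congr 1
          exact if_congr (and_congr_left' (by omega)) rfl rfl
      · funext t'
        simp [Mem.setNum, WExpr.eval, v10, hv', hI₂ v' hv']
    · rw [htest] at hb
      refine (Runs.skip ⟨fun t' ht' => ?_, hI₂⟩).le (by omega)
      rw [hI₁ t' ht']
      congr 1
      refine if_congr ⟨fun h => ⟨by omega, h.2⟩, fun h => ⟨?_, h.2⟩⟩ rfl rfl
      rcases Nat.lt_or_ge t' t with h' | h'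
      · exact h'
      · have : t' = t := by omega
        exact absurd (this ▸ h.2) hb
  · rw [h.1 t ht]
    congr 1
    exact if_congr (and_iff_right (by omega)) rfl rfl

open WExpr in
def activeProg (st : Strictness) : Prog :=
  forLoop 10 19 (var 0) (.ite (.eq (var 10) (var 7)) .skip
    (forLoop 11 20 (succ (var 1)) (.seq (laterProg st) (.seq spreadProg returnProg))))

theorem laterSum_eq_sum (S : TS (TArc (Fin n)) (ℕ × ℕ)) (A τ : ℕ × ℕ → ℚ) (v t₁ t T : ℕ)
    (hT : ∀ e ∈ S.arcs, e.time ≤ T) :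
    open scoped Classical in
    laterSum S A τ v t₁ t = ∑ r ∈ Finset.Ico t (T + 1), ∑ e ∈ S.arcs with S.ok (v, t₁) e,
      if S.lvl (e.dst, e.time) = S.lvl (v, t₁) + 1 ∧ e.time = r then
        A (e.dst, e.time) + τ (e.dst, e.time) else 0 := by
  classical
  rw [Finset.sum_comm, laterSum]
  refine Finset.sum_congr rfl fun e he => ?_
  have := hT e (Finset.mem_filter.1 he).1
  simp only [ite_and, Finset.sum_ite_irrel, Finset.sum_const_zero, Finset.sum_ite_eq, Finset.mem_Ico]
  refine if_congr Iff.rfl ?_ rfl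
  simp [show e.time < T + 1 by omega]

/-- The walks that wait at `v` from time `t₁`. -/
theorem Runs.activeTerm {σ : Mem} {v t₁ : ℕ} {A τ : ℕ × ℕ → ℚ} (hL : Lists L G)
    (hσ : Env G L κ w σ)
    (hsrc : SourceRep (tsys G st κ s) G.T σ) (hret : ReturnRep G st σ)
    (hτ : ∀ v < n, ∀ t ≤ G.T, σ.num 3 v t = τ (v, t))
    (hA : ∀ v < n, ∀ t ≤ G.T, σ.num 2 v t = A (v, t)) (hv : v < n) (ht₁ : t₁ ≤ G.T)
    (h10 : σ.var 10 = v) (h11 : σ.var 11 = t₁) :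
    Runs (.seq (laterProg st) (.seq spreadProg returnProg)) σ
      (200 * (G.T + 1) + 60 * (outArcs L v).length) fun σ' =>
      (∀ t ≤ G.T, σ'.num 0 v t = σ.num 0 v t + TemporalBetweenness.activeTerm G st κ s A τ v t t₁) ∧
      ∀ v' ≠ v, σ'.num 0 v' = σ.num 0 v' := by
  classical
  refine (Runs.seq_keeps (Runs.later hL hσ hsrc.dist hv ht₁ h10 h11) fun σ₁ k₁ h₁ =>
    Runs.seq_keeps (Runs.spread ((k₁.var 1 rfl).trans hσ.tmax) ((k₁.var 10 rfl).trans h10)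
      ((k₁.var 11 rfl).trans h11) ht₁) fun σ₂ k₂ h₂ =>
    (Runs.return ((hσ.keeps k₁ ⟨rfl, rfl, rfl, rfl, rfl, rfl, rfl, rfl⟩).keeps k₂
      ⟨rfl, rfl, rfl, rfl, rfl, rfl, rfl, rfl⟩) ((hsrc.keeps k₁ rfl rfl rfl rfl rfl).keeps k₂
      rfl rfl rfl rfl rfl) ((hret.keeps k₁ rfl rfl).keeps k₂ rfl rfl) hv ht₁
      (by rw [k₂.var 10 rfl, k₁.var 10 rfl, h10]) (by rw [k₂.var 11 rfl, k₁.var 11 rfl, h11])).mono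
      le_rfl fun σ₃ k₃ h₃ => ⟨fun t ht => ?_, fun v' hv' => ?_⟩).le (by omega)
  · rw [h₃.1 t ht, h₂.1 t ht, k₁.num 0 rfl, k₂.num 2 rfl, k₁.num 2 rfl, k₁.num 1 rfl,
      hsrc.sig v hv t₁ ht₁, hA v hv t ht, TemporalBetweenness.activeTerm, add_sub_assoc,
      laterSum_eq_sum _ _ _ _ _ _ G.T fun e he => (G.time_mem e he).2]
    congr 3
    congr 1
    refine Finset.sum_congr rfl fun r hr => ?_
    rw [Finset.mem_Ico] at hr
    rw [h₁ r (by omega)]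
    refine Finset.sum_congr rfl fun e he => ?_
    have hT := (G.time_mem e (Finset.mem_filter.1 he).1).2
    rw [hA _ e.dst.2 _ hT, hτ _ e.dst.2 _ hT]
  · rw [h₃.2 v' hv', h₂.2 v' hv', k₁.num 0 rfl]

/-- Each of the `T + 1` arrival times at `v` costs `O(T + deg v)`; since the degrees sum to `m`, all
nodes together cost `O(n T² + m T)`. -/
theorem Runs.active {σ : Mem} (hL : Lists L G) (hσ : Env G L κ w σ) (hs : s < n) (h7 : σ.var 7 = s)
    (hsrc : SourceRep (tsys G st κ s) G.T σ) (hret : ReturnRep G st σ)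
    (hτ : ∀ v < n, ∀ t ≤ G.T, σ.num 3 v t = TemporalBetweenness.share G st κ w s (v, t))
    (hA : (tsys G st κ s).Accumulates (TemporalBetweenness.share G st κ w s)
      fun x => σ.num 2 x.1 x.2) :
    Runs (activeProg st) σ (300 * (n * (G.T + 1) ^ 2 + L.length * (G.T + 1))) fun σ' =>
      ∀ v < n, ∀ t ≤ G.T,
        σ'.num 0 v t = σ.num 0 v t + contribution G st κ w .active s v t := by
  refine (Runs.forUp (fun k _ num => ∀ v < n, ∀ t ≤ G.T, num 0 v t = σ.num 0 v t +
      if v < k then contribution G st κ w .active s v t else 0)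
    (fun v => (G.T + 1) * (207 * (G.T + 1) + 60 * (outArcs L v).length) + 20) (N := n)
    (by simp [WExpr.eval, hσ.nodes]) rfl rfl rfl (by simp) ?_).mono ?_
    fun σ' _ h v hv t ht => by simpa [hv] using h v hv t ht
  · intro v hv σ₁ k₁ h10 hI
    have h7' : σ₁.var 7 = s := (k₁.var 7 rfl).trans h7
    refine (Runs.ite (B := (G.T + 1) * (207 * (G.T + 1) + 60 * (outArcs L v).length) + 9)
      (fun hb => ?_) fun hb => ?_).le (by simp only [BExpr.time, WExpr.time]; omega)
    · simp only [BExpr.Holds, WExpr.eval, h10, h7'] at hb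
      refine (Runs.skip ?_).le (by omega)
      intro v' hv' t ht
      rw [hI v' hv' t ht]
      rcases eq_or_ne v' v with rfl | hne
      · simp [contribution, hb]
      · congr 1
        exact if_congr (by omega) rfl rfl
    · simp only [BExpr.Holds, WExpr.eval, h10, h7'] at hb
      refine (Runs.forUp_const (fun k _ num => (∀ t ≤ G.T, num 0 v t = σ.num 0 v t +
          ∑ t₁ ∈ Finset.range k, TemporalBetweenness.activeTerm G st κ s
            (fun x => σ.num 2 x.1 x.2) (TemporalBetweenness.share G st κ w s) v t t₁) ∧
          ∀ v' ≠ v, num 0 v' = σ₁.num 0 v') (200 * (G.T + 1) + 60 * (outArcs L v).length)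
        (N := G.T + 1) (by simp [WExpr.eval, k₁.var 1 rfl, hσ.tmax]) rfl rfl rfl
        ?_ ⟨fun t ht => ?_, fun _ _ => rfl⟩ ?_).mono le_rfl ?_
      · simp only [WExpr.time]
        ring_nf
        omega
      · rw [hI v hv t ht]
        simp
      · rintro t₁ ht₁ σ₂ k₂ h11 ⟨hI₁, hI₂⟩
        refine (Runs.activeTerm hL ((hσ.keeps k₁ ⟨rfl, rfl, rfl, rfl, rfl, rfl, rfl, rfl⟩).keeps k₂
          ⟨rfl, rfl, rfl, rfl, rfl, rfl, rfl, rfl⟩) ((hsrc.keeps k₁ rfl rfl rfl rfl rfl).keeps k₂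
          rfl rfl rfl rfl rfl) ((hret.keeps k₁ rfl rfl).keeps k₂ rfl rfl)
          (A := fun x => σ.num 2 x.1 x.2) (τ := TemporalBetweenness.share G st κ w s)
          (by rw [k₂.num 3 rfl, k₁.num 3 rfl]; exact hτ)
          (by rw [k₂.num 2 rfl, k₁.num 2 rfl]; exact fun _ _ _ _ => rfl) hv (by omega)
          ((k₂.var 10 rfl).trans h10) h11).mono le_rfl fun σ₃ _ h =>
            ⟨fun t ht => ?_, fun v' hv' => (h.2 v' hv').trans (hI₂ v' hv')⟩
        rw [h.1 t ht, hI₁ t ht, Finset.sum_range_succ, add_assoc]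
      · rintro σ₂ - ⟨h, h'⟩ v' hv' t ht
        rcases eq_or_ne v' v with rfl | hne
        · rw [h t ht, if_pos (by omega), contribution_eq_sum_activeTerm hs hv ht (Ne.symm hb) hA]
        · rw [h' v' hne, hI v' hv' t ht]
          congr 1
          exact if_congr (by omega) rfl rfl
  · have h1 : ∑ v ∈ Finset.range n,
        ((G.T + 1) * (207 * (G.T + 1) + 60 * (outArcs L v).length) + 20 + 7) =
        n * (207 * (G.T + 1) ^ 2) + 60 * (L.length * (G.T + 1)) + 27 * n := by
      rw [← sum_outArcs L]
      simp only [Finset.sum_add_distrib, mul_add, Finset.sum_const, Finset.card_range, smul_eq_mul,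
        ← Finset.mul_sum]
      ring
    have hpos : 1 ≤ n * (G.T + 1) ^ 2 := Nat.mul_pos (by omega) (by positivity)
    have hle : n ≤ n * (G.T + 1) ^ 2 := Nat.le_mul_of_pos_right _ (by positivity)
    rw [h1]
    simp only [WExpr.time]
    have h3 : n * (207 * (G.T + 1) ^ 2) = 207 * (n * (G.T + 1) ^ 2) := by ring
    rw [h3]
    omega

end

section

open TS

variable {n : ℕ} {G : TemporalGraph (Fin n)} {st : Strictness} {κ w s : ℕ}
  {L : List (TArc (Fin n))}

/-! ### Preparations -/

/-- The memory holds the list of the arcs, as in the input. -/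
def ArcsRep (L : List (TArc (Fin n))) (arr : ℕ → ℕ → ℕ → ℕ) : Prop :=
  ∀ i (h : i < L.length), arr 0 i 0 = L[i].src ∧ arr 1 i 0 = L[i].dst ∧ arr 2 i 0 = L[i].time

open WExpr in
def graphProg : Prog :=
  forLoop 12 18 (var 2)
    (.seq (.assign 10 (get 0 (var 12) (lit 0)))
      (.seq (.assign 15 (get 3 (var 10) (lit 0)))
        (.seq (.store 4 (var 10) (var 15) (get 1 (var 12) (lit 0)))
          (.seq (.store 5 (var 10) (var 15) (get 2 (var 12) (lit 0)))
            (.store 3 (var 10) (lit 0) (succ (var 15)))))))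

theorem outArcs_append_singleton (L : List (TArc (Fin n))) (e : TArc (Fin n)) (u : ℕ) :
    outArcs (L ++ [e]) u = outArcs L u ++ if (e.src : ℕ) = u then [e] else [] := by
  rw [outArcs, List.filter_append]
  by_cases h : (e.src : ℕ) = u <;> simp [outArcs, h]

theorem Runs.graph {σ : Mem} (h2 : σ.var 2 = L.length) (hL : ArcsRep L σ.arr)
    (h3 : ∀ u, σ.arr 3 u 0 = 0) :
    Runs graphProg σ (40 * L.length + 8) fun σ' => GraphRep L σ'.arr := by
  refine (Runs.forUp_const (fun i arr _ => GraphRep (L.take i) arr) 25 (N := L.length)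
    (by simp [WExpr.eval, h2]) rfl rfl rfl (by simp only [WExpr.time]; omega)
    ⟨by simp [outArcs, h3], by simp [outArcs], by simp [outArcs]⟩ ?_).mono le_rfl
    fun σ' _ h => by simpa using h
  intro i hi σ₁ k₁ h12 hI
  obtain ⟨e0, e1, e2⟩ := hL i hi
  rw [List.take_succ_eq_append_getElem hi]
  generalize L[i] = e at e0 e1 e2
  have hdeg := hI.deg e.src e.src.2
  refine (Runs.seq (Runs.assign (Runs.seq (Runs.assign (Runs.seq (Runs.store (Runs.seq (Runs.store
    (Runs.store ?_))))))))).le (by simp [WExpr.time])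
  have a0 : σ₁.arr 0 i 0 = e.src := by rw [k₁.arr 0 rfl, e0]
  have a1 : σ₁.arr 1 i 0 = e.dst := by rw [k₁.arr 1 rfl, e1]
  have a2 : σ₁.arr 2 i 0 = e.time := by rw [k₁.arr 2 rfl, e2]
  refine ⟨fun u hu => ?_, fun u hu j hj => ?_, fun u hu j hj => ?_⟩
  · by_cases h : (e.src : ℕ) = u
    · subst h
      simp [Mem.setArr, Mem.setVar, WExpr.eval, h12, a0, outArcs_append_singleton, hdeg]
    · simp [Mem.setArr, Mem.setVar, WExpr.eval, h12, a0, outArcs_append_singleton, h, Ne.symm h,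
        hI.deg u hu]
  · by_cases h : (e.src : ℕ) = u
    · subst h
      simp only [outArcs_append_singleton, if_true] at hj ⊢
      rcases Nat.lt_or_ge j (outArcs (L.take i) e.src).length with h' | h'
      · have : j ≠ (outArcs (L.take i) e.src).length := by omega
        simpa [Mem.setArr, Mem.setVar, WExpr.eval, h12, a0, a1, hdeg, this,
          List.getElem_append_left h'] using hI.dst _ e.src.2 j h'
      · have : j = (outArcs (L.take i) e.src).length := by simp at hj; omega
        subst this
        simp [Mem.setArr, Mem.setVar, WExpr.eval, h12, a0, a1, hdeg]
    · simp only [outArcs_append_singleton, h, if_false, List.append_nil] at hj ⊢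
      simpa [Mem.setArr, Mem.setVar, WExpr.eval, h12, a0, Ne.symm h] using hI.dst u hu j hj
  · by_cases h : (e.src : ℕ) = u
    · subst h
      simp only [outArcs_append_singleton, if_true] at hj ⊢
      rcases Nat.lt_or_ge j (outArcs (L.take i) e.src).length with h' | h'
      · have : j ≠ (outArcs (L.take i) e.src).length := by omega
        simpa [Mem.setArr, Mem.setVar, WExpr.eval, h12, a0, a2, hdeg, this,
          List.getElem_append_left h'] using hI.time _ e.src.2 j h'
      · have : j = (outArcs (L.take i) e.src).length := by simp at hj; omega
        subst this
        simp [Mem.setArr, Mem.setVar, WExpr.eval, h12, a0, a2, hdeg]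
    · simp only [outArcs_append_singleton, h, if_false, List.append_nil] at hj ⊢
      simpa [Mem.setArr, Mem.setVar, WExpr.eval, h12, a0, Ne.symm h] using hI.time u hu j hj

open WExpr in
/-- Increase the entry of the word array `a` by one. -/
def incProg (a : ℕ) : Prog := .store a (lit 0) (lit 0) (succ (get a (lit 0) (lit 0)))

theorem Runs.inc {σ : Mem} {a i b : ℕ} {hi : WExpr} {N : ℕ} (hN : hi.eval σ = N)
    (hib : (b == i) = false) :
    Runs (forLoop i b hi (incProg a)) σ (N * 14 + hi.time + 7) fun σ' =>
      σ'.arr a 0 0 = σ.arr a 0 0 + N :=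
  Runs.forUp_const (fun k arr _ => arr a 0 0 = σ.arr a 0 0 + k) 7 hN hib rfl rfl le_rfl rfl
    fun j _ σ₁ _ _ hI => (Runs.store (by simp [Mem.setArr, WExpr.eval, hI, Nat.add_assoc])).le le_rfl

open WExpr in
-- Words have neither addition nor multiplication, so the product is counted out.
def cardProg : Prog := forLoop 10 19 (var 0) (forLoop 11 20 (succ (var 1)) (incProg 13))

theorem Runs.card {σ : Mem} {T : ℕ} (h0 : σ.var 0 = n) (h1 : σ.var 1 = T)
    (h13 : σ.arr 13 0 0 = 0) :
    Runs cardProg σ (30 * (n * (T + 1)) + 8) fun σ' => σ'.arr 13 0 0 = n * (T + 1) := by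
  have hle : n ≤ n * (T + 1) := Nat.le_mul_of_pos_right _ (by omega)
  refine Runs.forUp_const (fun k arr _ => arr 13 0 0 = k * (T + 1)) ((T + 1) * 14 + 9) (N := n)
    (by simp [WExpr.eval, h0]) rfl rfl rfl ?_ (by simpa using h13) fun v _ σ₁ k₁ _ hI =>
    (Runs.inc (N := T + 1) (by simp [WExpr.eval, k₁.var 1 rfl, h1]) rfl).mono le_rfl
    fun σ₂ _ h => by rw [h, hI, Nat.succ_mul]
  simp only [WExpr.time]
  ring_nf at hle ⊢
  omega

open WExpr in
-- From time `T` downwards the value grows by `w` at each step, by single increments. This is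
-- affordable because `w ≤ n`.
def baseProg : Prog :=
  .seq (.store 14 (lit 0) (lit 0) (succ (get 13 (lit 0) (lit 0))))
    (forLoop 10 19 (succ (var 1))
      (.seq (.store 10 (sub (var 1) (var 10)) (lit 0) (get 14 (lit 0) (lit 0)))
        (forLoop 11 20 (var 5) (incProg 14))))

theorem Runs.base {σ : Mem} {T D : ℕ} (h1 : σ.var 1 = T) (h5 : σ.var 5 = w)
    (h13 : σ.arr 13 0 0 = D) :
    Runs baseProg σ (14 * (w * (T + 1)) + 30 * (T + 1) + 20) fun σ' =>
      ∀ t ≤ T, σ'.arr 10 t 0 = D + 1 + (T - t) * w := by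
  refine (Runs.seq_keeps (Runs.store (Q := fun σ' => σ'.arr 14 0 0 = D + 1)
    (by simp [Mem.setArr, WExpr.eval, h13])) fun σ₁ k₁ h₁ =>
    (Runs.forUp_const (fun k arr _ => arr 14 0 0 = D + 1 + k * w ∧
      ∀ t ≤ T, T < t + k → arr 10 t 0 = D + 1 + (T - t) * w) (w * 14 + 18) (N := T + 1)
      (by simp [WExpr.eval, k₁.var 1 rfl, h1]) rfl rfl rfl le_rfl
      ⟨by simpa using h₁, fun t ht h => by omega⟩ ?_).mono le_rfl
      fun σ₂ _ h t ht => h.2 t ht (by omega)).le ?_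
  · rintro k hk σ₂ k₂ h10 ⟨hI, hI'⟩
    have v1 : σ₂.var 1 = T := by rw [k₂.var 1 rfl, k₁.var 1 rfl, h1]
    have v5 : σ₂.var 5 = w := by rw [k₂.var 5 rfl, k₁.var 5 rfl, h5]
    refine (Runs.seq_keeps (Runs.store (Q := fun σ' => ∀ t ≤ T, T < t + (k + 1) →
      σ'.arr 10 t 0 = D + 1 + (T - t) * w) ?_) fun σ₃ k₃ h₃ => (Runs.inc (N := w)
      (by simp [WExpr.eval, k₃.var 5 rfl, v5]) rfl).mono le_rfl fun σ₄ k₄ h₄ => ?_).le ?_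
    · intro t ht htk
      by_cases h : t = T - k
      · subst h
        simp [Mem.setArr, WExpr.eval, h10, v1, hI, show T - (T - k) = k by omega]
      · simpa [Mem.setArr, WExpr.eval, h10, v1, h] using hI' t ht (by omega)
    · refine ⟨?_, by rw [k₄.arr 10 rfl]; exact h₃⟩
      rw [h₄, k₃.arr 14 rfl, hI, Nat.succ_mul]
      omega
    · simp only [WExpr.time]
      omega
  · simp only [WExpr.time]
    ring_nf
    omega

def setupProg : Prog := .seq graphProg (.seq cardProg baseProg)

theorem Runs.setup {σ : Mem} (h0 : σ.var 0 = n) (h1 : σ.var 1 = G.T) (h2 : σ.var 2 = L.length)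
    (h4 : σ.var 4 = κ) (h5 : σ.var 5 = w) (hL : ArcsRep L σ.arr) (h3 : ∀ u, σ.arr 3 u 0 = 0)
    (h13 : σ.arr 13 0 0 = 0) (hn : 0 < n) (hw : w ≤ n) :
    Runs setupProg σ (120 * ((n + L.length) * (G.T + 1))) (Env G L κ w) := by
  refine (Runs.seq_keeps (Runs.graph h2 hL h3) fun σ₁ k₁ h₁ => Runs.seq_keeps
    (Runs.card ((k₁.var 0 rfl).trans h0) ((k₁.var 1 rfl).trans h1) (by rw [k₁.arr 13 rfl, h13]))
    fun σ₂ k₂ h₂ => (Runs.base (by rw [k₂.var 1 rfl, k₁.var 1 rfl, h1])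
      (by rw [k₂.var 5 rfl, k₁.var 5 rfl, h5]) h₂).mono le_rfl fun σ₃ k₃ h₃ =>
      ⟨?_, ?_, ?_, ?_, ?_, h₃⟩).le ?_
  · have e1 : L.length ≤ L.length * (G.T + 1) := Nat.le_mul_of_pos_right _ (by omega)
    have e2 : w * (G.T + 1) ≤ n * (G.T + 1) := Nat.mul_le_mul_right _ hw
    have e3 : 1 * (G.T + 1) ≤ n * (G.T + 1) := Nat.mul_le_mul_right _ hn
    rw [Nat.add_mul]
    omega
  · rw [k₃.var 0 rfl, k₂.var 0 rfl, k₁.var 0 rfl, h0]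
  · rw [k₃.var 1 rfl, k₂.var 1 rfl, k₁.var 1 rfl, h1]
  · rw [k₃.var 4 rfl, k₂.var 4 rfl, k₁.var 4 rfl, h4]
  · exact (h₁.congr (k₂.arr 3 rfl) (k₂.arr 4 rfl) (k₂.arr 5 rfl)).congr (k₃.arr 3 rfl)
      (k₃.arr 4 rfl) (k₃.arr 5 rfl)
  · rw [k₃.arr 13 rfl, h₂]

open WExpr in
-- To be run with `κ = 0`: then level and count of `(v, t)` for the source `v` are those of the
-- shortest closed walks at `v` within the time step `t ≥ 1`.
def returnsProg (st : Strictness) : Prog :=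
  forLoop 7 22 (var 0) (.seq (sourceProg st) (forLoop 11 20 (succ (var 1))
    (.seq (.store 12 (var 7) (var 11) (get 6 (var 7) (var 11)))
      (.storeQ 5 (var 7) (var 11) (.get 1 (var 7) (var 11))))))

theorem Runs.returns {σ : Mem} (hL : Lists L G) (hσ : Env G L 0 w σ) (hn : 0 < n) :
    Runs (returnsProg st) σ (400 * (n * ((n + L.length) * (G.T + 1)))) (ReturnRep G st) := by
  refine (Runs.forUp_const (fun k arr num => ∀ v < k, ∀ t ≤ G.T,
      arr 12 v t = (tsys G st 0 v).lvl (v, t) ∧ num 5 v t = (tsys G st 0 v).sig (v, t))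
    (300 * ((n + L.length) * (G.T + 1)) + (30 * (G.T + 1))) (N := n) (by simp [WExpr.eval, hσ.nodes])
    rfl rfl rfl ?_ (by simp) ?_).mono le_rfl fun σ' _ h =>
      ⟨fun v hv t ht => (h v hv t ht).1, fun v hv t ht => (h v hv t ht).2⟩
  · have e : 1 * (G.T + 1) ≤ (n + L.length) * (G.T + 1) := Nat.mul_le_mul_right _ (by omega)
    generalize (n + L.length) * (G.T + 1) = X at e ⊢
    have : n * (300 * X + 30 * (G.T + 1) + 7) ≤ n * (340 * X) := Nat.mul_le_mul_left _ (by omega)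
    have e2 : 1 * X ≤ n * X := Nat.mul_le_mul_right _ hn
    rw [Nat.mul_left_comm] at this
    simp only [WExpr.time]
    omega
  · intro v hv σ₁ k₁ h7 hI
    refine Runs.seq_keeps (Runs.source (st := st) hL
      (hσ.keeps k₁ ⟨rfl, rfl, rfl, rfl, rfl, rfl, rfl, rfl⟩) hv h7) fun σ₂ k₂ ⟨h₂, _⟩ =>
      (Runs.forUp_const (fun k arr num => ∀ v' t, t ≤ G.T → (v' < v ∨ v' = v ∧ t < k) →
        arr 12 v' t = (tsys G st 0 v').lvl (v', t) ∧ num 5 v' t = (tsys G st 0 v').sig (v', t)) 12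
        (N := G.T + 1) (by simp [WExpr.eval, k₂.var 1 rfl, k₁.var 1 rfl, hσ.tmax]) rfl rfl rfl
        (by simp only [WExpr.time]; omega) ?_ ?_).mono le_rfl
        fun σ₃ _ h v' hv' t ht => h v' t ht (by omega)
    · intro v' t ht h
      rw [k₂.arr 12 rfl, k₂.num 5 rfl]
      exact hI v' (by omega) t ht
    · intro t ht σ₃ k₃ h11 hI₃
      have v7 : σ₃.var 7 = v := by rw [k₃.var 7 rfl, k₂.var 7 rfl, h7]
      refine (Runs.seq (Runs.store (Runs.storeQ ?_))).le (by simp [WExpr.time, QExpr.time])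
      intro v' t' ht' h
      by_cases hvt : v' = v ∧ t' = t
      · obtain ⟨rfl, rfl⟩ := hvt
        simp [Mem.setArr, Mem.setNum, WExpr.eval, QExpr.eval, v7, h11, k₃.arr 6 rfl, k₃.num 1 rfl,
          h₂.dist v' hv t' ht', h₂.sig v' hv t' ht']
      · simpa [Mem.setArr, Mem.setNum, WExpr.eval, v7, h11, hvt] using hI₃ v' t' ht' (by omega)

/-! ### The algorithm -/

def finishProg (st : Strictness) : WalkType → Prog
  | .passive => passiveProg
  | .active => activeProg st

/-- The time for one source, up to a constant. -/
def work (n m T : ℕ) : WalkType → ℕ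
  | .passive => (n + m) * (T + 1)
  | .active => n * (T + 1) ^ 2 + m * (T + 1)

theorem le_work (n m T : ℕ) (ty : WalkType) : (n + m) * (T + 1) ≤ work n m T ty := by
  cases ty
  · exact le_rfl
  · rw [Nat.add_mul]
    exact Nat.add_le_add_right (Nat.mul_le_mul_left _ (Nat.le_self_pow two_ne_zero _)) _

theorem Runs.finish {ty : WalkType} {σ : Mem} (hL : Lists L G) (hσ : Env G L κ w σ) (hs : s < n)
    (h7 : σ.var 7 = s) (hsrc : SourceRep (tsys G st κ s) G.T σ)
    (hret : ty = .active → ReturnRep G st σ)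
    (hτ : ∀ v < n, ∀ t ≤ G.T, σ.num 3 v t = TemporalBetweenness.share G st κ w s (v, t))
    (hA : (tsys G st κ s).Accumulates (TemporalBetweenness.share G st κ w s)
      fun x => σ.num 2 x.1 x.2) :
    Runs (finishProg st ty) σ (300 * work n L.length G.T ty) fun σ' => ∀ v < n, ∀ t ≤ G.T,
      σ'.num 0 v t = σ.num 0 v t + contribution G st κ w ty s v t := by
  cases ty
  · refine (Runs.passive hσ hs h7 hsrc hA).le ?_
    have : n * (G.T + 1) ≤ (n + L.length) * (G.T + 1) := Nat.mul_le_mul_right _ (by omega)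
    simp only [work]
    omega
  · exact Runs.active hL hσ hs h7 hsrc (hret rfl) hτ hA

def sourcesProg (st : Strictness) (ty : WalkType) : Prog :=
  forLoop 7 22 (.var 0)
    (.seq (sourceProg st) (.seq shareProg (.seq (collectProg st) (finishProg st ty))))

theorem Runs.sources {ty : WalkType} {σ : Mem} (hL : Lists L G) (hσ : Env G L κ w σ) (hn : 0 < n)
    (hret : ty = .active → ReturnRep G st σ) (h0 : ∀ v t, σ.num 0 v t = 0) :
    Runs (sourcesProg st ty) σ (1000 * (n * work n L.length G.T ty)) fun σ' =>
      ∀ v < n, ∀ t ≤ G.T,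
        σ'.num 0 v t = ∑ s ∈ Finset.range n, contribution G st κ w ty s v t := by
  have hsafe : (sourcesProg st ty).Safe := by cases ty <;> exact ⟨rfl, rfl, rfl, rfl, rfl, rfl, rfl, rfl⟩
  have e1 := le_work n L.length G.T ty
  have e2 : n * (G.T + 1) ≤ (n + L.length) * (G.T + 1) := Nat.mul_le_mul_right _ (by omega)
  have e3 : 1 * (G.T + 1) ≤ n * (G.T + 1) := Nat.mul_le_mul_right _ hn
  refine Runs.forUp_const (fun k _ num => ∀ v < n, ∀ t ≤ G.T, num 0 v t =
      ∑ s ∈ Finset.range k, contribution G st κ w ty s v t) (900 * work n L.length G.T ty) (N := n)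
    (by simp [WExpr.eval, hσ.nodes]) rfl (by cases ty <;> rfl) (by cases ty <;> rfl) ?_
    (by simpa using fun v _ t _ => h0 v t) fun s hs σ₁ k₁ h7 hI => (Runs.seq_keeps
      (B' := 180 * (n * (G.T + 1)) + (100 * ((n + L.length) * (G.T + 1)) +
        300 * work n L.length G.T ty))
      (Runs.source (st := st) hL (hσ.keeps k₁ hsafe) hs h7) fun σ₂ k₂ ⟨h₂, h₂'⟩ => ?_).le ?_
  · generalize work n L.length G.T ty = X at e1 ⊢
    have : n * (900 * X + 7) ≤ n * (910 * X) := Nat.mul_le_mul_left _ (by omega)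
    have e4 : 1 * X ≤ n * X := Nat.mul_le_mul_right _ hn
    rw [Nat.mul_left_comm n 910] at this
    simp only [WExpr.time]
    omega
  · have hσ₂ := (hσ.keeps k₁ hsafe).keeps k₂ ⟨rfl, rfl, rfl, rfl, rfl, rfl, rfl, rfl⟩
    have v7 : σ₂.var 7 = s := (k₂.var 7 rfl).trans h7
    refine Runs.seq_keeps (Runs.share hσ₂ v7 h₂ hs) fun σ₃ k₃ h₃ => ?_
    have hσ₃ := hσ₂.keeps k₃ ⟨rfl, rfl, rfl, rfl, rfl, rfl, rfl, rfl⟩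
    have hsrc₃ := h₂.keeps k₃ rfl rfl rfl rfl rfl
    refine Runs.seq_keeps (Runs.collect hL hσ₃ hs hsrc₃ h₃
      (by rw [k₃.num 2 rfl]; exact h₂')) fun σ₄ k₄ h₄ => ?_
    refine (Runs.finish hL (hσ₃.keeps k₄ ⟨rfl, rfl, rfl, rfl, rfl, rfl, rfl, rfl⟩) hs
      ((k₄.var 7 rfl).trans ((k₃.var 7 rfl).trans v7)) (hsrc₃.keeps k₄ rfl rfl rfl rfl rfl)
      (fun h => (((hret h).keeps k₁ (by cases ty <;> rfl) (by cases ty <;> rfl)).keeps k₂ rfl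
        rfl).keeps k₃ rfl rfl |>.keeps k₄ rfl rfl) (by rw [k₄.num 3 rfl]; exact h₃)
      h₄).mono le_rfl fun σ₅ _ h v hv t ht => ?_
    rw [h v hv t ht, k₄.num 0 rfl, k₃.num 0 rfl, k₂.num 0 rfl, hI v hv t ht, Finset.sum_range_succ]
  · omega

/-- The program for the walk type `ty`, where the variable `x` bounds the waiting times and `e` is
the weight of the arrival time. -/
def betweennessProg (st : Strictness) (ty : WalkType) (x : ℕ) (e : WExpr) : Prog :=
  .seq (.assign 5 e) (.seq setupProg (.seq (match ty with
    | .passive => .skip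
    | .active => returnsProg st) (.seq (.assign 4 (.var x)) (sourcesProg st ty))))

/-- One program text for all criteria: variable `1` supplies `κ = T`, which no difference of times
exceeds, and variable `3` supplies `κ = k`; the weight is `0` or `n`. -/
theorem computable (st : Strictness) (ty : WalkType) {cr : ℕ → Criterion} (x : ℕ) (e : WExpr)
    (hx : x = 1 ∨ x = 3) (he : e = .lit 0 ∨ e = .var 0)
    (hcr : ∀ (n : ℕ) (G : TemporalGraph (Fin n)) (L : List (TArc (Fin n))) (k : ℕ),
      Matches G.T n (cr k) ((inputMem G L k).var x) (e.eval (inputMem G L k))) :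
    BetweennessComputableIn ty st cr fun n m T => n * work n m T ty := by
  refine ⟨betweennessProg st ty x e, 2000, fun n G L k hn _ hnd hmem => ?_⟩
  have hL : Lists L G := ⟨hnd, hmem⟩
  have hlen : L.length = G.arcs.card := by
    classical
    rw [← List.toFinset_card_of_nodup hnd]
    congr 1
    ext a
    rw [List.mem_toFinset, hmem]
  have hm := hcr n G L k
  set κ := (inputMem G L k).var x with hκ
  set w := e.eval (inputMem G L k) with hw
  have hwn : w ≤ n := by
    rcases he with rfl | rfl
    · exact Nat.zero_le _
    · exact le_rfl
  have e1 := le_work n L.length G.T ty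
  have e2 : 1 * work n L.length G.T ty ≤ n * work n L.length G.T ty := Nat.mul_le_mul_right _ hn
  have e3 : n * ((n + L.length) * (G.T + 1)) ≤ n * work n L.length G.T ty :=
    Nat.mul_le_mul_left _ e1
  have e4 : 1 * 1 ≤ (n + L.length) * (G.T + 1) := Nat.mul_le_mul (by omega) (by omega)
  have e5 : 1 * ((n + L.length) * (G.T + 1)) ≤ n * ((n + L.length) * (G.T + 1)) :=
    Nat.mul_le_mul_right _ hn
  have he' : e.time ≤ 1 := by rcases he with rfl | rfl <;> exact le_rfl
  have main : Runs (betweennessProg st ty x e) (inputMem G L k)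
      (2000 * (n * work n L.length G.T ty)) fun σ => ∀ v < n, ∀ t ≤ G.T,
        σ.num 0 v t = ∑ s ∈ Finset.range n, contribution G st κ w ty s v t := by
    -- Variable `4` is initially `0`, which is the waiting bound wanted for the returns; the actual
    -- `κ` is assigned afterwards.
    refine (Runs.seq (Runs.assign (Runs.seq_keeps (Runs.setup (κ := 0) (w := w) (G := G) (L := L)
      rfl rfl rfl rfl rfl ?_ ?_ ?_ hn hwn) fun σ₁ k₁ h₁ => Runs.seq_keeps
      (B := 400 * (n * ((n + L.length) * (G.T + 1))))
      (Q' := fun σ' => ty = .active → ReturnRep G st σ') ?_ fun σ₂ k₂ h₂ => Runs.seq (Runs.assign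
      ((Runs.sources (κ := κ) (w := w) hL ?_ hn (fun h => ⟨(h₂ h).lvl, (h₂ h).sig⟩) ?_)))))).le ?_
    · intro i hi
      simp [inputMem, Mem.setVar, hi]
    · intro u
      simp only [inputMem, Mem.setVar]
      split <;> rfl
    · simp only [inputMem, Mem.setVar]
      split <;> rfl
    · cases ty
      · exact (Runs.skip (by simp)).le (by omega)
      · exact (Runs.returns hL h₁ hn).mono le_rfl fun _ _ h _ => h
    · have h₂' : Env G L 0 w σ₂ := h₁.keeps k₂ (by
        cases ty <;> exact ⟨rfl, rfl, rfl, rfl, rfl, rfl, rfl, rfl⟩)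
      have hx' : σ₂.var x = κ := by
        rcases hx with rfl | rfl
        · rw [k₂.var 1 (by cases ty <;> rfl), k₁.var 1 rfl]
          rfl
        · rw [k₂.var 3 (by cases ty <;> rfl), k₁.var 3 rfl]
          rfl
      exact ⟨h₂'.nodes, h₂'.tmax, by simp [Mem.setVar, WExpr.eval, hx'], h₂'.graph, h₂'.card,
        h₂'.base⟩
    · intro v t
      change σ₂.num 0 v t = 0
      rw [k₂.num 0 (by cases ty <;> rfl), k₁.num 0 rfl]
      rfl
    · simp only [WExpr.time]
      omega
  obtain ⟨τ, σ, hE, hτ, hQ⟩ := main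
  refine ⟨τ, σ, hE, by rwa [← hlen], fun v t _ ht => ?_⟩
  rw [hQ v v.2 t ht, betweenness_eq hm]

/-! ### The stated bounds and the individual criteria -/

theorem BetweennessComputableIn.mono {ty : WalkType} {st : Strictness} {cr : ℕ → Criterion}
    {f g : ℕ → ℕ → ℕ → ℕ} (h : BetweennessComputableIn ty st cr f) (c : ℕ)
    (hfg : ∀ n m T, 0 < T → f n m T ≤ c * g n m T) : BetweennessComputableIn ty st cr g := by
  obtain ⟨P, C, hP⟩ := h
  refine ⟨P, C * c, fun n G L k hn hT hnd hmem => ?_⟩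
  obtain ⟨τ, σ, hE, hτ, hQ⟩ := hP n G L k hn hT hnd hmem
  refine ⟨τ, σ, hE, hτ.trans ?_, hQ⟩
  rw [Nat.mul_assoc]
  exact Nat.mul_le_mul_left _ (hfg _ _ _ hT)

theorem work_passive_le (n m T : ℕ) (hT : 0 < T) :
    n * work n m T .passive ≤ 2 * (n ^ 2 * T + n * m * T) := by
  have : n * (n + m) * (T + 1) ≤ n * (n + m) * (2 * T) := Nat.mul_le_mul_left _ (by omega)
  calc n * work n m T .passive = n * (n + m) * (T + 1) := by rw [work]; ring
    _ ≤ n * (n + m) * (2 * T) := this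
    _ = 2 * (n ^ 2 * T + n * m * T) := by ring

theorem work_active_le (n m T : ℕ) (hT : 0 < T) :
    n * work n m T .active ≤ 4 * (n ^ 2 * T ^ 2 + n * m * T) := by
  have h1 : n ^ 2 * (T + 1) ^ 2 ≤ n ^ 2 * (2 * T) ^ 2 :=
    Nat.mul_le_mul_left _ (Nat.pow_le_pow_left (by omega) _)
  have h2 : n * m * (T + 1) ≤ n * m * (4 * T) := Nat.mul_le_mul_left _ (by omega)
  calc n * work n m T .active = n ^ 2 * (T + 1) ^ 2 + n * m * (T + 1) := by rw [work]; ring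
    _ ≤ n ^ 2 * (2 * T) ^ 2 + n * m * (4 * T) := Nat.add_le_add h1 h2
    _ = 4 * (n ^ 2 * T ^ 2 + n * m * T) := by ring

theorem matches_shortest (T n : ℕ) : Matches T n .shortest T 0 :=
  ⟨fun t t' h => by simp only [Criterion.Allows, true_iff]; omega, fun W => by simp [Criterion.cost]⟩

theorem matches_shortestRestless (T n k : ℕ) : Matches T n (.shortestRestless k) k 0 :=
  ⟨fun _ _ _ => Iff.rfl, fun W => by simp [Criterion.cost]⟩

theorem matches_shortestForemost (T n : ℕ) : Matches T n .shortestForemost T n :=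
  ⟨fun t t' h => by simp only [Criterion.Allows, true_iff]; omega, fun _ => rfl⟩

theorem computable_shortest (st : Strictness) (ty : WalkType) :
    BetweennessComputableIn ty st (fun _ => .shortest) fun n m T => n * work n m T ty :=
  computable st ty 1 (.lit 0) (.inl rfl) (.inl rfl) fun n G _ _ => matches_shortest G.T n

theorem computable_shortestRestless (st : Strictness) (ty : WalkType) :
    BetweennessComputableIn ty st (fun k => .shortestRestless k)
      fun n m T => n * work n m T ty :=
  computable st ty 3 (.lit 0) (.inr rfl) (.inl rfl) fun n G _ k => matches_shortestRestless G.T n k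

theorem computable_shortestForemost (st : Strictness) (ty : WalkType) :
    BetweennessComputableIn ty st (fun _ => .shortestForemost) fun n m T => n * work n m T ty :=
  computable st ty 1 (.var 0) (.inl rfl) (.inr rfl) fun n G _ _ => matches_shortestForemost G.T n

end

end TemporalBetweenness

theorem theorem1 (st : Strictness) :
    (BetweennessComputableIn .passive st (fun _ => .shortest)
        (fun n m T => n ^ 2 * T + n * m * T) ∧
      BetweennessComputableIn .passive st (fun k => .shortestRestless k)
        (fun n m T => n ^ 2 * T + n * m * T) ∧
      BetweennessComputableIn .passive st (fun _ => .shortestForemost)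
        (fun n m T => n ^ 2 * T + n * m * T)) ∧
    (BetweennessComputableIn .active st (fun _ => .shortest)
        (fun n m T => n ^ 2 * T ^ 2 + n * m * T) ∧
      BetweennessComputableIn .active st (fun k => .shortestRestless k)
        (fun n m T => n ^ 2 * T ^ 2 + n * m * T)) :=
  ⟨⟨(computable_shortest st .passive).mono 2 work_passive_le,
    (computable_shortestRestless st .passive).mono 2 work_passive_le,
    (computable_shortestForemost st .passive).mono 2 work_passive_le⟩,
   (computable_shortest st .active).mono 4 work_active_le,
   (computable_shortestRestless st .active).mono 4 work_active_le⟩
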